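/- For a rooted ordered tree $T$ let $|T|$ be its number of vertices, $\sigma(T)$ the number of its independent vertex subsets and $Z(T)$ the number of its independent edge subsets (matchings), the empty set being counted in both cases. Let $\sigma_1(T)$, $\sigma_2(T)$ count the independent vertex subsets that do, respectively do not, contain the root, and let $Z_1(T)$, $Z_2(T)$ count the matchings that do, respectively do not, cover the root. Put $$SS(z)=\sum_T\sigma(T)^2z^{|T|},\quad SS_{ij}(z)=\sum_T\sigma_i(T)\sigma_j(T)z^{|T|},\quad ZZ(z)=\sum_T Z(T)^2z^{|T|},\quad ZZ_{ij}(z)=\sum_T Z_i(T)Z_j(T)z^{|T|},$$ the sums being over all rooted ordered trees, and let $\sigma_n=\sigma(T_n)$, $Z_n=Z(T_n)$ for a uniformly random rooted ordered tree $T_n$ on $n$ vertices. Decimal values marked $\approx$ are correct up to half a unit in the last digit given. A power series $f$ is said to have a dominant square-root singularity at $z_0>0$ with expansion $f(z)\sim a-b\sqrt{1-z/z_0}$, where $b\neq0$, if its radius of convergence is $z_0$, it continues analytically to $\{|z|<R\}\setminus[z_0,\infty)$ for some $R>z_0$ (so that $z_0$ is its only singularity with $|z|\le z_0$), and near $z_0$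 the continuation has the form $g(z)-h(z)\sqrt{1-z/z_0}$ (principal branch), with $g,h$ analytic at $z_0$, $g(z_0)=a$ and $h(z_0)=b$. **(1)** There is $z_0\approx 0.0873832$ such that $SS$ has a dominant square-root singularity at $z_0$, with expansion $SS(z)\sim a-b\sqrt{1-z/z_0}$, $a\approx0.614803$, $b\approx0.519010$. For $|z|<z_0$ one has $SS=SS_{11}+2SS_{12}+SS_{22}$ and $$SS_{11}=\frac{z}{1-SS_{22}},\qquad SS_{12}=\frac{z}{1-SS_{12}-SS_{22}},\qquad SS_{22}=\frac{z}{1-SS_{11}-2SS_{12}-SS_{22}}$$ with non-vanishing denominators, and $s=SS(z)$ satisfies $$s^6-6s^5+(4z+14)s^4+(8z^2-20z-16)s^3+(4z^3-30z^2+36z+9)s^2-(12z^3-36z^2+28z+2)s-(z^4-8z^3+14z^2-8z)=0.$$ Moreover, as $n\to\infty$, $$\operatorname{Var}(\sigma_n)\sim 2b\,\Bigl(\frac1{4z_0}\Bigr)^n,\qquad 2b\approx 1.03802,\quad \frac1{4z_0}\approx 2.86096.$$ **(2)** There is $z_0\approx 0.107969$ such that $ZZ$ has a dominant square-root singularity at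 $z_0$, with expansion $ZZ(z)\sim a-b\sqrt{1-z/z_0}$, $a\approx0.296221$, $b\approx0.386136$. For $|z|<z_0$ one has $ZZ=ZZ_{11}+2ZZ_{12}+ZZ_{22}$ and $$ZZ_{11}=\frac{z\,ZZ_{22}}{(1-ZZ)^2}+\frac{2z(ZZ_{12}+ZZ_{22})^2}{(1-ZZ)^3},\qquad ZZ_{12}=\frac{z(ZZ_{12}+ZZ_{22})}{(1-ZZ)^2},\qquad ZZ_{22}=\frac{z}{1-ZZ}$$ with $1-ZZ\neq0$, and $s=ZZ(z)$ satisfies $$s^8-7s^7-(z-21)s^6+(4z-35)s^5+(2z^2-5z+35)s^4-(7z^2+21)s^3-(z^3-9z^2-5z-7)s^2+(2z^3-5z^2-4z-1)s+(z^4-z^3+z^2+z)=0.$$ Moreover, as $n\to\infty$, $$\operatorname{Var}(Z_n)\sim 2b\,\Bigl(\frac1{4z_0}\Bigr)^n,\qquad 2b\approx 0.77227,\quad \frac1{4z_0}\approx 2.31549.$$ -/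

import Mathlib

open Filter Topology Asymptotics MeasureTheory ProbabilityTheory

/-- Rooted ordered trees: a root together with a finite sequence of branches, each of which is
again a rooted ordered tree. -/
inductive OrderedTree : Type
  | node (k : ℕ) (branch : Fin k → OrderedTree) : OrderedTree

namespace OrderedTree

/-- The vertices of a rooted ordered tree: its root, and the vertices of its branches. -/
inductive Vertex : OrderedTree → Type
  | root (T : OrderedTree) : Vertex T
  | inBranch {k : ℕ} {branch : Fin k → OrderedTree} (i : Fin k) (v : Vertex (branch i)) :
      Vertex (node k branch)

/-- `IsParent u v`: the vertex `u` is the parent of the vertex `v`. -/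
inductive IsParent : ∀ {T : OrderedTree}, Vertex T → Vertex T → Prop
  | root {k : ℕ} {branch : Fin k → OrderedTree} (i : Fin k) :
      IsParent (Vertex.root (node k branch)) (Vertex.inBranch i (Vertex.root (branch i)))
  | inBranch {k : ℕ} {branch : Fin k → OrderedTree} (i : Fin k) {u v : Vertex (branch i)}
      (h : IsParent u v) :
      IsParent (Vertex.inBranch (branch := branch) i u) (Vertex.inBranch i v)

/-- The vertex set of a rooted ordered tree is finite, so that the cardinalities below are the
true ones. -/
instance finite_vertex (T : OrderedTree) : Finite (Vertex T) := by
  induction T with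
  | node k branch ih =>
    let f : Option (Σ i : Fin k, Vertex (branch i)) → Vertex (node k branch) := fun o =>
      match o with
      | none => Vertex.root _
      | some ⟨i, v⟩ => Vertex.inBranch i v
    refine Finite.of_surjective f ?_
    intro v
    cases v with
    | root => exact ⟨none, rfl⟩
    | inBranch i v => exact ⟨some ⟨i, v⟩, rfl⟩

/-- The underlying graph: two vertices are adjacent if one is the parent of the other. -/
def graph (T : OrderedTree) : SimpleGraph (Vertex T) :=
  SimpleGraph.fromRel IsParent

/-- The number `|T|` of vertices of `T`. -/
noncomputable def order (T : OrderedTree) : ℕ := Nat.card (Vertex T)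

/-- The independent vertex subsets of a graph (including the empty set). -/
def indepSets {V : Type} (G : SimpleGraph V) : Set (Set V) := {s | G.IsIndepSet s}

/-- The independent edge subsets, or matchings, of a graph: the sets of edges no two of which
share a vertex (including the empty set). -/
def matchings {V : Type} (G : SimpleGraph V) : Set (Set (Sym2 V)) :=
  {M | M ⊆ G.edgeSet ∧ ∀ e ∈ M, ∀ f ∈ M, e ≠ f → ∀ v, v ∈ e → v ∉ f}

/-- The `σ`-index of `T`: the number of independent vertex subsets. -/
noncomputable def sigma (T : OrderedTree) : ℕ := (indepSets T.graph).ncard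

/-- The number of independent vertex subsets of `T` containing the root. -/
noncomputable def sigma₁ (T : OrderedTree) : ℕ :=
  {s ∈ indepSets T.graph | Vertex.root T ∈ s}.ncard

/-- The number of independent vertex subsets of `T` not containing the root. -/
noncomputable def sigma₂ (T : OrderedTree) : ℕ :=
  {s ∈ indepSets T.graph | Vertex.root T ∉ s}.ncard

/-- The `Z`-index of `T`: the number of independent edge subsets. -/
noncomputable def zIndex (T : OrderedTree) : ℕ := (matchings T.graph).ncard

/-- The number of independent edge subsets of `T` that cover the root. -/
noncomputable def zIndex₁ (T : OrderedTree) : ℕ :=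
  {M ∈ matchings T.graph | ∃ e ∈ M, Vertex.root T ∈ e}.ncard

/-- The number of independent edge subsets of `T` that do not cover the root. -/
noncomputable def zIndex₂ (T : OrderedTree) : ℕ :=
  {M ∈ matchings T.graph | ¬ ∃ e ∈ M, Vertex.root T ∈ e}.ncard

/-- The generating function `∑_T w(T) z^|T|`, the sum being over all rooted ordered trees. -/
noncomputable def genFun (w : OrderedTree → ℕ) (z : ℂ) : ℂ :=
  ∑' T : OrderedTree, (w T : ℂ) * z ^ T.order

noncomputable def SS (z : ℂ) : ℂ := genFun (fun T => T.sigma * T.sigma) z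
noncomputable def SS₁₁ (z : ℂ) : ℂ := genFun (fun T => T.sigma₁ * T.sigma₁) z
noncomputable def SS₁₂ (z : ℂ) : ℂ := genFun (fun T => T.sigma₁ * T.sigma₂) z
noncomputable def SS₂₂ (z : ℂ) : ℂ := genFun (fun T => T.sigma₂ * T.sigma₂) z

noncomputable def ZZ (z : ℂ) : ℂ := genFun (fun T => T.zIndex * T.zIndex) z
noncomputable def ZZ₁₁ (z : ℂ) : ℂ := genFun (fun T => T.zIndex₁ * T.zIndex₁) z
noncomputable def ZZ₁₂ (z : ℂ) : ℂ := genFun (fun T => T.zIndex₁ * T.zIndex₂) z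
noncomputable def ZZ₂₂ (z : ℂ) : ℂ := genFun (fun T => T.zIndex₂ * T.zIndex₂) z

/-- The series `∑_T w(T) z^|T|` has radius of convergence `r`. -/
def HasConvergenceRadius (w : OrderedTree → ℕ) (r : ℝ) : Prop :=
  (∀ z : ℂ, ‖z‖ < r → Summable fun T : OrderedTree => (w T : ℂ) * z ^ T.order) ∧
  ∀ z : ℂ, r < ‖z‖ → ¬ Summable fun T : OrderedTree => (w T : ℂ) * z ^ T.order

instance : MeasurableSpace OrderedTree := ⊤

/-- The law of a uniformly random rooted ordered tree `T_n` on `n` vertices. -/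
noncomputable def uniformTree (n : ℕ) : Measure OrderedTree :=
  uniformOn {T : OrderedTree | T.order = n}

end OrderedTree

/-- The open disc of radius `R` about `0`, slit along the ray `[z₀, ∞)`. -/
def slitDisc (z₀ R : ℝ) : Set ℂ := {z | ‖z‖ < R ∧ ¬ (z.im = 0 ∧ z₀ ≤ z.re)}

/-- `f`, which is given on the disc `|z| < z₀`, has a square-root singularity at `z₀` with
expansion `a - b √(1 - z / z₀) + ⋯`, and this is the only singularity on the circle `|z| = z₀`:
`f` continues analytically to a slit disc of radius `R > z₀`, and near `z₀` the continuation is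
`g(z) - h(z) √(1 - z / z₀)` (principal branch) with `g`, `h` analytic at `z₀`,
`g(z₀) = a` and `h(z₀) = b ≠ 0`. -/
def HasDominantSqrtSingularity (f : ℂ → ℂ) (z₀ a b : ℝ) : Prop :=
  0 < z₀ ∧ b ≠ 0 ∧ ∃ R : ℝ, z₀ < R ∧ ∃ F g h : ℂ → ℂ,
    DifferentiableOn ℂ F (slitDisc z₀ R) ∧
    (∀ z : ℂ, ‖z‖ < z₀ → F z = f z) ∧
    AnalyticAt ℂ g (z₀ : ℂ) ∧ AnalyticAt ℂ h (z₀ : ℂ) ∧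
    g (z₀ : ℂ) = (a : ℂ) ∧ h (z₀ : ℂ) = (b : ℂ) ∧
    ∀ᶠ z in 𝓝[slitDisc z₀ R] (z₀ : ℂ),
      F z = g z - h z * (1 - z / (z₀ : ℂ)) ^ (1 / 2 : ℂ)

/-!
The weights `σ₁`, `σ₂`, `Z₁`, `Z₂` of a tree are computed from the branches at the root: an
independent set is a family of independent sets of the branches, avoiding their roots if it contains
the root of the tree, and a matching that covers the root uses exactly one edge to a branch. Products
of two weights are again sums over finitely many labels of products over the branches
(`OrderedTree.IsBranching`), which gives the functional equations wherever the series converge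
absolutely. Convergence comes from positive solutions of the equations: such a solution bounds the
sums over the trees of bounded height, by induction on the height
(`OrderedTree.tsum_le_of_supersolution`). At the critical point the equations have such a solution,
so the series converge, with explicit bounds, on the *closed* disc `|z| ≤ z₀`.

Both systems have genus zero and are uniformized by one parameter `x` with `x = z φ(x)`:

* for independent sets `x = SS₁₂ / (1 - SS₂₂)`, with `SS₂₂ = u = x (1 - x) / (1 - 2 x)`,
  `φ = 1 / ((1 - u)² (1 - x))` and `SS = 1 - (1 - 2 x) (1 - u)²`;
* for matchings `x = z / (1 - ZZ)²`, with `φ = P²`, `P = 1 + x + x² + 2 (x / (1 - x))²` and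
  `ZZ = 1 - 1 / P`.

The polynomial equations are checked by substituting these rational functions. The equation
`x = z φ(x)` is singular at `x = τ`, where `τ φ'(τ) = φ(τ)`, and `z₀ = τ / φ(τ)`. On the disc
`|x| ≤ τ` the map `z φ` is a strict contraction for `|z| ≤ z₀` in the sense that
`z₀ |φ(x) - φ(y)| < |x - y|`; hence `x` is the only solution there, extends analytically past every
point of the circle other than `z₀`, and is an analytic function of `√(1 - z / z₀)` near `z₀`
(`hasDominantSqrtSingularity_of_implicit`). All quantities at `τ` are enclosed in intervals.

A dominant square-root singularity determines the coefficients asymptotically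
(`HasDominantSqrtSingularity.coeff_isEquivalent`), hence the radius of convergence. The second moment
of `σ(T_n)` is the quotient of the coefficient of `SS` by the number of trees of order `n`, which is
itself, up to sign and the factor `4ⁿ / 2`, the `n`-th coefficient of `√(1 - w)`; the polynomial
factors cancel and `2 b (4 z₀)⁻ⁿ` remains. The square of the mean is exponentially smaller, because
the series of `σ` converges at some `ρ` with `4 ρ² > z₀`
(`OrderedTree.variance_isEquivalent`); the same applies to `Z`.
-/


/-! ### Independent sets and matchings of a tree in terms of its branches -/

namespace OrderedTree

section Recursion

variable {k : ℕ} {branch : Fin k → OrderedTree}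

/-- A vertex of a tree is its root or a vertex of one of its branches. -/
def vertexEquiv (k : ℕ) (branch : Fin k → OrderedTree) :
    Vertex (node k branch) ≃ Option (Σ i : Fin k, Vertex (branch i)) where
  toFun v := match v with
    | .root _ => none
    | .inBranch i v => some ⟨i, v⟩
  invFun o := match o with
    | none => Vertex.root _
    | some ⟨i, v⟩ => Vertex.inBranch i v
  left_inv v := by cases v <;> rfl
  right_inv o := by rcases o with _ | ⟨i, v⟩ <;> rfl

theorem order_node : (node k branch).order = 1 + ∑ i, (branch i).order := by
  unfold order
  rw [Nat.card_congr (vertexEquiv k branch), Finite.card_option, Nat.card_sigma, add_comm]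

theorem inBranch_injective (i : Fin k) :
    Function.Injective (Vertex.inBranch (branch := branch) i) := by
  intro u v h
  have := congrArg (vertexEquiv k branch) h
  simpa [vertexEquiv] using this

theorem inBranch_index {i j : Fin k} {u : Vertex (branch i)} {v : Vertex (branch j)}
    (h : Vertex.inBranch (branch := branch) i u = Vertex.inBranch j v) : i = j := by
  have := congrArg (vertexEquiv k branch) h
  simp only [vertexEquiv, Equiv.coe_fn_mk, Option.some.injEq, Sigma.mk.injEq] at this
  exact this.1

theorem root_ne_inBranch {i : Fin k} {u : Vertex (branch i)} :
    Vertex.root (node k branch) ≠ Vertex.inBranch i u := by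
  intro h
  cases h

theorem not_isParent_root {T : OrderedTree} {u : Vertex T} : ¬ IsParent u (Vertex.root T) := by
  intro h
  cases h

theorem isParent_root_iff {v : Vertex (node k branch)} :
    IsParent (Vertex.root (node k branch)) v ↔
      ∃ i, v = Vertex.inBranch i (Vertex.root (branch i)) := by
  constructor
  · intro h
    cases h with
    | root i => exact ⟨i, rfl⟩
  · rintro ⟨i, rfl⟩
    exact .root i

theorem isParent_inBranch_iff {i : Fin k} {u : Vertex (branch i)} {w : Vertex (node k branch)} :
    IsParent (Vertex.inBranch (branch := branch) i u) w ↔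
      ∃ v, IsParent u v ∧ w = Vertex.inBranch i v := by
  constructor
  · intro h
    cases h with
    | inBranch i h => exact ⟨_, h, rfl⟩
  · rintro ⟨v, h, rfl⟩
    exact .inBranch i h

theorem adj_inBranch {i : Fin k} {u v : Vertex (branch i)} :
    (node k branch).graph.Adj (Vertex.inBranch i u) (Vertex.inBranch i v) ↔
      (branch i).graph.Adj u v := by
  simp only [graph, SimpleGraph.fromRel_adj, isParent_inBranch_iff,
    (inBranch_injective i).eq_iff, ne_eq, (inBranch_injective i).ne_iff]
  simp

theorem adj_root_iff {w : Vertex (node k branch)} :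
    (node k branch).graph.Adj (Vertex.root _) w ↔
      ∃ i, w = Vertex.inBranch i (Vertex.root (branch i)) := by
  simp only [graph, SimpleGraph.fromRel_adj, isParent_root_iff, not_isParent_root, or_false]
  constructor
  · exact fun h => h.2
  · rintro ⟨i, rfl⟩
    exact ⟨root_ne_inBranch, i, rfl⟩

theorem adj_inBranch_index {i j : Fin k} {u : Vertex (branch i)} {v : Vertex (branch j)}
    (h : (node k branch).graph.Adj (Vertex.inBranch i u) (Vertex.inBranch j v)) : i = j := by
  simp only [graph, SimpleGraph.fromRel_adj, isParent_inBranch_iff] at h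
  rcases h.2 with ⟨w, -, hw⟩ | ⟨w, -, hw⟩
  · exact (inBranch_index hw).symm
  · exact inBranch_index hw

/-- Independent sets of a tree whose behaviour at the root is prescribed by `P` are families of
independent sets of the branches; those in the branches avoid the roots if `P` holds. -/
theorem ncard_indepSets_node (P : Prop) :
    {s ∈ indepSets (node k branch).graph | Vertex.root _ ∈ s ↔ P}.ncard =
      ∏ i, {s ∈ indepSets (branch i).graph | P → Vertex.root _ ∉ s}.ncard := by
  simp only [← Nat.card_coe_set_eq]
  rw [← Nat.card_pi]
  have hmem : ∀ s ∈ {s ∈ indepSets (node k branch).graph | Vertex.root _ ∈ s ↔ P}, ∀ i,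
      Vertex.inBranch i ⁻¹' s ∈
        {s ∈ indepSets (branch i).graph | P → Vertex.root _ ∉ s} := by
    rintro s ⟨hs, hP⟩ i
    refine ⟨fun u hu v hv huv hadj => hs hu hv ?_ (adj_inBranch.2 hadj), fun hp hr => ?_⟩
    · exact fun h => huv (inBranch_injective i h)
    · exact hs (hP.2 hp) hr root_ne_inBranch (adj_root_iff.2 ⟨i, rfl⟩)
  refine Nat.card_congr (Equiv.ofBijective
    (fun s => fun i => ⟨Vertex.inBranch i ⁻¹' s.1, hmem s.1 s.2 i⟩) ⟨?_, ?_⟩)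
  · rintro ⟨s, hs⟩ ⟨t, ht⟩ h
    simp only [funext_iff, Subtype.mk.injEq] at h
    refine Subtype.ext (Set.ext fun v => ?_)
    cases v with
    | root => exact hs.2.trans ht.2.symm
    | inBranch i v => exact Set.ext_iff.1 (h i) v
  · -- Glue a family of independent sets, adding the root of the tree if `P` holds.
    intro f
    have hpre : ∀ i, Vertex.inBranch i ⁻¹'
        ({w | (w = Vertex.root (node k branch) ∧ P) ∨
          ∃ i, ∃ v ∈ (f i).1, w = Vertex.inBranch i v} : Set (Vertex (node k branch)))
          = (f i).1 := by
      intro i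
      ext v
      simp only [Set.preimage_ofPred_eq, Set.mem_ofPred_eq]
      constructor
      · rintro (⟨h, -⟩ | ⟨j, w, hw, h⟩)
        · exact absurd h.symm root_ne_inBranch
        · obtain rfl := inBranch_index h
          exact inBranch_injective i h ▸ hw
      · exact fun hv => Or.inr ⟨i, v, hv, rfl⟩
    have hroot : Vertex.root (node k branch) ∈
        ({w | (w = Vertex.root (node k branch) ∧ P) ∨
          ∃ i, ∃ v ∈ (f i).1, w = Vertex.inBranch i v} : Set (Vertex (node k branch))) ↔ P := by
      simp only [Set.mem_ofPred_eq, true_and]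
      constructor
      · rintro (h | ⟨i, v, -, h⟩)
        · exact h
        · exact absurd h root_ne_inBranch
      · exact Or.inl
    generalize ({w | (w = Vertex.root (node k branch) ∧ P) ∨
          ∃ i, ∃ v ∈ (f i).1, w = Vertex.inBranch i v} : Set (Vertex (node k branch))) = s
      at hpre hroot
    have hin : ∀ i v, Vertex.inBranch i v ∈ s ↔ v ∈ (f i).1 := fun i v => Set.ext_iff.1 (hpre i) v
    refine ⟨⟨s, ?_, hroot⟩, funext fun i => Subtype.ext (hpre i)⟩
    have hr : ∀ i, Vertex.root (node k branch) ∈ s →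
        Vertex.inBranch i (Vertex.root (branch i)) ∉ s :=
      fun i h h' => (f i).2.2 (hroot.1 h) ((hin _ _).1 h')
    intro u hu v hv huv hadj
    cases u with
    | root =>
      obtain ⟨i, rfl⟩ := adj_root_iff.1 hadj
      exact hr i hu hv
    | inBranch i u =>
      cases v with
      | root =>
        obtain ⟨j, hj⟩ := adj_root_iff.1 hadj.symm
        exact hr j hv (hj ▸ hu)
      | inBranch j v =>
        obtain rfl := adj_inBranch_index hadj
        exact (f i).2.1 ((hin _ _).1 hu) ((hin _ _).1 hv)
          (fun h => huv (by rw [h])) (adj_inBranch.1 hadj)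

theorem sigma₁_node : (node k branch).sigma₁ = ∏ i, (branch i).sigma₂ := by
  have := ncard_indepSets_node (branch := branch) True
  simp only [iff_true, true_imp_iff] at this
  exact this

theorem sigma₂_node : (node k branch).sigma₂ = ∏ i, (branch i).sigma := by
  have := ncard_indepSets_node (branch := branch) False
  simp only [iff_false, false_imp_iff, and_true, Set.ofPred_mem_eq] at this
  exact this

theorem sigma_eq (T : OrderedTree) : T.sigma = T.sigma₁ + T.sigma₂ := by
  unfold sigma sigma₁ sigma₂
  rw [← Set.ncard_union_eq]
  · congr 1
    ext s
    simp only [Set.mem_union, Set.mem_ofPred_eq, ← and_or_left]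
    exact (and_iff_left (em _)).symm
  · rw [Set.disjoint_left]
    exact fun s h h' => h'.2 h.2

theorem zIndex_eq (T : OrderedTree) : T.zIndex = T.zIndex₁ + T.zIndex₂ := by
  unfold zIndex zIndex₁ zIndex₂
  rw [← Set.ncard_union_eq]
  · congr 1
    ext s
    simp only [Set.mem_union, Set.mem_ofPred_eq, ← and_or_left]
    exact (and_iff_left (em _)).symm
  · rw [Set.disjoint_left]
    exact fun s h h' => h'.2 h.2

theorem mem_edgeSet_node {e : Sym2 (Vertex (node k branch))} :
    e ∈ (node k branch).graph.edgeSet ↔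
      (∃ i, e = s(Vertex.root _, Vertex.inBranch i (Vertex.root _))) ∨
      ∃ i, ∃ e' ∈ (branch i).graph.edgeSet, e = e'.map (Vertex.inBranch i) := by
  constructor
  · induction e with
    | h u v =>
    intro h
    rw [SimpleGraph.mem_edgeSet] at h
    cases u with
    | root =>
      obtain ⟨i, rfl⟩ := adj_root_iff.1 h
      exact Or.inl ⟨i, rfl⟩
    | inBranch i u =>
      cases v with
      | root =>
        obtain ⟨j, hj⟩ := adj_root_iff.1 h.symm
        exact Or.inl ⟨j, by rw [hj, Sym2.eq_swap]⟩
      | inBranch j v =>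
        obtain rfl := adj_inBranch_index h
        exact Or.inr ⟨i, s(u, v), adj_inBranch.1 h, rfl⟩
  · rintro (⟨i, rfl⟩ | ⟨i, e', h, rfl⟩)
    · exact adj_root_iff.2 ⟨i, rfl⟩
    · induction e' with
      | h u v => exact adj_inBranch.2 h

theorem root_notMem_map {i : Fin k} {e : Sym2 (Vertex (branch i))} :
    Vertex.root (node k branch) ∉ e.map (Vertex.inBranch i) := by
  rw [Sym2.mem_map]
  rintro ⟨v, -, h⟩
  exact root_ne_inBranch h.symm

theorem inBranch_mem_map {i : Fin k} {v : Vertex (branch i)} {e : Sym2 (Vertex (branch i))} :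
    Vertex.inBranch (branch := branch) i v ∈ e.map (Vertex.inBranch i) ↔ v ∈ e := by
  rw [Sym2.mem_map]
  constructor
  · rintro ⟨w, hw, h⟩
    exact inBranch_injective i h ▸ hw
  · exact fun h => ⟨v, h, rfl⟩

theorem index_eq_of_mem_map {i j : Fin k} {v : Vertex (branch j)} {e : Sym2 (Vertex (branch i))}
    (h : Vertex.inBranch (branch := branch) j v ∈ e.map (Vertex.inBranch i)) : i = j := by
  obtain ⟨w, -, h⟩ := Sym2.mem_map.1 h
  exact inBranch_index h

/-- The matchings of a tree that match the root to the root of the branch `o` (or to nothing, if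
`o = none`) are families of matchings of the branches; the one in the branch `o` does not cover
its root. -/
theorem ncard_matchings_node (o : Option (Fin k)) :
    {M ∈ matchings (node k branch).graph |
      ∀ i, s(Vertex.root _, Vertex.inBranch i (Vertex.root _)) ∈ M ↔ o = some i}.ncard =
      ∏ i, {M ∈ matchings (branch i).graph |
        o = some i → ¬ ∃ e ∈ M, Vertex.root _ ∈ e}.ncard := by
  simp only [← Nat.card_coe_set_eq]
  rw [← Nat.card_pi]
  have hmem : ∀ M ∈ {M ∈ matchings (node k branch).graph |
      ∀ i, s(Vertex.root _, Vertex.inBranch i (Vertex.root _)) ∈ M ↔ o = some i}, ∀ i,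
      Sym2.map (Vertex.inBranch i) ⁻¹' M ∈
        {M ∈ matchings (branch i).graph | o = some i → ¬ ∃ e ∈ M, Vertex.root _ ∈ e} := by
    rintro M ⟨hM, ho⟩ i
    refine ⟨⟨fun e he => ?_, fun e he f hf hef v hv hv' => ?_⟩, ?_⟩
    · have := hM.1 he
      induction e with
      | h u v => exact adj_inBranch.1 this
    · exact hM.2 _ he _ hf ((Sym2.map.injective (inBranch_injective i)).ne hef) _
        (inBranch_mem_map.2 hv) (inBranch_mem_map.2 hv')
    · rintro hi ⟨e, he, hr⟩
      refine hM.2 _ ((ho i).2 hi) _ he (fun h => ?_) (Vertex.inBranch i (Vertex.root _))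
        (Sym2.mem_mk_right _ _) (inBranch_mem_map.2 hr)
      exact root_notMem_map (h ▸ Sym2.mem_mk_left _ _)
  refine Nat.card_congr (Equiv.ofBijective
    (fun M => fun i => ⟨Sym2.map (Vertex.inBranch i) ⁻¹' M.1, hmem M.1 M.2 i⟩) ⟨?_, ?_⟩)
  · have key : ∀ M ∈ {M ∈ matchings (node k branch).graph |
        ∀ i, s(Vertex.root _, Vertex.inBranch i (Vertex.root _)) ∈ M ↔ o = some i},
        ∀ N ∈ {M ∈ matchings (node k branch).graph |
        ∀ i, s(Vertex.root _, Vertex.inBranch i (Vertex.root _)) ∈ M ↔ o = some i},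
        (∀ i, Sym2.map (Vertex.inBranch i) ⁻¹' M = Sym2.map (Vertex.inBranch i) ⁻¹' N) →
        M ⊆ N := by
      intro M hM N hN h e he
      rcases mem_edgeSet_node.1 (hM.1.1 he) with ⟨i, rfl⟩ | ⟨i, e', -, rfl⟩
      · exact (hN.2 i).2 ((hM.2 i).1 he)
      · exact (Set.ext_iff.1 (h i) e').1 he
    rintro ⟨s, hs⟩ ⟨t, ht⟩ h
    simp only [funext_iff, Subtype.mk.injEq] at h
    exact Subtype.ext ((key s hs t ht h).antisymm (key t ht s hs fun i => (h i).symm))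
  · -- Glue a family of matchings, adding the edge from the root to the branch `o`, if any.
    intro f
    set M : Set (Sym2 (Vertex (node k branch))) :=
      {e | (∃ i, o = some i ∧ e = s(Vertex.root _, Vertex.inBranch i (Vertex.root _))) ∨
        ∃ i, ∃ e' ∈ (f i).1, e = e'.map (Vertex.inBranch i)} with hMdef
    have hpre : ∀ i, Sym2.map (Vertex.inBranch i) ⁻¹' M = (f i).1 := by
      intro i
      ext e
      simp only [hMdef, Set.preimage_ofPred_eq, Set.mem_ofPred_eq]
      constructor
      · rintro (⟨j, -, h⟩ | ⟨j, e', he', h⟩)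
        · exact absurd (h ▸ Sym2.mem_mk_left _ _) (root_notMem_map (e := e))
        · have hij : i = j := by
            induction e with
            | h u v =>
            exact (index_eq_of_mem_map (h ▸ inBranch_mem_map.2 (Sym2.mem_mk_left u v))).symm
          subst hij
          exact Sym2.map.injective (inBranch_injective i) h ▸ he'
      · exact fun he => Or.inr ⟨i, e, he, rfl⟩
    have hroot : ∀ i, s(Vertex.root _, Vertex.inBranch i (Vertex.root _)) ∈ M ↔ o = some i := by
      intro i
      constructor
      · rintro (⟨j, hj, h⟩ | ⟨j, e', -, h⟩)
        · rw [Sym2.congr_right] at h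
          rw [inBranch_index h, hj]
        · exact absurd (h ▸ Sym2.mem_mk_left _ _) (root_notMem_map (e := e'))
      · exact fun h => Or.inl ⟨i, h, rfl⟩
    have hmix : ∀ i j, o = some i → ∀ e' ∈ (f j).1, ∀ v,
        v ∈ s(Vertex.root (node k branch), Vertex.inBranch i (Vertex.root _)) →
        v ∉ e'.map (Vertex.inBranch j) := by
      intro i j hi e' he' v hv hv'
      rcases Sym2.mem_iff.1 hv with rfl | rfl
      · exact root_notMem_map hv'
      · obtain rfl := index_eq_of_mem_map hv'
        exact (f j).2.2 hi ⟨e', he', inBranch_mem_map.1 hv'⟩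
    refine ⟨⟨M, ⟨?_, ?_⟩, hroot⟩, funext fun i => Subtype.ext (hpre i)⟩
    · rintro e (⟨i, hi, rfl⟩ | ⟨i, e', he', rfl⟩)
      · exact mem_edgeSet_node.2 (Or.inl ⟨i, rfl⟩)
      · exact mem_edgeSet_node.2 (Or.inr ⟨i, e', (f i).2.1.1 he', rfl⟩)
    · rintro e (⟨i, hi, rfl⟩ | ⟨i, e', he', rfl⟩) g (⟨j, hj, rfl⟩ | ⟨j, g', hg', rfl⟩) hne v hv hv'
      · rw [hi] at hj
        obtain rfl := Option.some.inj hj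
        exact hne rfl
      · exact hmix i j hi g' hg' v hv hv'
      · exact hmix j i hj e' he' v hv' hv
      · obtain ⟨u, hu, rfl⟩ := Sym2.mem_map.1 hv
        obtain rfl := index_eq_of_mem_map hv'
        exact (f j).2.1.2 _ he' _ hg' (fun h => hne (by rw [h])) u hu (inBranch_mem_map.1 hv')

theorem covers_root_iff {M : Set (Sym2 (Vertex (node k branch)))}
    (hM : M ∈ matchings (node k branch).graph) :
    (∃ e ∈ M, Vertex.root _ ∈ e) ↔
      ∃ i, s(Vertex.root _, Vertex.inBranch i (Vertex.root (branch i))) ∈ M := by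
  constructor
  · rintro ⟨e, he, hr⟩
    rcases mem_edgeSet_node.1 (hM.1 he) with ⟨i, rfl⟩ | ⟨i, e', -, rfl⟩
    · exact ⟨i, he⟩
    · exact absurd hr root_notMem_map
  · rintro ⟨i, hi⟩
    exact ⟨_, hi, Sym2.mem_mk_left _ _⟩

theorem zIndex₂_node : (node k branch).zIndex₂ = ∏ i, (branch i).zIndex := by
  have := ncard_matchings_node (branch := branch) none
  simp only [reduceCtorEq, iff_false, false_imp_iff, and_true, Set.ofPred_mem_eq] at this
  unfold zIndex₂
  rw [show {M ∈ matchings (node k branch).graph | ¬ ∃ e ∈ M, Vertex.root _ ∈ e} =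
    {M ∈ matchings (node k branch).graph |
      ∀ i, s(Vertex.root _, Vertex.inBranch i (Vertex.root _)) ∉ M} from ?_, this]
  · rfl
  · ext M
    simp only [Set.mem_ofPred_eq]
    refine and_congr_right fun hM => ?_
    rw [covers_root_iff hM, not_exists]

/-- A matching that covers the root uses the edge to exactly one branch `i`. -/
theorem zIndex₁_node :
    (node k branch).zIndex₁ =
      ∑ i, ∏ j, if j = i then (branch j).zIndex₂ else (branch j).zIndex := by
  have h : ∀ i : Fin k, (∏ j, if j = i then (branch j).zIndex₂ else (branch j).zIndex) =
      {M ∈ matchings (node k branch).graph | ∀ j,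
        s(Vertex.root _, Vertex.inBranch j (Vertex.root _)) ∈ M ↔ some i = some j}.ncard := by
    intro i
    rw [ncard_matchings_node]
    refine Finset.prod_congr rfl fun j _ => ?_
    split_ifs with hij
    · simp [zIndex₂, hij]
    · simp [zIndex, Ne.symm hij]
  simp only [h]
  unfold zIndex₁
  rw [← finsum_eq_sum_of_fintype, ← Set.ncard_iUnion_of_finite]
  · congr 1
    ext M
    simp only [Set.mem_ofPred_eq, Set.mem_iUnion, exists_and_left]
    refine and_congr_right fun hM => ?_
    rw [covers_root_iff hM]
    refine exists_congr fun i => ⟨fun hi j => ⟨fun hj => ?_, fun hj => ?_⟩, fun hi => (hi i).2 rfl⟩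
    · by_contra hne
      refine hM.2 _ hi _ hj (fun h => hne ?_) _ (Sym2.mem_mk_left _ _) (Sym2.mem_mk_left _ _)
      rw [Sym2.congr_right] at h
      rw [inBranch_index h]
    · exact Option.some.inj hj ▸ hi
  · intro i
    exact Set.toFinite _
  · intro i j hij
    refine Set.disjoint_left.2 fun M hM hM' => hij ?_
    exact (Option.some.inj ((hM'.2 i).1 ((hM.2 i).2 rfl))).symm

end Recursion

end OrderedTree

/-! ### Sums of products over tuples -/

open scoped ENNReal in
theorem ENNReal.tsum_pi_prod {α : Type*} (k : ℕ) (f : Fin k → α → ℝ≥0∞) :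
    ∑' g : Fin k → α, ∏ i, f i (g i) = ∏ i, ∑' a, f i a := by
  induction k with
  | zero => simp
  | succ k ih =>
    rw [← (Fin.consEquiv fun _ => α).tsum_eq, ENNReal.tsum_prod', Fin.prod_univ_succ]
    simp only [Fin.consEquiv_apply, Fin.prod_univ_succ, Fin.cons_zero, Fin.cons_succ]
    simp only [ENNReal.tsum_mul_left, ih, ENNReal.tsum_mul_right]

theorem hasSum_pi_prod_of_summable_norm {α : Type*} (k : ℕ) (f : Fin k → α → ℂ)
    (hf : ∀ i, Summable fun a => ‖f i a‖) :
    (Summable fun g : Fin k → α => ‖∏ i, f i (g i)‖) ∧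
      ∑' g : Fin k → α, ∏ i, f i (g i) = ∏ i, ∑' a, f i a := by
  induction k with
  | zero => exact ⟨(hasSum_fintype _).summable, by simp⟩
  | succ k ih =>
    obtain ⟨h1, h2⟩ := ih (fun i => f i.succ) fun i => hf i.succ
    constructor
    · rw [← (Fin.consEquiv fun _ => α).summable_iff]
      refine ((hf 0).mul_of_nonneg h1 (fun _ => norm_nonneg _) fun _ => norm_nonneg _).congr ?_
      rintro ⟨a, g⟩
      simp [Fin.prod_univ_succ, Fin.consEquiv_apply]
    · rw [← (Fin.consEquiv fun _ => α).tsum_eq, Fin.prod_univ_succ, ← h2,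
        tsum_mul_tsum_of_summable_norm (hf 0) h1]
      refine tsum_congr ?_
      rintro ⟨a, g⟩
      simp [Fin.prod_univ_succ, Fin.consEquiv_apply]

section MarkedProducts

variable {R : Type*} [CommSemiring R] {k : ℕ}

theorem prod_ite_eq_mul_pow (i : Fin k) (a b : R) :
    (∏ j, if j = i then a else b) = a * b ^ (k - 1) := by
  rw [← Finset.mul_prod_erase _ _ (Finset.mem_univ i), if_pos rfl]
  congr 1
  rw [Finset.prod_congr rfl fun j hj => if_neg (Finset.ne_of_mem_erase hj)]
  simp

theorem sum_prod_ite_eq (a b : R) :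
    (∑ i : Fin k, ∏ j, if j = i then a else b) = k * (a * b ^ (k - 1)) := by
  simp [prod_ite_eq_mul_pow]

/-- The label of the branch `l` in the product of two marked products, with marks at `i` and
at `j`. -/
def pairLabel {β : Type*} {k : ℕ} (a b c : β) (e : Fin k × Fin k) (l : Fin k) : β :=
  if l = e.1 then (if l = e.2 then a else b) else (if l = e.2 then b else c)

theorem sum_prod_pairLabel_eq (a b c : R) :
    (∑ e : Fin k × Fin k, ∏ l, pairLabel a b c e l) =
      k * (a * c ^ (k - 1)) + (k * (k - 1) : ℕ) * (b ^ 2 * c ^ (k - 2)) := by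
  have hoff : ∀ i j : Fin k, j ≠ i → ∏ l, pairLabel a b c (i, j) l = b ^ 2 * c ^ (k - 2) := by
    intro i j hij
    rw [← Finset.mul_prod_erase _ _ (Finset.mem_univ i),
      ← Finset.mul_prod_erase _ _ (Finset.mem_erase.2 ⟨hij, Finset.mem_univ j⟩),
      Finset.prod_congr rfl (g := fun _ => c)]
    · simp only [pairLabel, if_pos, if_neg hij, if_neg hij.symm, Finset.prod_const]
      rw [Finset.card_erase_of_mem (by simp [hij]), Finset.card_erase_of_mem (by simp)]
      simp only [Finset.card_univ, Fintype.card_fin, Nat.sub_sub]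
      ring
    · intro l hl
      simp only [Finset.mem_erase, Finset.mem_univ, and_true] at hl
      simp [pairLabel, hl.1, hl.2]
  have hdiag : ∀ i : Fin k, ∏ l, pairLabel a b c (i, i) l = a * c ^ (k - 1) := by
    intro i
    rw [← prod_ite_eq_mul_pow i a c]
    refine Finset.prod_congr rfl fun l _ => ?_
    unfold pairLabel
    split_ifs <;> rfl
  rw [Fintype.sum_prod_type]
  have : ∀ i : Fin k, ∑ j, ∏ l, pairLabel a b c (i, j) l =
      a * c ^ (k - 1) + (k - 1 : ℕ) * (b ^ 2 * c ^ (k - 2)) := by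
    intro i
    rw [← Finset.add_sum_erase _ _ (Finset.mem_univ i), hdiag,
      Finset.sum_congr rfl fun j hj => hoff i j (Finset.ne_of_mem_erase hj)]
    simp
  simp only [this, Finset.sum_const, Finset.card_univ, Fintype.card_fin, nsmul_eq_mul]
  push_cast
  ring

end MarkedProducts

section GeometricSums

variable {𝕜 : Type*} [NormedField 𝕜]

theorem hasSum_succ_mul_geometric {b : 𝕜} (hb : ‖b‖ < 1) :
    HasSum (fun k : ℕ => (k : 𝕜) * b ^ (k - 1)) (1 / (1 - b) ^ 2) := by
  rw [← hasSum_nat_add_iff' 1]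
  simpa using hasSum_choose_mul_geometric_of_norm_lt_one 1 hb

theorem hasSum_sum_prod_ite (a : 𝕜) {b : 𝕜} (hb : ‖b‖ < 1) :
    HasSum (fun k : ℕ => ∑ i : Fin k, ∏ j, if j = i then a else b) (a / (1 - b) ^ 2) := by
  simp only [sum_prod_ite_eq]
  convert! (hasSum_succ_mul_geometric hb).mul_left a using 1
  · ext k; ring
  · ring

/-- Of the pairs of marks among `k` branches, `k` are coincident and `k (k - 1)` are not, whence the
first and the second derivative of the geometric series. -/
theorem hasSum_sum_prod_pairLabel (a b : 𝕜) {c : 𝕜} (hc : ‖c‖ < 1) :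
    HasSum (fun k : ℕ => ∑ e : Fin k × Fin k, ∏ l, pairLabel a b c e l)
      (a / (1 - c) ^ 2 + 2 * b ^ 2 / (1 - c) ^ 3) := by
  simp only [sum_prod_pairLabel_eq]
  have h2 : HasSum (fun k : ℕ => ((k * (k - 1) : ℕ) : 𝕜) * c ^ (k - 2)) (2 / (1 - c) ^ 3) := by
    rw [← hasSum_nat_add_iff' 2]
    convert! (hasSum_choose_mul_geometric_of_norm_lt_one 2 hc).mul_left 2 using 1
    · ext n
      have : (n + 2) * (n + 2 - 1) = 2 * (n + 2).choose 2 := by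
        rw [Nat.choose_two_right, Nat.mul_div_cancel' (Nat.even_mul_pred_self (n + 2)).two_dvd]
      rw [this]
      push_cast
      rw [mul_assoc]
    · simp [Finset.sum_range_succ, div_eq_mul_inv]
  convert! ((hasSum_succ_mul_geometric hc).mul_left a).add (h2.mul_left (b ^ 2)) using 1
  · ext k; ring
  · ring

end GeometricSums

/-! ### Sums over rooted ordered trees -/

namespace OrderedTree

open scoped ENNReal

/-- A rooted ordered tree is the sequence of its branches. -/
def nodeEquiv : (Σ k : ℕ, Fin k → OrderedTree) ≃ OrderedTree where
  toFun p := node p.1 p.2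
  invFun T := match T with
    | .node k branch => ⟨k, branch⟩
  left_inv _ := rfl
  right_inv T := by cases T; rfl

/-- The trees of height less than `h`, where a single vertex has height `0`. -/
def heightLT : ℕ → Set OrderedTree
  | 0 => ∅
  | h + 1 => Set.range fun p : Σ k : ℕ, Fin k → heightLT h => node p.1 fun i => p.2 i

theorem heightLT_succ_mono {h : ℕ} : heightLT h ⊆ heightLT (h + 1) := by
  induction h with
  | zero => exact Set.empty_subset _
  | succ h ih =>
    rintro _ ⟨⟨k, g⟩, rfl⟩
    exact ⟨⟨k, fun i => ⟨g i, ih (g i).2⟩⟩, rfl⟩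

theorem heightLT_mono : Monotone heightLT := monotone_nat_of_le_succ fun _ => heightLT_succ_mono

theorem exists_mem_heightLT (T : OrderedTree) : ∃ h, T ∈ heightLT h := by
  induction T with
  | node k branch ih =>
    choose h hh using ih
    obtain ⟨m, hm⟩ := (Set.finite_range h).bddAbove
    exact ⟨m + 1, ⟨k, fun i => ⟨branch i, heightLT_mono (hm ⟨i, rfl⟩) (hh i)⟩⟩, rfl⟩

/-- A supersolution of the system of equations for tree sums bounds the tree sums: sums over the
trees of bounded height are bounded inductively. -/
theorem tsum_le_of_supersolution {ι : Type*} (f : ι → OrderedTree → ℝ≥0∞) (B : ι → ℝ≥0∞)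
    (hB : ∀ E : Set OrderedTree, (∀ i, ∑' T : E, f i T ≤ B i) →
      ∀ i, ∑' k, ∑' g : Fin k → E, f i (node k fun l => g l) ≤ B i) (i : ι) :
    ∑' T, f i T ≤ B i := by
  have hE : ∀ h, ∀ i, ∑' T : heightLT h, f i T ≤ B i := by
    intro h
    induction h with
    | zero =>
      intro i
      have : IsEmpty (heightLT 0) := Set.isEmpty_coe_sort.2 rfl
      simp
    | succ h ih =>
      intro i
      have hinj : Function.Injective
          fun p : Σ k : ℕ, Fin k → heightLT h => node p.1 fun i => p.2 i := by
        rintro ⟨k, g⟩ ⟨k', g'⟩ hp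
        simp only [node.injEq] at hp
        obtain ⟨rfl, hp⟩ := hp
        congr
        funext l
        exact Subtype.ext (congrFun (eq_of_heq hp) l)
      refine le_trans (le_of_eq ?_) (hB _ ih i)
      rw [← ENNReal.tsum_sigma' fun p : Σ k : ℕ, Fin k → heightLT h =>
        f i (node p.1 fun i => p.2 i)]
      exact tsum_range (f i) hinj
  rw [ENNReal.tsum_eq_iSup_sum]
  refine iSup_le fun s => ?_
  choose h hh using exists_mem_heightLT
  have hs : ∀ T ∈ s, T ∈ heightLT (s.sup h) := fun T hT =>
    heightLT_mono (Finset.le_sup hT) (hh T)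
  refine le_trans ?_ (hE (s.sup h) i)
  rw [← Finset.tsum_subtype' s (f i)]
  exact ENNReal.tsum_mono_subtype (f i) fun T hT => hs T hT

/-- The term of the tree `T` in the generating function with weight `w`. -/
noncomputable def term {R : Type*} [CommSemiring R] (w : OrderedTree → ℕ) (x : R)
    (T : OrderedTree) : R :=
  w T * x ^ T.order

/-- `w` satisfies a branching recursion if its value at a tree is a sum, over an index `e`, of
products over the branches `l` of weights `v k e l`. -/
def IsBranching {κ : ℕ → Type} [∀ k, Fintype (κ k)] (w : OrderedTree → ℕ)
    (v : ∀ k, κ k → Fin k → OrderedTree → ℕ) : Prop :=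
  ∀ k (g : Fin k → OrderedTree), w (node k g) = ∑ e, ∏ l, v k e l (g l)

section Branching

variable {κ : ℕ → Type} [∀ k, Fintype (κ k)] {w : OrderedTree → ℕ}
  {v : ∀ k, κ k → Fin k → OrderedTree → ℕ}

theorem IsBranching.term_node {R : Type*} [CommSemiring R] (h : IsBranching w v) (x : R) (k : ℕ)
    (g : Fin k → OrderedTree) :
    term w x (node k g) = x * ∑ e, ∏ l, term (v k e l) x (g l) := by
  simp only [term, h k g, order_node, pow_add, pow_one, Finset.prod_mul_distrib,
    Finset.prod_pow_eq_pow_sum, ← Finset.sum_mul]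
  push_cast
  ring

theorem IsBranching.tsum_node (h : IsBranching w v) (x : ℝ≥0∞) (k : ℕ) (E : Set OrderedTree) :
    ∑' g : Fin k → E, term w x (node k fun l => g l) =
      x * ∑ e, ∏ l, ∑' T : E, term (v k e l) x T := by
  simp only [h.term_node, ENNReal.tsum_mul_left]
  rw [Summable.tsum_finsetSum fun _ _ => ENNReal.summable]
  congr 1
  refine Finset.sum_congr rfl fun e _ => ?_
  exact ENNReal.tsum_pi_prod k fun l (T : E) => term (v k e l) x T

theorem IsBranching.hasSum (h : IsBranching w v) (z : ℂ) (hw : Summable (term w z))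
    (hv : ∀ k e l, Summable fun T => ‖term (v k e l) z T‖) :
    HasSum (fun k => z * ∑ e, ∏ l, ∑' T, term (v k e l) z T) (∑' T, term w z T) := by
  have h1 : HasSum (fun p : Σ k : ℕ, Fin k → OrderedTree => term w z (nodeEquiv p))
      (∑' T, term w z T) := nodeEquiv.hasSum_iff.2 hw.hasSum
  refine h1.sigma fun k => ?_
  simp only [nodeEquiv, Equiv.coe_fn_mk, h.term_node]
  refine HasSum.mul_left z (hasSum_sum fun e _ => ?_)
  obtain ⟨h2, h3⟩ := hasSum_pi_prod_of_summable_norm k (fun l T => term (v k e l) z T)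
    (hv k e)
  rw [← h3]
  exact h2.of_norm.hasSum

end Branching

/-- Passage from a bound in `[0, ∞]`, where convergence is not an issue, to absolute convergence in
a closed disc. -/
theorem summable_norm_term_of_tsum_le {w : OrderedTree → ℕ} {x B : ℝ} (hx : 0 ≤ x)
    (hB0 : 0 ≤ B) (hB : ∑' T, term w (ENNReal.ofReal x) T ≤ ENNReal.ofReal B) {z : ℂ}
    (hz : ‖z‖ ≤ x) :
    (Summable fun T => ‖term w z T‖) ∧ ‖∑' T, term w z T‖ ≤ B := by
  have hterm : ∀ T, term w (ENNReal.ofReal x) T = ENNReal.ofReal (term w x T) := by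
    intro T
    simp only [term]
    rw [ENNReal.ofReal_mul (Nat.cast_nonneg _), ENNReal.ofReal_natCast, ENNReal.ofReal_pow hx]
  have hnn : ∀ T, 0 ≤ term w x T := fun T => mul_nonneg (Nat.cast_nonneg _) (pow_nonneg hx _)
  simp only [hterm] at hB
  have hsum : Summable fun T => term w x T := by
    have := ENNReal.summable_toReal (ne_top_of_le_ne_top ENNReal.ofReal_ne_top hB)
    simpa only [ENNReal.toReal_ofReal (hnn _)] using this
  have hle : ∀ T, ‖term w z T‖ ≤ term w x T := by
    intro T
    simp only [term, norm_mul, norm_pow, Complex.norm_natCast]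
    gcongr
  rw [← ENNReal.ofReal_tsum_of_nonneg hnn hsum, ENNReal.ofReal_le_ofReal_iff hB0] at hB
  exact ⟨hsum.of_nonneg_of_le (fun _ => norm_nonneg _) hle,
    (tsum_of_norm_bounded hsum.hasSum hle).trans hB⟩

theorem tsum_ofReal_le {f : ℕ → ℝ≥0∞} {g : ℕ → ℝ} {S : ℝ} (hf : ∀ k, f k ≤ ENNReal.ofReal (g k))
    (hg0 : ∀ k, 0 ≤ g k) (hg : HasSum g S) : ∑' k, f k ≤ ENNReal.ofReal S := by
  rw [← hg.tsum_eq, ENNReal.ofReal_tsum_of_nonneg hg0 hg.summable]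
  exact ENNReal.tsum_le_tsum hf

end OrderedTree

/-! ### Functions that are analytic in `√(1 - z / z₀)` -/

/-- The principal square root. -/
noncomputable def csqrt (w : ℂ) : ℂ := w ^ (1 / 2 : ℂ)

theorem csqrt_sq (w : ℂ) : csqrt w ^ 2 = w := by
  simp [csqrt, one_div]

theorem csqrt_of_sq {t : ℂ} (ht : 0 < t.re) : csqrt (t ^ 2) = t := by
  have := Complex.sq_cpow_two_inv ht
  simpa [csqrt, one_div] using this

theorem csqrt_zero : csqrt 0 = 0 := by simp [csqrt]

theorem analyticAt_csqrt {w : ℂ} (hw : w ∈ Complex.slitPlane) : AnalyticAt ℂ csqrt w :=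
  analyticAt_id.cpow analyticAt_const hw

theorem csqrt_re_pos {w : ℂ} (hw : w ∈ Complex.slitPlane) : 0 < (csqrt w).re := by
  have hw0 := Complex.slitPlane_ne_zero hw
  rw [csqrt, Complex.cpow_def_of_ne_zero hw0, Complex.exp_re]
  refine mul_pos (Real.exp_pos _) (Real.cos_pos_of_mem_Ioo ?_)
  have h1 := Complex.neg_pi_lt_arg w
  have h2 := Complex.arg_le_pi w
  have h3 := (Complex.mem_slitPlane_iff_arg.1 hw).1
  have h4 : Complex.arg w < Real.pi := lt_of_le_of_ne h2 h3
  have : (Complex.log w * (1 / 2)).im = Complex.arg w / 2 := by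
    simp [Complex.mul_im, Complex.log_im]
    ring
  rw [this]
  constructor <;> linarith

theorem continuous_csqrt_zero : ContinuousAt csqrt 0 := by
  rw [ContinuousAt, csqrt_zero, tendsto_zero_iff_norm_tendsto_zero]
  have : ∀ w : ℂ, ‖csqrt w‖ = Real.sqrt ‖w‖ := by
    intro w
    rw [← csqrt_sq w, norm_pow, Real.sqrt_sq (norm_nonneg _), csqrt_sq]
  simp only [this]
  have h : ContinuousAt (fun w : ℂ => Real.sqrt ‖w‖) 0 := by fun_prop
  simpa [ContinuousAt] using h

/-- An even function that is analytic at `0` is an analytic function of the square. -/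
theorem exists_analyticAt_comp_sq {e : ℂ → ℂ} (he : AnalyticAt ℂ e 0) (heven : ∀ t, e (-t) = e t) :
    ∃ E : ℂ → ℂ, AnalyticAt ℂ E 0 ∧ ∀ t, E (t ^ 2) = e t := by
  have hsq : ∀ s t : ℂ, s ^ 2 = t ^ 2 → e s = e t := by
    intro s t h
    rcases sq_eq_sq_iff_eq_or_eq_neg.1 h with rfl | rfl
    · rfl
    · exact heven t
  refine ⟨fun w => e (csqrt w), ?_, fun t => hsq _ _ (csqrt_sq _)⟩
  have hcont : Tendsto csqrt (𝓝 0) (𝓝 0) := by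
    simpa [ContinuousAt, csqrt_zero] using continuous_csqrt_zero
  refine Complex.analyticAt_of_differentiable_on_punctured_nhds_of_continuousAt ?_ ?_
  · have h1 : ∀ᶠ w in 𝓝 (0 : ℂ), AnalyticAt ℂ e (csqrt w) :=
      hcont.eventually he.eventually_analyticAt
    have h2 : ∀ᶠ w in 𝓝 (0 : ℂ), AnalyticAt ℂ e (Complex.I * csqrt (-w)) := by
      have : Tendsto (fun w => Complex.I * csqrt (-w)) (𝓝 0) (𝓝 0) := by
        have h0 : Tendsto (fun w : ℂ => -w) (𝓝 0) (𝓝 0) := by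
          simpa using (continuous_neg (G := ℂ)).tendsto 0
        simpa using (hcont.comp h0).const_mul Complex.I
      exact this.eventually he.eventually_analyticAt
    rw [eventually_nhdsWithin_iff]
    filter_upwards [h1, h2] with w hw1 hw2 hw0
    rcases Complex.mem_slitPlane_or_neg_mem_slitPlane hw0 with hw | hw
    · exact (hw1.comp (analyticAt_csqrt hw)).differentiableAt
    · -- On the cut the root can be taken along the other side, as `e` does not see its sign.
      have heq : (fun w => e (csqrt w)) = fun w => e (Complex.I * csqrt (-w)) := by
        funext v
        refine hsq _ _ ?_
        rw [mul_pow, csqrt_sq, csqrt_sq, Complex.I_sq]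
        ring
      rw [heq]
      have h3 : AnalyticAt ℂ (fun v => Complex.I * csqrt (-v)) w :=
        analyticAt_const.mul ((analyticAt_csqrt hw).comp analyticAt_id.neg)
      exact (hw2.comp (f := fun v => Complex.I * csqrt (-v)) h3).differentiableAt
  · have : ContinuousAt e (csqrt 0) := by simpa [csqrt_zero] using he.continuousAt
    exact this.comp continuous_csqrt_zero

theorem one_sub_div_mem_slitPlane {z₀ R : ℝ} (hz₀ : 0 < z₀) {z : ℂ} (hz : z ∈ slitDisc z₀ R) :
    1 - z / z₀ ∈ Complex.slitPlane := by
  have hre : (z / z₀).re = z.re / z₀ := by simp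
  have him : (z / z₀).im = z.im / z₀ := by simp
  rw [Complex.mem_slitPlane_iff]
  simp only [Complex.sub_re, Complex.one_re, Complex.sub_im, Complex.one_im, hre, him]
  by_cases h : z.im = 0
  · left
    have h2 : z.re < z₀ := by
      by_contra hc
      exact hz.2 ⟨h, not_lt.1 hc⟩
    have := (div_lt_one hz₀).2 h2
    linarith
  · right
    have := div_ne_zero h hz₀.ne'
    simpa using this

/-- If `f(z) = G(√(1 - z / z₀))` with `G` analytic in a neighbourhood of the set that
`√(1 - z / z₀)` describes for `|z| ≤ z₀`, then `f` has a square-root singularity at `z₀`: the even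
and the odd part of `G` yield the two analytic functions of the local expansion. -/
theorem hasDominantSqrtSingularity_of_comp_sqrt {f G : ℂ → ℂ} {W : Set ℂ} {z₀ a b : ℝ}
    (hz₀ : 0 < z₀) (hW : IsOpen W) (hL : ∀ t : ℂ, 0 ≤ t.re → ‖1 - t ^ 2‖ ≤ 1 → t ∈ W)
    (hG : DifferentiableOn ℂ G W) (hf : ∀ z : ℂ, ‖z‖ < z₀ → f z = G (csqrt (1 - z / z₀)))
    (ha : G 0 = a) (hb : deriv G 0 = -b) (hb0 : b ≠ 0) :
    HasDominantSqrtSingularity f z₀ a b := by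
  have hz₀' : (z₀ : ℂ) ≠ 0 := by exact_mod_cast hz₀.ne'
  -- A slightly larger disc is still mapped into `W`.
  obtain ⟨ρ, hρ, hρW⟩ : ∃ ρ : ℝ, 1 < ρ ∧ ∀ t : ℂ, 0 ≤ t.re → ‖1 - t ^ 2‖ < ρ → t ∈ W := by
    set C : Set ℂ := {t | 0 ≤ t.re ∧ ‖1 - t ^ 2‖ ≤ 2} \ W with hC
    have hCc : IsCompact C := by
      refine Metric.isCompact_of_isClosed_isBounded ?_ ?_
      · refine IsClosed.sdiff ?_ hW
        exact (isClosed_le continuous_const Complex.continuous_re).inter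
          (isClosed_le (f := fun t : ℂ => ‖1 - t ^ 2‖) (by fun_prop) continuous_const)
      · refine (Metric.isBounded_closedBall (x := (0 : ℂ)) (r := 2)).subset ?_
        rintro t ⟨⟨-, ht⟩, -⟩
        rw [mem_closedBall_zero_iff]
        have h1 : ‖t‖ ^ 2 ≤ 3 := by
          rw [← norm_pow]
          calc ‖t ^ 2‖ = ‖1 - (1 - t ^ 2)‖ := by ring_nf
            _ ≤ ‖(1 : ℂ)‖ + ‖1 - t ^ 2‖ := norm_sub_le _ _
            _ ≤ 3 := by rw [norm_one]; linarith
        nlinarith [norm_nonneg t]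
    rcases C.eq_empty_or_nonempty with hne | hne
    · refine ⟨2, one_lt_two, fun t ht ht' => ?_⟩
      by_contra htW
      have : t ∈ C := ⟨⟨ht, ht'.le⟩, htW⟩
      rw [hne] at this
      exact this
    · obtain ⟨t₀, ht₀, hmin⟩ := hCc.exists_isMinOn hne
        (f := fun t : ℂ => ‖1 - t ^ 2‖) (by fun_prop)
      have h1 : 1 < ‖1 - t₀ ^ 2‖ := by
        by_contra hc
        exact ht₀.2 (hL t₀ ht₀.1.1 (not_lt.1 hc))
      refine ⟨min 2 ‖1 - t₀ ^ 2‖, lt_min one_lt_two h1, fun t ht ht' => ?_⟩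
      by_contra htW
      have h2 : t ∈ C := ⟨⟨ht, ht'.le.trans (min_le_left _ _)⟩, htW⟩
      exact absurd (ht'.trans_le (min_le_right _ _)) (not_lt.2 (hmin h2))
  have hmaps : ∀ z ∈ slitDisc z₀ (z₀ * ρ), csqrt (1 - z / z₀) ∈ W := by
    intro z hz
    refine hρW _ (csqrt_re_pos (one_sub_div_mem_slitPlane hz₀ hz)).le ?_
    rw [csqrt_sq, sub_sub_cancel, norm_div, Complex.norm_real, Real.norm_of_nonneg hz₀.le,
      div_lt_iff₀ hz₀, mul_comm]
    exact hz.1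
  have h0W : (0 : ℂ) ∈ W := hL 0 (by simp) (by simp)
  have hG0 : AnalyticAt ℂ G 0 := hG.analyticAt (hW.mem_nhds h0W)
  have hGneg : AnalyticAt ℂ (fun t => G (-t)) 0 := by
    have : AnalyticAt ℂ G (-0) := by simpa using hG0
    exact this.comp (f := fun t : ℂ => -t) analyticAt_id.neg
  obtain ⟨E, hE, hEsq⟩ := exists_analyticAt_comp_sq (e := fun t => (G t + G (-t)) / 2)
    ((hG0.add hGneg).div_const) (fun t => by simp [add_comm])
  set O : ℂ → ℂ := fun t => (G t - G (-t)) / 2 with hO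
  have hOa : AnalyticAt ℂ O 0 := (hG0.sub hGneg).div_const
  have hO0 : O 0 = 0 := by simp [hO]
  have hOd : deriv O 0 = -b := by
    have h1 : HasDerivAt G (-b : ℂ) 0 := hb ▸ hG0.differentiableAt.hasDerivAt
    have h2 : HasDerivAt (fun t => G (-t)) (b : ℂ) 0 := by
      have h3 : HasDerivAt G (-b : ℂ) (-0) := by simpa using h1
      have h5 := h3.comp (0 : ℂ) (hasDerivAt_neg (0 : ℂ))
      rw [mul_neg_one, neg_neg] at h5
      exact h5
    have h4 := ((h1.sub h2).div_const 2).deriv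
    rw [show deriv O 0 = deriv (fun t => (G t - G (-t)) / 2) 0 from rfl]
    refine h4.trans ?_
    ring
  have hslope : AnalyticAt ℂ (dslope O 0) 0 := by
    obtain ⟨p, hp⟩ := hOa
    exact ⟨_, hp.has_fpower_series_dslope_fslope⟩
  obtain ⟨D, hD, hDsq⟩ := exists_analyticAt_comp_sq (e := dslope O 0) hslope (by
    intro t
    rcases eq_or_ne t 0 with rfl | ht
    · simp
    · rw [dslope_of_ne _ ht, dslope_of_ne _ (neg_ne_zero.2 ht)]
      simp only [slope_def_field, hO]
      simp only [neg_neg, sub_zero, neg_zero, sub_self, zero_div]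
      field_simp
      ring)
  have hlin : AnalyticAt ℂ (fun z : ℂ => 1 - z / z₀) z₀ :=
    analyticAt_const.sub analyticAt_id.div_const
  have hlin0 : (1 : ℂ) - z₀ / z₀ = 0 := by rw [div_self hz₀', sub_self]
  refine ⟨hz₀, hb0, z₀ * ρ, by nlinarith, fun z => G (csqrt (1 - z / z₀)),
    fun z => E (1 - z / z₀), fun z => -D (1 - z / z₀), ?_, fun z hz => (hf z hz).symm, ?_, ?_,
    ?_, ?_, ?_⟩
  · intro z hz
    have h1 : DifferentiableAt ℂ G (csqrt (1 - z / z₀)) :=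
      hG.differentiableAt (hW.mem_nhds (hmaps z hz))
    have h2 : DifferentiableAt ℂ csqrt (1 - z / z₀) :=
      (analyticAt_csqrt (one_sub_div_mem_slitPlane hz₀ hz)).differentiableAt
    have h3 : DifferentiableAt ℂ (fun z : ℂ => 1 - z / z₀) z := by fun_prop
    exact (h1.comp z (f := fun z => csqrt (1 - z / z₀))
      (h2.comp z (f := fun z : ℂ => 1 - z / z₀) h3)).differentiableWithinAt
  · exact AnalyticAt.comp (f := fun z : ℂ => 1 - z / z₀) (by rw [hlin0]; exact hE) hlin
  · exact (AnalyticAt.comp (f := fun z : ℂ => 1 - z / z₀) (by rw [hlin0]; exact hD) hlin).neg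
  · have := hEsq 0
    simp only [ne_eq, OfNat.ofNat_ne_zero, not_false_eq_true, zero_pow, neg_zero] at this
    simp only [hlin0, this, ha]
    ring
  · have := hDsq 0
    simp only [ne_eq, OfNat.ofNat_ne_zero, not_false_eq_true, zero_pow, dslope_same] at this
    simp only [hlin0, this, hOd, neg_neg]
  · refine Eventually.of_forall fun z => ?_
    have h1 := hEsq (csqrt (1 - z / z₀))
    have h2 := hDsq (csqrt (1 - z / z₀))
    have h3 := sub_smul_dslope O 0 (csqrt (1 - z / z₀))
    rw [csqrt_sq] at h1 h2
    rw [← h2, hO0, sub_zero, sub_zero, smul_eq_mul] at h3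
    change _ = E (1 - z / z₀) - -D (1 - z / z₀) * csqrt (1 - z / z₀)
    rw [h1, neg_mul, sub_neg_eq_add, mul_comm, h3]
    simp only [hO]
    ring

/-! ### Inverting an analytic function along a compact set -/

/-- A function that is analytic, with non-vanishing derivative, at the points of a compact set, and
injective on it, has an analytic inverse in a neighbourhood of the image. -/
theorem exists_differentiableOn_comp_eq {T H : ℂ → ℂ} {M : Set ℂ} (hM : IsCompact M)
    (hT : ∀ x ∈ M, AnalyticAt ℂ T x) (hT' : ∀ x ∈ M, deriv T x ≠ 0) (hinj : Set.InjOn T M)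
    (hH : ∀ x ∈ M, AnalyticAt ℂ H x) :
    ∃ W : Set ℂ, IsOpen W ∧ T '' M ⊆ W ∧ ∃ G : ℂ → ℂ, DifferentiableOn ℂ G W ∧
      ∀ x ∈ M, G (T x) = H x ∧ deriv G (T x) = deriv H x / deriv T x := by
  obtain ⟨t, ht, htinj⟩ := hinj.exists_mem_nhdsSet hM (fun x hx => (hT x hx).continuousAt)
    (fun x hx => by
      have h1 := (hT x hx).hasStrictDerivAt
      have h2 := h1.eventually_left_inverse (hT' x hx)
      refine ⟨_, h2, fun y hy z hz hyz => ?_⟩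
      rw [← hy, ← hz, hyz])
  have hs : {x | AnalyticAt ℂ T x ∧ deriv T x ≠ 0 ∧ AnalyticAt ℂ H x} ∈ 𝓝ˢ M := by
    rw [mem_nhdsSet_iff_forall]
    intro x hx
    filter_upwards [(hT x hx).eventually_analyticAt,
      (hT x hx).deriv.continuousAt.eventually_ne (hT' x hx), (hH x hx).eventually_analyticAt]
      with y h1 h2 h3 using ⟨h1, h2, h3⟩
  obtain ⟨U, hUo, hMU, hU⟩ := mem_nhdsSet_iff_exists.1 (inter_mem ht hs)
  have hUinj : Set.InjOn T U := htinj.mono fun x hx => (hU hx).1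
  set Y := Function.invFunOn T U with hY
  have hYT : ∀ x ∈ U, Y (T x) = x := fun x hx => hUinj.leftInvOn_invFunOn hx
  have hder : ∀ x ∈ U, HasDerivAt (H ∘ Y) (deriv H x / deriv T x) (T x) := by
    intro x hx
    obtain ⟨h1, h2, h3⟩ := (hU hx).2
    have h4 : HasStrictDerivAt Y (deriv T x)⁻¹ (T x) :=
      h1.hasStrictDerivAt.to_local_left_inverse h2
        (by filter_upwards [hUo.mem_nhds hx] with y hy using hYT y hy)
    have h5 : HasDerivAt H (deriv H x) (Y (T x)) := by
      rw [hYT x hx]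
      exact h3.differentiableAt.hasDerivAt
    exact h5.comp (T x) h4.hasDerivAt
  refine ⟨T '' U, ?_, Set.image_mono hMU, H ∘ Y, ?_, fun x hx => ⟨?_, (hder x (hMU hx)).deriv⟩⟩
  · rw [isOpen_iff_mem_nhds]
    rintro _ ⟨x, hx, rfl⟩
    obtain ⟨h1, h2, -⟩ := (hU hx).2
    rw [← h1.hasStrictDerivAt.map_nhds_eq h2]
    exact image_mem_map (hUo.mem_nhds hx)
  · rintro _ ⟨x, hx, rfl⟩
    exact (hder x hx).differentiableAt.differentiableWithinAt
  · simp [hYT x (hMU hx)]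

/-! ### Implicit functions `x = z φ(x)` -/

/-- A double zero can be factored out of an analytic function. -/
theorem exists_eq_sub_sq_mul {N : ℂ → ℂ} {c : ℂ} (hN : AnalyticAt ℂ N c) (h0 : N c = 0)
    (h1 : deriv N c = 0) :
    ∃ n : ℂ → ℂ, AnalyticAt ℂ n c ∧ (∀ x, N x = (x - c) ^ 2 * n x) ∧
      n c = deriv (deriv N) c / 2 := by
  obtain ⟨p, hp⟩ := hN
  have hn : AnalyticAt ℂ (dslope (dslope N c) c) c :=
    ⟨_, hp.has_fpower_series_dslope_fslope.has_fpower_series_dslope_fslope⟩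
  have hd : AnalyticAt ℂ (dslope N c) c := ⟨_, hp.has_fpower_series_dslope_fslope⟩
  refine ⟨dslope (dslope N c) c, hn, fun x => ?_, ?_⟩
  · have h2 := sub_smul_dslope N c x
    have h3 := sub_smul_dslope (dslope N c) c x
    rw [dslope_same, h1, sub_zero, smul_eq_mul] at h3
    rw [h0, sub_zero, smul_eq_mul, ← h3] at h2
    rw [← h2]
    ring
  · -- Differentiate `N = (x - c) · s`, `s` the slope, twice.
    rw [dslope_same]
    have h2 : ∀ᶠ x in 𝓝 c, deriv N x = dslope N c x + (x - c) * deriv (dslope N c) x := by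
      filter_upwards [hd.eventually_analyticAt] with x hx
      have h3 : N = fun x => (x - c) * dslope N c x := by
        funext y
        have := sub_smul_dslope N c y
        rw [h0, sub_zero, smul_eq_mul] at this
        exact this.symm
      have h4 : HasDerivAt (fun x => (x - c) * dslope N c x)
          (1 * dslope N c x + (x - c) * deriv (dslope N c) x) x :=
        ((hasDerivAt_id x).sub_const c).mul hx.differentiableAt.hasDerivAt
      rw [← h3] at h4
      rw [h4.deriv, one_mul]
    have h5 : HasDerivAt (fun x => dslope N c x + (x - c) * deriv (dslope N c) x)
        (deriv (dslope N c) c + (1 * deriv (dslope N c) c + (c - c) * deriv (deriv (dslope N c)) c))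
        c :=
      hd.differentiableAt.hasDerivAt.add
        (((hasDerivAt_id c).sub_const c).mul hd.deriv.differentiableAt.hasDerivAt)
    rw [EventuallyEq.deriv_eq h2, h5.deriv]
    ring

open Metric in
/-- Let `X(z)` solve `x = z φ(x)` for `|z| ≤ z₀`, with values in the closed disc of radius `τ`,
where `(τ, z₀)` is a point at which the equation degenerates to second order. If `z₀ φ` strictly contracts
distances on this disc, then every function `H(X(z))` with `H` analytic on the disc has a
square-root singularity at `z₀`.

The function `1 - x / (z₀ φ(x))`, which takes the value `1 - z / z₀` at `x = X(z)`, has a square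
root `T` which is analytic and injective near the set of the relevant `x`, including its double
zero `τ`; the inverse function of `T` expresses `X(z)` through `√(1 - z / z₀)`. -/
theorem hasDominantSqrtSingularity_of_implicit {φ H X : ℂ → ℂ} {τ z₀ p a H₁ : ℝ} (hτ : 0 < τ)
    (hz₀ : 0 < z₀) (hφ : ∀ x ∈ closedBall (0 : ℂ) τ, AnalyticAt ℂ φ x)
    (hH : ∀ x ∈ closedBall (0 : ℂ) τ, AnalyticAt ℂ H x) (hφ0 : φ 0 ≠ 0)
    (h0 : z₀ * φ τ = τ) (h1 : z₀ * deriv φ τ = 1) (h2 : deriv (deriv φ) τ = p) (hp : 0 < p)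
    (hHτ : H τ = a) (hH1 : deriv H τ = H₁) (hH₁ : H₁ ≠ 0)
    (hlip : ∀ x ∈ closedBall (0 : ℂ) τ, ∀ y ∈ closedBall (0 : ℂ) τ, x ≠ y →
      z₀ * ‖φ x - φ y‖ < ‖x - y‖)
    (hder : ∀ x ∈ closedBall (0 : ℂ) τ, x ≠ τ → z₀ * ‖deriv φ x‖ < 1)
    (hX : ∀ z : ℂ, ‖z‖ ≤ z₀ → ‖X z‖ ≤ τ ∧ X z = z * φ (X z)) :
    HasDominantSqrtSingularity (fun z => H (X z)) z₀ a (H₁ * Real.sqrt (2 * τ / (z₀ * p))) := by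
  have hz₀' : (z₀ : ℂ) ≠ 0 := by exact_mod_cast hz₀.ne'
  have hτ' : (τ : ℂ) ≠ 0 := by exact_mod_cast hτ.ne'
  have hτmem : (τ : ℂ) ∈ closedBall (0 : ℂ) τ := by
    simp [abs_of_pos hτ]
  -- The solutions `x` of `x = z φ(x)` in the disc for the parameters `|z| ≤ z₀`.
  set M : Set ℂ := {x | x ∈ closedBall (0 : ℂ) τ ∧ ‖x‖ ≤ z₀ * ‖φ x‖} with hMdef
  have hφne : ∀ x ∈ M, φ x ≠ 0 := by
    rintro x ⟨-, hx⟩ h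
    rw [h, norm_zero, mul_zero, norm_le_zero_iff] at hx
    exact hφ0 (hx ▸ h)
  have hφτ : φ τ ≠ 0 := by
    intro h
    rw [h, mul_zero] at h0
    exact hτ' h0.symm
  have hτM : (τ : ℂ) ∈ M := by
    refine ⟨hτmem, le_of_eq ?_⟩
    have := congrArg norm h0
    rw [norm_mul, Complex.norm_real z₀, Real.norm_of_nonneg hz₀.le] at this
    exact this.symm
  have hMc : IsCompact M := by
    have hφc : ContinuousOn φ (closedBall (0 : ℂ) τ) :=
      fun x hx => (hφ x hx).continuousAt.continuousWithinAt
    have hcl : IsClosed M := by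
      have : ContinuousOn (fun x => z₀ * ‖φ x‖ - ‖x‖) (closedBall (0 : ℂ) τ) := by fun_prop
      have h := this.preimage_isClosed_of_isClosed isClosed_closedBall (isClosed_Ici (a := (0 : ℝ)))
      convert h using 1
      ext x
      simp [hMdef]
    exact (isCompact_closedBall (0 : ℂ) τ).of_isClosed_subset hcl fun x hx => hx.1
  -- The solution `x` belongs to the parameter `z = z₀ (1 - Q x)`.
  set Q : ℂ → ℂ := fun x => 1 - x / (z₀ * φ x) with hQ
  have hQan : ∀ x ∈ M, AnalyticAt ℂ Q x := fun x hx =>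
    analyticAt_const.sub (analyticAt_id.div (analyticAt_const.mul (hφ x hx.1))
      (mul_ne_zero hz₀' (hφne x hx)))
  -- Points of `M` are solutions for a parameter in the disc, which they determine uniquely.
  have hQnorm : ∀ x ∈ M, ‖1 - Q x‖ ≤ 1 := by
    intro x hx
    have h3 : 0 < z₀ * ‖φ x‖ := mul_pos hz₀ (norm_pos_iff.2 (hφne x hx))
    rw [hQ, sub_sub_cancel, norm_div, norm_mul, Complex.norm_real, Real.norm_of_nonneg hz₀.le,
      div_le_one h3]
    exact hx.2
  have hsol : ∀ x ∈ M, x = z₀ * (1 - Q x) * φ x := by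
    intro x hx
    have h3 := hφne x hx
    simp only [hQ, sub_sub_cancel]
    field_simp
  have hQinj : Set.InjOn Q M := by
    intro x hx y hy hxy
    by_contra hne
    have h3 := hlip x hx.1 y hy.1 hne
    have h4 : x - y = z₀ * (1 - Q x) * (φ x - φ y) := by
      rw [mul_sub]
      nth_rw 2 [hxy]
      rw [← hsol x hx, ← hsol y hy]
    have h5 : ‖x - y‖ ≤ z₀ * ‖φ x - φ y‖ := by
      calc ‖x - y‖ = z₀ * ‖1 - Q x‖ * ‖φ x - φ y‖ := by
            rw [h4, norm_mul, norm_mul, Complex.norm_real, Real.norm_of_nonneg hz₀.le]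
        _ ≤ z₀ * 1 * ‖φ x - φ y‖ := by
            gcongr
            exact hQnorm x hx
        _ = _ := by rw [mul_one]
    exact absurd h3 (not_lt.2 h5)
  have hQτ : Q τ = 0 := by
    simp only [hQ, h0, div_self hτ', sub_self]
  have hQre : ∀ x ∈ M, 0 ≤ (Q x).re := by
    intro x hx
    have h3 := (Complex.re_le_norm (1 - Q x)).trans (hQnorm x hx)
    simp only [Complex.sub_re, Complex.one_re] at h3
    linarith
  have hQslit : ∀ x ∈ M, x ≠ τ → Q x ∈ Complex.slitPlane := by
    intro x hx hne
    have hQ0 : Q x ≠ 0 := fun h => hne (hQinj hx hτM (h.trans hQτ.symm))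
    rw [Complex.mem_slitPlane_iff]
    rcases (hQre x hx).lt_or_eq with h3 | h3
    · exact Or.inl h3
    · exact Or.inr fun h4 => hQ0 (Complex.ext h3.symm h4)
  have hQder : ∀ x ∈ M, x ≠ τ → deriv Q x ≠ 0 := by
    intro x hx hne h3
    have h4 := hφne x hx
    have h5 : HasDerivAt Q (-((1 * (z₀ * φ x) - x * (z₀ * deriv φ x)) / (z₀ * φ x) ^ 2)) x :=
      (((hasDerivAt_id x).div ((hφ x hx.1).differentiableAt.hasDerivAt.const_mul (z₀ : ℂ))
        (mul_ne_zero hz₀' h4))).const_sub 1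
    rw [h5.deriv, neg_eq_zero, div_eq_zero_iff] at h3
    have h6 : φ x = x * deriv φ x := by
      rcases h3 with h3 | h3
      · have : (z₀ : ℂ) * (φ x - x * deriv φ x) = 0 := by linear_combination h3
        exact sub_eq_zero.1 ((mul_eq_zero.1 this).resolve_left hz₀')
      · exact absurd h3 (pow_ne_zero 2 (mul_ne_zero hz₀' h4))
    have h7 : ‖φ x‖ < ‖φ x‖ := by
      calc ‖φ x‖ = ‖x‖ * ‖deriv φ x‖ := by rw [← norm_mul, ← h6]
        _ ≤ z₀ * ‖φ x‖ * ‖deriv φ x‖ := by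
            gcongr
            exact hx.2
        _ = ‖φ x‖ * (z₀ * ‖deriv φ x‖) := by ring
        _ < ‖φ x‖ * 1 := by
            have := hder x hx.1 hne
            have := norm_pos_iff.2 h4
            gcongr
        _ = ‖φ x‖ := mul_one _
    exact lt_irrefl _ h7
  -- The double zero of `Q` at `τ`.
  obtain ⟨n, hn, hNn, hnτ⟩ := exists_eq_sub_sq_mul (N := fun x => z₀ * φ x - x) (c := τ)
    ((analyticAt_const.mul (hφ τ hτmem)).sub analyticAt_id) (by simp [h0]) (by
      have : HasDerivAt (fun x => z₀ * φ x - x) (z₀ * deriv φ τ - 1) τ :=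
        ((hφ τ hτmem).differentiableAt.hasDerivAt.const_mul (z₀ : ℂ)).sub (hasDerivAt_id _)
      rw [this.deriv, h1, sub_self])
  have hN2 : deriv (deriv fun x => z₀ * φ x - x) (τ : ℂ) = z₀ * p := by
    have h3 : ∀ᶠ x in 𝓝 (τ : ℂ), deriv (fun x => z₀ * φ x - x) x = z₀ * deriv φ x - 1 := by
      filter_upwards [(hφ τ hτmem).eventually_analyticAt] with x hx
      exact ((hx.differentiableAt.hasDerivAt.const_mul (z₀ : ℂ)).sub (hasDerivAt_id _)).deriv
    have h4 : HasDerivAt (fun x => z₀ * deriv φ x - 1) (z₀ * deriv (deriv φ) τ) τ :=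
      ((hφ τ hτmem).deriv.differentiableAt.hasDerivAt.const_mul (z₀ : ℂ)).sub_const 1
    rw [EventuallyEq.deriv_eq h3, h4.deriv, h2]
  rw [hN2] at hnτ
  set k : ℂ → ℂ := fun x => n x / (z₀ * φ x) with hk
  have hkan : AnalyticAt ℂ k τ :=
    hn.div (analyticAt_const.mul (hφ τ hτmem)) (mul_ne_zero hz₀' hφτ)
  set κ : ℝ := z₀ * p / (2 * τ) with hκ
  have hκpos : 0 < κ := by positivity
  have hkτ : k τ = κ := by
    simp only [hk, hnτ, h0, hκ]
    push_cast
    field_simp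
  have hQk : ∀ x, φ x ≠ 0 → Q x = (τ - x) ^ 2 * k x := by
    intro x hx
    have h3 := hNn x
    simp only [hQ, hk]
    field_simp
    linear_combination h3
  set S : ℂ → ℂ := fun x => (τ - x) * csqrt (k x) with hS
  have hkslit : k τ ∈ Complex.slitPlane := by
    rw [hkτ]
    exact Complex.ofReal_mem_slitPlane.2 hκpos
  have hcsqrtk : csqrt (k τ) = (Real.sqrt κ : ℝ) := by
    have h3 : (κ : ℂ) = ((Real.sqrt κ : ℝ) : ℂ) ^ 2 := by
      rw [← Complex.ofReal_pow, Real.sq_sqrt hκpos.le]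
    rw [hkτ, h3, csqrt_of_sq]
    simpa using hκpos
  have hSan : AnalyticAt ℂ S τ :=
    (analyticAt_const.sub analyticAt_id).mul
      (AnalyticAt.comp (f := k) (analyticAt_csqrt hkslit) hkan)
  have hSder : deriv S τ = -(Real.sqrt κ : ℝ) := by
    have h3 : AnalyticAt ℂ (fun x => csqrt (k x)) τ :=
      AnalyticAt.comp (f := k) (analyticAt_csqrt hkslit) hkan
    have h4 : HasDerivAt S (-1 * csqrt (k τ) + (τ - τ) * deriv (fun x => csqrt (k x)) τ) τ :=
      ((hasDerivAt_id (τ : ℂ)).const_sub (τ : ℂ)).mul h3.differentiableAt.hasDerivAt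
    rw [h4.deriv, hcsqrtk]
    ring
  have hS2 : ∀ x, φ x ≠ 0 → S x ^ 2 = Q x := by
    intro x hx
    rw [hQk x hx, hS, mul_pow, csqrt_sq]
  -- On `M`, near `τ`, the root `S` of `Q` is the principal one.
  have hSre : ∀ᶠ x in 𝓝 (τ : ℂ), x ∈ M → x ≠ τ → 0 < (S x).re := by
    have hcont : ContinuousAt (fun x => csqrt (k x)) τ :=
      (AnalyticAt.comp (f := k) (analyticAt_csqrt hkslit) hkan).continuousAt
    have hsq : 0 < Real.sqrt κ := Real.sqrt_pos.2 hκpos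
    have hclose : ∀ᶠ x in 𝓝 (τ : ℂ), ‖csqrt (k x) - (Real.sqrt κ : ℝ)‖ < Real.sqrt κ / 4 := by
      have := Metric.tendsto_nhds.1 hcont.tendsto (Real.sqrt κ / 4) (by positivity)
      simpa [dist_eq_norm, hcsqrtk] using this
    filter_upwards [hclose] with x hx hxM hne
    by_contra hcon
    rw [not_lt] at hcon
    set ε := csqrt (k x) - (Real.sqrt κ : ℝ) with hε
    have hSx : S x = (τ - x) * (Real.sqrt κ : ℝ) + (τ - x) * ε := by
      simp only [hS, hε]
      ring
    have hd : 0 < ‖(τ : ℂ) - x‖ := norm_pos_iff.2 (sub_ne_zero.2 (Ne.symm hne))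
    have hre0 : 0 ≤ ((τ : ℂ) - x).re := by
      have := (Complex.re_le_norm x).trans (mem_closedBall_zero_iff.1 hxM.1)
      simpa using this
    -- The real part of `S x` is at least `-|τ - x| √κ / 4` ...
    have h3 : -(‖(τ : ℂ) - x‖ * (Real.sqrt κ / 4)) ≤ (S x).re := by
      have h4 : |((τ - x) * ε).re| ≤ ‖(τ : ℂ) - x‖ * (Real.sqrt κ / 4) := by
        refine (Complex.abs_re_le_norm _).trans ?_
        rw [norm_mul]
        gcongr
      have h5 := (abs_le.1 h4).1
      have h6 : (S x).re = ((τ : ℂ) - x).re * Real.sqrt κ + ((τ - x) * ε).re := by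
        rw [hSx, Complex.add_re, Complex.re_mul_ofReal]
      rw [h6]
      have := mul_nonneg hre0 hsq.le
      linarith
    -- ... whereas `|S x| ≥ 3 |τ - x| √κ / 4`, and `Re (S x)² ≥ 0`.
    have h4 : ‖(τ : ℂ) - x‖ * (3 * Real.sqrt κ / 4) ≤ ‖S x‖ := by
      rw [hS, norm_mul]
      gcongr
      have h5 : ‖((Real.sqrt κ : ℝ) : ℂ)‖ ≤ ‖csqrt (k x)‖ + ‖ε‖ := by
        calc ‖((Real.sqrt κ : ℝ) : ℂ)‖ = ‖csqrt (k x) - ε‖ := by rw [hε, sub_sub_cancel]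
          _ ≤ _ := norm_sub_le _ _
      rw [Complex.norm_real, Real.norm_of_nonneg hsq.le] at h5
      linarith
    have h5 : 0 ≤ (S x ^ 2).re := by
      rw [hS2 x (hφne x hxM)]
      exact hQre x hxM
    have h6 : (S x ^ 2).re = (S x).re ^ 2 - (S x).im ^ 2 := by
      rw [sq, Complex.mul_re]
      ring
    have h7 : ‖S x‖ ^ 2 = (S x).re ^ 2 + (S x).im ^ 2 := by
      rw [Complex.sq_norm, Complex.normSq_apply]
      ring
    have h8 : 0 < ‖(τ : ℂ) - x‖ * Real.sqrt κ := mul_pos hd hsq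
    set D := ‖(τ : ℂ) - x‖ * Real.sqrt κ with hD
    have h9 : -(D / 4) ≤ (S x).re := by rw [hD]; linarith
    have h10 : 3 * D / 4 ≤ ‖S x‖ := by rw [hD]; linarith
    have h11 : (S x).re ^ 2 ≤ (D / 4) ^ 2 := by nlinarith
    have h12 : (3 * D / 4) ^ 2 ≤ ‖S x‖ ^ 2 := by gcongr
    nlinarith
  obtain ⟨δ, hδ, hSδ⟩ := Metric.eventually_nhds_iff.1 (hSan.eventually_analyticAt.and hSre)
  -- The analytic square root of `Q` near `M`.
  classical
  set T : ℂ → ℂ := fun x => if dist x τ < δ / 2 ∧ φ x ≠ 0 then S x else csqrt (Q x) with hT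
  have hTτ : T =ᶠ[𝓝 (τ : ℂ)] S := by
    filter_upwards [Metric.ball_mem_nhds (τ : ℂ) (half_pos hδ),
      (hφ τ hτmem).continuousAt.eventually_ne hφτ] with x hx hx'
    exact if_pos ⟨hx, hx'⟩
  have hT2 : ∀ x, T x ^ 2 = Q x := by
    intro x
    simp only [hT]
    split_ifs with h
    · exact hS2 x h.2
    · exact csqrt_sq _
  have hTne : ∀ x ∈ M, x ≠ τ → T =ᶠ[𝓝 x] fun y => csqrt (Q y) := by
    intro x hx hne
    rcases lt_or_ge (dist x τ) δ with hd | hd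
    · obtain ⟨h3, h4⟩ := hSδ hd
      have h5 : ∀ᶠ y in 𝓝 x, 0 < (S y).re :=
        (Complex.continuous_re.continuousAt.comp h3.continuousAt).eventually_const_lt (h4 hx hne)
      filter_upwards [h5, (hφ x hx.1).continuousAt.eventually_ne (hφne x hx)] with y hy hy'
      simp only [hT]
      split_ifs with h
      · rw [← hS2 y hy', csqrt_of_sq hy]
      · rfl
    · have hc : ContinuousAt (fun y : ℂ => dist y τ) x := by fun_prop
      have : ∀ᶠ y in 𝓝 x, δ / 2 < dist y (τ : ℂ) :=
        hc.eventually_const_lt (by linarith)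
      filter_upwards [this] with y hy
      exact if_neg fun h => absurd h.1 (not_lt.2 hy.le)
  have hTan : ∀ x ∈ M, AnalyticAt ℂ T x := by
    intro x hx
    by_cases hne : x = τ
    · subst hne
      exact hSan.congr hTτ.symm
    · exact (AnalyticAt.comp (f := Q) (analyticAt_csqrt (hQslit x hx hne)) (hQan x hx)).congr
        (hTne x hx hne).symm
  have hTder : ∀ x ∈ M, deriv T x ≠ 0 := by
    intro x hx
    by_cases hne : x = τ
    · subst hne
      rw [hTτ.deriv_eq, hSder]
      simpa using (Real.sqrt_pos.2 hκpos).ne'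
    · intro h
      have h3 : HasDerivAt (fun y => T y ^ 2) (2 * T x * deriv T x) x := by
        simpa using (hTan x hx).differentiableAt.hasDerivAt.fun_pow 2
      rw [funext hT2] at h3
      refine hQder x hx hne ?_
      rw [h3.deriv, h, mul_zero]
  have hTinj : Set.InjOn T M := fun x hx y hy hxy =>
    hQinj hx hy (by rw [← hT2 x, ← hT2 y, hxy])
  obtain ⟨W, hWo, hTW, G, hGd, hG⟩ := exists_differentiableOn_comp_eq hMc hTan hTder hTinj
    fun x hx => hH x hx.1
  have hTτ0 : T τ = 0 := by
    have := hT2 τ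
    rw [hQτ] at this
    exact pow_eq_zero_iff two_ne_zero |>.1 this
  have hXM : ∀ z : ℂ, ‖z‖ ≤ z₀ → X z ∈ M ∧ Q (X z) = 1 - z / z₀ := by
    intro z hz
    obtain ⟨h3, h4⟩ := hX z hz
    have h5 : X z ∈ M := by
      refine ⟨mem_closedBall_zero_iff.2 h3, ?_⟩
      calc ‖X z‖ = ‖z‖ * ‖φ (X z)‖ := by rw [← norm_mul, ← h4]
        _ ≤ z₀ * ‖φ (X z)‖ := by gcongr
    refine ⟨h5, ?_⟩
    have h6 := hφne _ h5
    simp only [hQ]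
    nth_rw 1 [h4]
    field_simp
  have hTX : ∀ z : ℂ, ‖z‖ ≤ z₀ → ∀ t : ℂ, t ^ 2 = 1 - z / z₀ → (t = 0 ∨ 0 < t.re) →
      T (X z) = t := by
    intro z hz t ht ht0
    obtain ⟨h3, h4⟩ := hXM z hz
    by_cases hne : X z = τ
    · rw [hne, hTτ0]
      rw [hne, hQτ, ← ht] at h4
      exact (pow_eq_zero_iff two_ne_zero |>.1 h4.symm).symm
    · have h5 : 0 < (T (X z)).re := by
        rw [(hTne _ h3 hne).eq_of_nhds]
        exact csqrt_re_pos (hQslit _ h3 hne)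
      have h6 : T (X z) ^ 2 = t ^ 2 := by rw [hT2, h4, ht]
      rcases sq_eq_sq_iff_eq_or_eq_neg.1 h6 with h7 | h7
      · exact h7
      · rw [h7, Complex.neg_re] at h5
        rcases ht0 with h8 | h8
        · simp [h8] at h5
        · linarith
  have hb : H₁ * Real.sqrt (2 * τ / (z₀ * p)) = H₁ / Real.sqrt κ := by
    rw [hκ, div_eq_mul_inv H₁, ← Real.sqrt_inv, inv_div]
  rw [hb]
  refine hasDominantSqrtSingularity_of_comp_sqrt hz₀ hWo ?_ hGd ?_ ?_ ?_
    (div_ne_zero hH₁ (Real.sqrt_pos.2 hκpos).ne')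
  · intro t ht ht1
    have h3 : ‖(z₀ : ℂ) * (1 - t ^ 2)‖ ≤ z₀ := by
      rw [norm_mul, Complex.norm_real, Real.norm_of_nonneg hz₀.le]
      nlinarith
    refine hTW ⟨X (z₀ * (1 - t ^ 2)), (hXM _ h3).1, hTX _ h3 t ?_ ?_⟩
    · field_simp
      ring
    · rcases ht.lt_or_eq with h4 | h4
      · exact Or.inr h4
      · left
        -- On the imaginary axis `|1 - t²| = 1 + |t|²`.
        have h5 : t = Complex.I * t.im := by
          apply Complex.ext <;> simp [← h4]
        have h6 : 1 - t ^ 2 = ((1 + t.im ^ 2 : ℝ) : ℂ) := by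
          rw [h5, mul_pow, Complex.I_sq]
          push_cast
          simp
        rw [h6, Complex.norm_real, Real.norm_of_nonneg (by positivity)] at ht1
        have h7 : t.im = 0 := by nlinarith
        rw [h5, h7]
        simp
  · intro z hz
    have h3 : (1 : ℂ) - z / z₀ ∈ Complex.slitPlane := by
      refine one_sub_div_mem_slitPlane (R := z₀) hz₀ ⟨hz, fun h => ?_⟩
      exact absurd ((Complex.re_le_norm z).trans_lt hz) (not_lt.2 h.2)
    rw [← (hG _ (hXM z hz.le).1).1, hTX z hz.le _ (csqrt_sq _) (Or.inr (csqrt_re_pos h3))]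
  · rw [← hTτ0, (hG _ hτM).1, hHτ]
  · have h3 := (hG _ hτM).2
    rw [hTτ0, hTτ.deriv_eq, hSder, hH1] at h3
    rw [h3]
    push_cast
    rw [div_neg]

/-! ### The coefficients of `√(1 - w)` -/

/-- The coefficient of `w ^ n` in the power series of `√(1 - w)`. -/
noncomputable def sqrtCoeff (n : ℕ) : ℝ := (-1) ^ n * Ring.choose (1 / 2 : ℝ) n

theorem sqrtCoeff_zero : sqrtCoeff 0 = 1 := by simp [sqrtCoeff]

theorem sqrtCoeff_succ (n : ℕ) : sqrtCoeff (n + 1) = sqrtCoeff n * ((n - 1 / 2) / (n + 1)) := by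
  have h := Ring.choose_smul_choose (1 / 2 : ℝ) (Nat.le_succ n)
  rw [Nat.succ_eq_add_one, Nat.add_sub_cancel_left, Ring.choose_one_right,
    Nat.choose_succ_self_right, nsmul_eq_mul] at h
  push_cast at h
  have h1 : (n : ℝ) + 1 ≠ 0 := by positivity
  simp only [sqrtCoeff, pow_succ]
  field_simp
  linear_combination (-2 : ℝ) * h

theorem hasSum_sqrtCoeff {w : ℂ} (hw : ‖w‖ < 1) :
    HasSum (fun n => (sqrtCoeff n : ℂ) * w ^ n) (csqrt (1 - w)) := by
  have h := Complex.one_add_cpow_hasFPowerSeriesOnBall_zero (a := 1 / 2)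
  have hw' : -w ∈ Metric.eball (0 : ℂ) 1 := by
    simpa [← ofReal_norm, ENNReal.ofReal_lt_one] using hw
  have h2 := h.hasSum hw'
  simp only [binomialSeries_apply, List.ofFn_const, List.prod_replicate, zero_sub, smul_eq_mul,
    ← sub_eq_add_neg] at h2
  convert! h2 using 1
  funext n
  rw [sqrtCoeff, neg_pow]
  have h3 := Complex.ofReal_choose (1 / 2) n
  push_cast at h3 ⊢
  rw [h3]
  ring

theorem sqrtCoeff_neg (n : ℕ) : sqrtCoeff (n + 1) < 0 := by
  induction n with
  | zero => norm_num [sqrtCoeff_succ, sqrtCoeff_zero]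
  | succ n ih =>
    rw [sqrtCoeff_succ]
    refine mul_neg_of_neg_of_pos ih ?_
    push_cast
    have : (0 : ℝ) ≤ n := Nat.cast_nonneg n
    apply div_pos <;> linarith

/-- The weight `n² (n - 1)` is chosen such that the quantity increases with `n`. -/
theorem le_sqrtCoeff_sq (n : ℕ) (hn : 2 ≤ n) :
    1 / 16 ≤ sqrtCoeff n ^ 2 * (n ^ 2 * (n - 1) : ℝ) := by
  induction n, hn using Nat.le_induction with
  | base => norm_num [sqrtCoeff_succ, sqrtCoeff_zero]
  | succ n hn ih =>
    refine ih.trans ?_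
    have hn' : (2 : ℝ) ≤ n := by exact_mod_cast hn
    rw [sqrtCoeff_succ]
    push_cast
    rw [mul_pow, mul_assoc]
    refine mul_le_mul_of_nonneg_left ?_ (sq_nonneg _)
    rw [div_pow, div_mul_eq_mul_div, le_div_iff₀ (by positivity)]
    nlinarith [mul_nonneg (sq_nonneg ((n : ℝ) + 1)) (Nat.cast_nonneg (α := ℝ) n)]

/-- The lower bound `n ^ (-3/2) / 4` for the coefficients of `√(1 - w)`, squared. -/
theorem one_le_mul_sqrtCoeff_sq (n : ℕ) (hn : 2 ≤ n) :
    1 ≤ 16 * (n : ℝ) ^ 3 * sqrtCoeff n ^ 2 := by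
  have h := le_sqrtCoeff_sq n hn
  nlinarith [mul_nonneg (sq_nonneg (sqrtCoeff n)) (sq_nonneg (n : ℝ))]

/-- A sequence of order `n ^ (-2)` is negligible against the coefficients of `√(1 - w)`, which are
of order `n ^ (-3/2)`. -/
theorem isLittleO_sqrtCoeff_of_bounded {r : ℕ → ℝ} {C : ℝ}
    (hr : ∀ n : ℕ, |r (n + 2)| * ((n + 2) * (n + 1)) ≤ C) : r =o[atTop] sqrtCoeff := by
  have hlim : Tendsto (fun n : ℕ => 16 * (2 * C) ^ 2 / (n : ℝ)) atTop (𝓝 0) :=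
    tendsto_const_div_atTop_nhds_zero_nat _
  rw [isLittleO_iff]
  intro c hc
  have hev := hlim.eventually_lt_const (pow_pos hc 2)
  filter_upwards [hev, eventually_ge_atTop 2] with n h1 hn
  obtain ⟨m, rfl⟩ := Nat.exists_eq_add_of_le' hn
  have h2 := hr m
  have h3 := one_le_mul_sqrtCoeff_sq (m + 2) hn
  push_cast at h1 h3
  set N : ℝ := m + 2 with hN
  have hm : (0 : ℝ) ≤ m := Nat.cast_nonneg m
  have hN0 : 0 < N := by positivity
  have h4 : |r (m + 2)| * N ^ 2 ≤ 2 * C := by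
    have h5 : N ^ 2 ≤ 2 * (N * (m + 1)) := by rw [hN]; nlinarith
    have := mul_le_mul_of_nonneg_left h5 (abs_nonneg (r (m + 2)))
    linarith
  rw [Real.norm_eq_abs, Real.norm_eq_abs]
  refine (pow_le_pow_iff_left₀ (abs_nonneg _) (by positivity) two_ne_zero).1 ?_
  rw [mul_pow, sq_abs (sqrtCoeff _)]
  have h5 : (|r (m + 2)| * N ^ 2) ^ 2 ≤ (2 * C) ^ 2 := by gcongr
  have h6 : 16 * (2 * C) ^ 2 ≤ c ^ 2 * N := ((div_lt_iff₀ hN0).1 h1).le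
  refine le_of_mul_le_mul_right ?_ (pow_pos hN0 4)
  calc |r (m + 2)| ^ 2 * N ^ 4 = (|r (m + 2)| * N ^ 2) ^ 2 * 1 := by ring
    _ ≤ (2 * C) ^ 2 * (16 * N ^ 3 * sqrtCoeff (m + 2) ^ 2) := by gcongr
    _ = 16 * (2 * C) ^ 2 * (N ^ 3 * sqrtCoeff (m + 2) ^ 2) := by ring
    _ ≤ c ^ 2 * N * (N ^ 3 * sqrtCoeff (m + 2) ^ 2) := by gcongr
    _ = _ := by ring

/-- The coefficients of `(1 - w) √(1 - w)` are negligible against those of `√(1 - w)`. -/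
theorem isLittleO_sqrtCoeff_sub :
    (fun n => sqrtCoeff n - sqrtCoeff (n - 1)) =o[atTop] sqrtCoeff := by
  have hlim : Tendsto (fun n : ℕ => 6 * ((n : ℝ)⁻¹)) atTop (𝓝 0) := by
    simpa using tendsto_inv_atTop_nhds_zero_nat.const_mul (6 : ℝ)
  rw [isLittleO_iff]
  intro c hc
  filter_upwards [hlim.eventually_lt_const hc, eventually_ge_atTop 2] with n h1 hn
  obtain ⟨m, rfl⟩ := Nat.exists_eq_add_of_le' hn
  have hm : (0 : ℝ) ≤ m := Nat.cast_nonneg m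
  have h2 : sqrtCoeff (m + 2) - sqrtCoeff (m + 1) =
      -(sqrtCoeff (m + 2) * (3 / 2 / (m + 1 / 2))) := by
    rw [sqrtCoeff_succ (m + 1)]
    push_cast
    have h3 : (m : ℝ) + 1 - 1 / 2 = m + 1 / 2 := by ring
    rw [h3]
    field_simp
    ring
  change ‖sqrtCoeff (m + 2) - sqrtCoeff (m + 1)‖ ≤ _
  rw [h2, norm_neg, norm_mul, mul_comm]
  refine mul_le_mul_of_nonneg_right (le_trans ?_ h1.le) (norm_nonneg _)
  rw [Real.norm_of_nonneg (by positivity), ← div_eq_mul_inv, div_le_div_iff₀ (by positivity)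
    (by positivity)]
  push_cast
  nlinarith

/-! ### Transfer from the singularity to the coefficients -/

/-- If the second derivative of a power series is bounded by `C` on the open unit disc, the
coefficients are at most `C / (n (n - 1))`: Cauchy's estimates for the second derivative. -/
theorem norm_coeff_le_of_norm_deriv_deriv_le {r : ℂ → ℂ} {u : ℕ → ℂ} {C : ℝ}
    (hu : ∀ w : ℂ, ‖w‖ < 1 → HasSum (fun n => u n * w ^ n) (r w))
    (hr : DifferentiableOn ℂ r (Metric.ball 0 1))
    (hC : ∀ w : ℂ, ‖w‖ < 1 → ‖deriv (deriv r) w‖ ≤ C) (n : ℕ) :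
    ‖u (n + 2)‖ * ((n + 2) * (n + 1)) ≤ C := by
  have h0 : AnalyticAt ℂ r 0 := hr.analyticAt (Metric.ball_mem_nhds _ one_pos)
  have h1 : HasFPowerSeriesAt r (.ofScalars ℂ u) 0 := by
    rw [hasFPowerSeriesAt_iff]
    filter_upwards [Metric.ball_mem_nhds (0 : ℂ) one_pos] with w hw
    have := hu w (mem_ball_zero_iff.1 hw)
    simpa [FormalMultilinearSeries.coeff_ofScalars, mul_comm] using this
  have h2 := congrArg (fun p => FormalMultilinearSeries.coeff p (n + 2))
    (h1.eq_formalMultilinearSeries h0.hasFPowerSeriesAt)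
  simp only [FormalMultilinearSeries.coeff_ofScalars] at h2
  have hd : DifferentiableOn ℂ (deriv (deriv r)) (Metric.ball 0 1) :=
    (hr.deriv Metric.isOpen_ball).deriv Metric.isOpen_ball
  -- Cauchy's estimate on the circles of radius `ρ < 1`.
  have h3 : ∀ ρ ∈ Set.Ioo (0 : ℝ) 1,
      ‖iteratedDeriv n (deriv (deriv r)) 0‖ * ρ ^ n ≤ n.factorial * C := by
    rintro ρ ⟨hρ0, hρ1⟩
    rw [← le_div_iff₀ (pow_pos hρ0 n)]
    refine Complex.norm_iteratedDeriv_le_of_forall_mem_sphere_norm_le n hρ0 ?_ fun z hz => ?_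
    · refine DifferentiableOn.diffContOnCl (hd.mono ?_)
      exact Metric.closure_ball_subset_closedBall.trans (Metric.closedBall_subset_ball hρ1)
    · exact hC z (by rw [mem_sphere_zero_iff_norm.1 hz]; exact hρ1)
  have h4 : ‖iteratedDeriv n (deriv (deriv r)) 0‖ ≤ n.factorial * C := by
    have h5 : Tendsto (fun ρ : ℝ => ‖iteratedDeriv n (deriv (deriv r)) 0‖ * ρ ^ n) (𝓝[<] 1)
        (𝓝 (‖iteratedDeriv n (deriv (deriv r)) 0‖ * 1 ^ n)) :=
      (Continuous.tendsto (by fun_prop) 1).mono_left nhdsWithin_le_nhds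
    rw [one_pow, mul_one] at h5
    exact le_of_tendsto h5 (by
      filter_upwards [Ioo_mem_nhdsLT (zero_lt_one' ℝ)] with ρ hρ using h3 ρ hρ)
  rw [← iteratedDeriv_succ', ← iteratedDeriv_succ'] at h4
  have h5 : ‖iteratedDeriv (n + 2) r 0‖ = ‖u (n + 2)‖ * ((n + 2) * (n + 1) * n.factorial) := by
    rw [h2, norm_div, Complex.norm_natCast, Nat.factorial_succ, Nat.factorial_succ]
    push_cast
    have : (n.factorial : ℝ) ≠ 0 := by positivity
    field_simp
    ring
  rw [show n + 1 + 1 = n + 2 from rfl, h5] at h4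
  have h6 : (0 : ℝ) < n.factorial := by positivity
  nlinarith

theorem isOpen_slitDisc (z₀ R : ℝ) : IsOpen (slitDisc z₀ R) := by
  have h : IsClosed {z : ℂ | z.im = 0 ∧ z₀ ≤ z.re} :=
    (isClosed_eq Complex.continuous_im continuous_const).inter
      (isClosed_le continuous_const Complex.continuous_re)
  exact (isOpen_lt continuous_norm continuous_const).inter h.isOpen_compl

theorem hasDerivAt_csqrt {w : ℂ} (hw : w ∈ Complex.slitPlane) :
    HasDerivAt csqrt (1 / (2 * csqrt w)) w := by
  have hd := (analyticAt_csqrt hw).differentiableAt.hasDerivAt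
  have h1 := hd.fun_pow 2
  simp only [csqrt_sq] at h1
  have h2 := h1.unique (hasDerivAt_id' w)
  have h3 : csqrt w ≠ 0 := fun h => Complex.slitPlane_ne_zero hw (by rw [← csqrt_sq w, h]; simp)
  have h4 : deriv csqrt w = 1 / (2 * csqrt w) := by
    rw [eq_div_iff (mul_ne_zero two_ne_zero h3)]
    simpa [mul_comm] using h2
  rwa [h4] at hd

theorem hasDerivAt_mul_csqrt {w : ℂ} (hw : 1 - w ∈ Complex.slitPlane) :
    HasDerivAt (fun w => (1 - w) * csqrt (1 - w)) (-(3 / 2) * csqrt (1 - w)) w := by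
  have h3 : csqrt (1 - w) ≠ 0 :=
    fun h => Complex.slitPlane_ne_zero hw (by rw [← csqrt_sq (1 - w), h]; simp)
  have h1 := (hasDerivAt_id' w).const_sub 1
  have h2 := h1.mul ((hasDerivAt_csqrt hw).comp w h1)
  refine h2.congr_deriv ?_
  simp only [Function.comp_apply]
  have h4 := csqrt_sq (1 - w)
  field_simp
  linear_combination h4

theorem hasDerivAt_sq_mul_csqrt {w : ℂ} (hw : 1 - w ∈ Complex.slitPlane) :
    HasDerivAt (fun w => (1 - w) ^ 2 * csqrt (1 - w)) (-(5 / 2) * ((1 - w) * csqrt (1 - w))) w := by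
  have h1 := (hasDerivAt_id' w).const_sub 1
  have h2 := h1.mul (hasDerivAt_mul_csqrt hw)
  have h3 : (fun w : ℂ => (1 - w) ^ 2 * csqrt (1 - w)) =
      fun w => (1 - w) * ((1 - w) * csqrt (1 - w)) := by
    funext w
    ring
  rw [h3]
  refine h2.congr_deriv ?_
  ring

/-- A function with a square-root singularity at `1`, from which its two leading singular terms
have been subtracted, has a bounded second derivative on the unit disc. -/
theorem exists_norm_deriv_deriv_le {F g h : ℂ → ℂ} {R : ℝ} (hR : 1 < R)
    (hF : DifferentiableOn ℂ F (slitDisc 1 R)) (hg : AnalyticAt ℂ g 1) (hh : AnalyticAt ℂ h 1)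
    (hloc : ∀ᶠ w in 𝓝[slitDisc 1 R] (1 : ℂ), F w = g w - h w * csqrt (1 - w)) :
    ∃ C : ℝ, ∀ w : ℂ, ‖w‖ < 1 → ‖deriv (deriv fun w => F w + h 1 * csqrt (1 - w) -
      deriv h 1 * ((1 - w) * csqrt (1 - w))) w‖ ≤ C := by
  set r : ℂ → ℂ := fun w => F w + h 1 * csqrt (1 - w) -
      deriv h 1 * ((1 - w) * csqrt (1 - w)) with hr
  have hopen := isOpen_slitDisc 1 R
  have hslit : ∀ w ∈ slitDisc 1 R, 1 - w ∈ Complex.slitPlane := by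
    intro w hw
    simpa using one_sub_div_mem_slitPlane (z₀ := 1) one_pos hw
  have hrd : DifferentiableOn ℂ r (slitDisc 1 R) := by
    intro w hw
    have h1 : DifferentiableAt ℂ (fun w : ℂ => csqrt (1 - w)) w :=
      ((hasDerivAt_csqrt (hslit w hw)).comp w ((hasDerivAt_id' w).const_sub 1)).differentiableAt
    have h2 := hF.differentiableAt (hopen.mem_nhds hw)
    have h3 : DifferentiableAt ℂ (fun w : ℂ => 1 - w) w := by fun_prop
    exact ((h2.add (h1.const_mul _)).sub ((h3.mul h1).const_mul _)).differentiableWithinAt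
  have hr2 : DifferentiableOn ℂ (deriv (deriv r)) (slitDisc 1 R) :=
    (hrd.deriv hopen).deriv hopen
  -- The Taylor expansion of `h` to second order.
  obtain ⟨k, hk, hhk, -⟩ := exists_eq_sub_sq_mul (N := fun w => h w - h 1 - (w - 1) * deriv h 1)
    (c := 1) ((hh.sub analyticAt_const).sub ((analyticAt_id.sub analyticAt_const).mul
      analyticAt_const)) (by simp) (by
      have h1 : HasDerivAt (fun w => h w - h 1 - (w - 1) * deriv h 1)
          (deriv h 1 - 1 * deriv h 1) 1 :=
        (hh.differentiableAt.hasDerivAt.sub_const _).sub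
          (((hasDerivAt_id' (1 : ℂ)).sub_const 1).mul_const _)
      rw [h1.deriv, one_mul, sub_self])
  set B : ℂ → ℂ := fun w => deriv (deriv g) w - (deriv (deriv k) w * ((1 - w) ^ 2 * csqrt (1 - w)) +
    2 * deriv k w * (-(5 / 2) * ((1 - w) * csqrt (1 - w))) +
    k w * (15 / 4 * csqrt (1 - w))) with hB
  have hev : ∀ᶠ w in 𝓝 (1 : ℂ), AnalyticAt ℂ g w ∧ AnalyticAt ℂ k w ∧
      (w ∈ slitDisc 1 R → F w = g w - h w * csqrt (1 - w)) ∧ ‖B w‖ ≤ ‖B 1‖ + 1 := by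
    have hc : ContinuousAt (fun w : ℂ => csqrt (1 - w)) 1 := by
      have h1 : ContinuousAt csqrt ((fun w : ℂ => 1 - w) 1) := by
        simpa using continuous_csqrt_zero
      have h2 : ContinuousAt (fun w : ℂ => 1 - w) 1 := by fun_prop
      exact h1.comp h2
    have hBc : ContinuousAt B 1 := by
      have h1 := hg.deriv.deriv.continuousAt
      have h2 := hk.deriv.deriv.continuousAt
      have h3 := hk.deriv.continuousAt
      have h4 := hk.continuousAt
      simp only [hB]
      fun_prop
    exact hg.eventually_analyticAt.and (hk.eventually_analyticAt.and
      ((eventually_nhdsWithin_iff.1 hloc).and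
        (hBc.norm.eventually_le_const (lt_add_one _))))
  obtain ⟨ε, hε, hεW⟩ := Metric.eventually_nhds_iff.1 hev
  have hVo : IsOpen (Metric.ball (1 : ℂ) ε ∩ slitDisc 1 R) := Metric.isOpen_ball.inter hopen
  have hrB : ∀ w ∈ Metric.ball (1 : ℂ) ε ∩ slitDisc 1 R, deriv (deriv r) w = B w := by
    have h1 : ∀ w ∈ Metric.ball (1 : ℂ) ε ∩ slitDisc 1 R,
        r w = g w - k w * ((1 - w) ^ 2 * csqrt (1 - w)) := by
      rintro w ⟨hw, hw'⟩
      simp only [hr, (hεW hw).2.2.1 hw']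
      linear_combination (-csqrt (1 - w)) * hhk w
    have h2 : ∀ w ∈ Metric.ball (1 : ℂ) ε ∩ slitDisc 1 R,
        deriv r w = deriv g w - (deriv k w * ((1 - w) ^ 2 * csqrt (1 - w)) +
          k w * (-(5 / 2) * ((1 - w) * csqrt (1 - w)))) := by
      intro w hw
      have h3 : r =ᶠ[𝓝 w] fun w => g w - k w * ((1 - w) ^ 2 * csqrt (1 - w)) := by
        filter_upwards [hVo.mem_nhds hw] with v hv using h1 v hv
      rw [h3.deriv_eq]
      exact ((hεW hw.1).1.differentiableAt.hasDerivAt.sub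
        ((hεW hw.1).2.1.differentiableAt.hasDerivAt.mul
          (hasDerivAt_sq_mul_csqrt (hslit w hw.2)))).deriv
    intro w hw
    have h3 : deriv r =ᶠ[𝓝 w] fun w => deriv g w - (deriv k w * ((1 - w) ^ 2 * csqrt (1 - w)) +
          k w * (-(5 / 2) * ((1 - w) * csqrt (1 - w)))) := by
      filter_upwards [hVo.mem_nhds hw] with v hv using h2 v hv
    have hs := hslit w hw.2
    rw [h3.deriv_eq]
    refine ((hεW hw.1).1.deriv.differentiableAt.hasDerivAt.sub
        (((hεW hw.1).2.1.deriv.differentiableAt.hasDerivAt.mul (hasDerivAt_sq_mul_csqrt hs)).add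
          ((hεW hw.1).2.1.differentiableAt.hasDerivAt.mul
            ((hasDerivAt_mul_csqrt hs).const_mul (-(5 / 2)))))).deriv.trans ?_
    simp only [hB]
    ring
  -- Away from `1`, the second derivative is bounded by compactness.
  have hKc : IsCompact (Metric.closedBall (0 : ℂ) 1 \ Metric.ball 1 ε) :=
    (isCompact_closedBall 0 1).diff Metric.isOpen_ball
  have hsub : ∀ w : ℂ, ‖w‖ ≤ 1 → w ≠ 1 → w ∈ slitDisc 1 R := by
    intro w hw hne
    refine ⟨hw.trans_lt hR, fun ⟨him, hre⟩ => hne ?_⟩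
    exact Complex.ext (le_antisymm ((Complex.re_le_norm w).trans hw) hre) (by simpa using him)
  obtain ⟨C, hC⟩ := hKc.exists_bound_of_continuousOn (f := deriv (deriv r))
    (hr2.continuousOn.mono fun w hw => hsub w (mem_closedBall_zero_iff.1 hw.1) fun h =>
      hw.2 (by rw [h]; exact Metric.mem_ball_self hε))
  refine ⟨max C (‖B 1‖ + 1), fun w hw => ?_⟩
  have hne : w ≠ 1 := fun h => by simp [h] at hw
  by_cases hwε : w ∈ Metric.ball (1 : ℂ) ε
  · rw [hrB w ⟨hwε, hsub w hw.le hne⟩]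
    exact (hεW hwε).2.2.2.trans (le_max_right _ _)
  · exact (hC w ⟨mem_closedBall_zero_iff.2 hw.le, hwε⟩).trans (le_max_left _ _)

/-- The coefficients of a function with a dominant square-root singularity are asymptotic to those
of its leading singular term. -/
theorem HasDominantSqrtSingularity.coeff_isEquivalent {f : ℂ → ℂ} {z₀ a b : ℝ}
    (hf : HasDominantSqrtSingularity f z₀ a b) {u : ℕ → ℝ}
    (hu : ∀ z : ℂ, ‖z‖ < z₀ → HasSum (fun n => (u n : ℂ) * z ^ n) (f z)) :
    (fun n => u n * z₀ ^ n) ~[atTop] fun n => -b * sqrtCoeff n := by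
  obtain ⟨hz₀, hb, R, hR, F, g, h, hF, hFf, hg, hh, -, hhb, hloc⟩ := hf
  have hz₀' : (z₀ : ℂ) ≠ 0 := by exact_mod_cast hz₀.ne'
  have hR0 : 0 < R := hz₀.trans hR
  have hscale : ∀ w ∈ slitDisc 1 (R / z₀), (z₀ : ℂ) * w ∈ slitDisc z₀ R := by
    rintro w ⟨h1, h2⟩
    refine ⟨?_, fun ⟨h3, h4⟩ => h2 ?_⟩
    · rw [norm_mul, Complex.norm_real, Real.norm_of_nonneg hz₀.le, mul_comm]
      exact (lt_div_iff₀ hz₀).1 h1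
    · rw [Complex.im_ofReal_mul] at h3
      rw [Complex.re_ofReal_mul] at h4
      exact ⟨(mul_eq_zero.1 h3).resolve_left hz₀.ne', by nlinarith⟩
  have hlin : AnalyticAt ℂ (fun w : ℂ => z₀ * w) 1 := analyticAt_const.mul analyticAt_id
  have hga : AnalyticAt ℂ (fun w => g (z₀ * w)) 1 :=
    AnalyticAt.comp (f := fun w : ℂ => z₀ * w) (by simpa using hg) hlin
  have hha : AnalyticAt ℂ (fun w => h (z₀ * w)) 1 :=
    AnalyticAt.comp (f := fun w : ℂ => z₀ * w) (by simpa using hh) hlin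
  have hFd : DifferentiableOn ℂ (fun w => F (z₀ * w)) (slitDisc 1 (R / z₀)) := by
    refine hF.comp (f := fun w : ℂ => z₀ * w) (by fun_prop) hscale
  have hloc' : ∀ᶠ w in 𝓝[slitDisc 1 (R / z₀)] (1 : ℂ),
      F (z₀ * w) = g (z₀ * w) - h (z₀ * w) * csqrt (1 - w) := by
    have h1 : Tendsto (fun w : ℂ => (z₀ : ℂ) * w) (𝓝[slitDisc 1 (R / z₀)] (1 : ℂ))
        (𝓝[slitDisc z₀ R] (z₀ : ℂ)) := by
      refine tendsto_nhdsWithin_iff.2 ⟨?_, ?_⟩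
      · have h2 : ContinuousAt (fun w : ℂ => (z₀ : ℂ) * w) 1 := by fun_prop
        have h3 := h2.tendsto
        rw [mul_one] at h3
        exact h3.mono_left nhdsWithin_le_nhds
      · filter_upwards [self_mem_nhdsWithin] with w hw using hscale w hw
    filter_upwards [h1.eventually hloc] with w hw
    rw [hw, mul_div_cancel_left₀ w hz₀']
    rfl
  obtain ⟨C, hC⟩ := exists_norm_deriv_deriv_le ((one_lt_div hz₀).2 hR) hFd hga hha hloc'
  simp only [mul_one, hhb] at hC
  set e : ℂ := deriv (fun w => h (z₀ * w)) 1 with he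
  -- Coefficients of the remainder.
  set s : ℕ → ℂ := fun n => u n * z₀ ^ n + b * sqrtCoeff n -
    e * (sqrtCoeff n - if n = 0 then (0 : ℂ) else (sqrtCoeff (n - 1) : ℂ)) with hs
  have hsum : ∀ w : ℂ, ‖w‖ < 1 → HasSum (fun n => s n * w ^ n)
      (F (z₀ * w) + b * csqrt (1 - w) - e * ((1 - w) * csqrt (1 - w))) := by
    intro w hw
    have h1 : ‖(z₀ : ℂ) * w‖ < z₀ := by
      rw [norm_mul, Complex.norm_real, Real.norm_of_nonneg hz₀.le]
      nlinarith
    have h2 := hu _ h1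
    rw [← hFf _ h1] at h2
    have h3 := hasSum_sqrtCoeff hw
    have h4 : HasSum (fun n : ℕ => (if n = 0 then 0 else (sqrtCoeff (n - 1) : ℂ)) * w ^ n)
        (w * csqrt (1 - w)) := by
      rw [← hasSum_nat_add_iff' 1]
      simpa [pow_succ, mul_comm, mul_assoc, mul_left_comm] using h3.mul_left w
    convert! (h2.add (h3.mul_left (b : ℂ))).sub ((h3.sub h4).mul_left e) using 1
    · funext n
      simp only [hs]
      ring
    · ring
  have hdiff : DifferentiableOn ℂ (fun w : ℂ => F (z₀ * w) + b * csqrt (1 - w) -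
      e * ((1 - w) * csqrt (1 - w))) (Metric.ball 0 1) := by
    intro w hw
    have hw1 : w ∈ slitDisc 1 (R / z₀) := by
      rw [mem_ball_zero_iff] at hw
      refine ⟨hw.trans ((one_lt_div hz₀).2 hR), fun h1 => ?_⟩
      exact absurd ((Complex.re_le_norm w).trans_lt hw) (not_lt.2 h1.2)
    have hw2 : 1 - w ∈ Complex.slitPlane := by
      simpa using one_sub_div_mem_slitPlane (z₀ := 1) one_pos hw1
    have h1 : DifferentiableAt ℂ (fun w : ℂ => csqrt (1 - w)) w :=
      ((hasDerivAt_csqrt hw2).comp w ((hasDerivAt_id' w).const_sub 1)).differentiableAt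
    have h2 := hFd.differentiableAt ((isOpen_slitDisc _ _).mem_nhds hw1)
    have h3 : DifferentiableAt ℂ (fun w : ℂ => 1 - w) w := by fun_prop
    exact ((h2.add (h1.const_mul _)).sub ((h3.mul h1).const_mul _)).differentiableWithinAt
  have hbound := norm_coeff_le_of_norm_deriv_deriv_le hsum hdiff hC
  have hso : (fun n => ‖s n‖) =o[atTop] sqrtCoeff :=
    isLittleO_sqrtCoeff_of_bounded (C := C) fun n => by
      rw [abs_of_nonneg (norm_nonneg _)]
      exact hbound n
  have hdo : (fun n => (u n * z₀ ^ n - -b * sqrtCoeff n)) =o[atTop] sqrtCoeff := by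
    have h1 : (fun n => ‖s n‖ + ‖e‖ * ‖sqrtCoeff n - sqrtCoeff (n - 1)‖) =o[atTop] sqrtCoeff :=
      hso.add (isLittleO_sqrtCoeff_sub.norm_left.const_mul_left _)
    refine IsBigO.trans_isLittleO (IsBigO.of_bound 1 ?_) h1
    filter_upwards [eventually_ne_atTop 0] with n hn
    rw [one_mul, Real.norm_of_nonneg (by positivity : 0 ≤ ‖s n‖ + ‖e‖ * _)]
    have h2 : (((u n * z₀ ^ n - -b * sqrtCoeff n : ℝ)) : ℂ) =
        s n + e * ((sqrtCoeff n - sqrtCoeff (n - 1) : ℝ) : ℂ) := by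
      simp only [hs, if_neg hn]
      push_cast
      ring
    rw [← Complex.norm_real, h2]
    refine (norm_add_le _ _).trans ?_
    rw [norm_mul, Complex.norm_real]
  exact hdo.trans_isBigO (isBigO_self_const_mul (neg_ne_zero.2 hb) _ _)

/-! ### Counting trees -/

namespace OrderedTree

open scoped ENNReal

/-- One step of the verification of a supersolution: a bound for the sum over the trees with
branches in `E`, given bounds for the sums over `E`. -/
theorem IsBranching.tsum_node_le {κ : ℕ → Type} [∀ k, Fintype (κ k)] {w : OrderedTree → ℕ}
    {v : ∀ k, κ k → Fin k → OrderedTree → ℕ} (h : IsBranching w v) {x S : ℝ} (hx : 0 ≤ x)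
    {E : Set OrderedTree} (B : ∀ k, κ k → Fin k → ℝ) (hB0 : ∀ k e l, 0 ≤ B k e l)
    (hB : ∀ k e l, ∑' T : E, term (v k e l) (ENNReal.ofReal x) T ≤ ENNReal.ofReal (B k e l))
    (hS : HasSum (fun k => ∑ e, ∏ l, B k e l) S) :
    ∑' k, ∑' g : Fin k → E, term w (ENNReal.ofReal x) (node k fun l => g l) ≤
      ENNReal.ofReal (x * S) := by
  refine tsum_ofReal_le (fun k => ?_) (fun k => ?_) (hS.mul_left x)
  · rw [h.tsum_node, ENNReal.ofReal_mul hx,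
      ENNReal.ofReal_sum_of_nonneg fun e _ => Finset.prod_nonneg fun l _ => hB0 k e l]
    refine mul_le_mul_right (Finset.sum_le_sum fun e _ => ?_) _
    rw [ENNReal.ofReal_prod_of_nonneg fun l _ => hB0 k e l]
    exact Finset.prod_le_prod' fun l _ => hB k e l
  · exact mul_nonneg hx (Finset.sum_nonneg fun e _ => Finset.prod_nonneg fun l _ => hB0 k e l)

theorem hasSum_sum_prod_unit {𝕜 : Type*} [NormedField 𝕜] {b : 𝕜} (hb : ‖b‖ < 1) :
    HasSum (fun k : ℕ => ∑ _e : Unit, ∏ _l : Fin k, b) (1 / (1 - b)) := by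
  simpa using hasSum_geometric_of_norm_lt_one hb

theorem isBranching_one : IsBranching (κ := fun _ => Unit) (fun _ => 1) fun _ _ _ _ => 1 := by
  intro k g
  simp

theorem isBranching_sigma₁ :
    IsBranching (κ := fun _ => Unit) sigma₁ fun _ _ _ => sigma₂ := by
  intro k g
  simp [sigma₁_node]

theorem isBranching_sigma₂ :
    IsBranching (κ := fun _ => Unit) sigma₂ fun _ _ _ => sigma := by
  intro k g
  simp [sigma₂_node]

theorem isBranching_zIndex₂ :
    IsBranching (κ := fun _ => Unit) zIndex₂ fun _ _ _ => zIndex := by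
  intro k g
  simp [zIndex₂_node]

theorem isBranching_zIndex₁ :
    IsBranching (κ := Fin) zIndex₁ fun _ i l => if l = i then zIndex₂ else zIndex := by
  intro k g
  rw [zIndex₁_node]
  refine Finset.sum_congr rfl fun i _ => Finset.prod_congr rfl fun l _ => ?_
  split_ifs with h <;> simp [h]

/-- The supersolution `1 / 2` of `t = z / (1 - t)` at `z = 1 / 4` shows that the series counting all
trees converges there. -/
theorem tsum_term_one_le : ∑' T, term (fun _ => 1) (ENNReal.ofReal (1 / 4)) T ≤
    ENNReal.ofReal (1 / 2) := by
  refine tsum_le_of_supersolution (ι := Unit) (fun _ => term (fun _ => 1) (ENNReal.ofReal (1 / 4)))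
    (fun _ => ENNReal.ofReal (1 / 2)) (fun E hE _ => ?_) ()
  refine (isBranching_one.tsum_node_le (by norm_num) (fun _ _ _ => 1 / 2)
    (fun _ _ _ => by norm_num) (fun _ _ _ => hE ()) (hasSum_sum_prod_unit ?_)).trans ?_
  · rw [Real.norm_eq_abs, abs_of_pos] <;> norm_num
  · norm_num

/-- The terms of a convergent series exceed `4⁻ⁿ` only finitely often. -/
theorem finite_order_eq (n : ℕ) : {T : OrderedTree | T.order = n}.Finite := by
  have h := (summable_norm_term_of_tsum_le (z := 1 / 4) (by norm_num) (by norm_num)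
    tsum_term_one_le (by norm_num)).1
  have h1 := h.tendsto_cofinite_zero.eventually_lt_const (u := (1 / 4 : ℝ) ^ n) (by positivity)
  refine Set.Finite.subset (Filter.eventually_cofinite.1 h1) fun T hT => ?_
  rw [Set.mem_ofPred_eq] at hT
  simp [term, hT]

/-- The sum of the weight `w` over the trees of order `n`. -/
noncomputable def levelSum (w : OrderedTree → ℕ) (n : ℕ) : ℝ :=
  ∑ T ∈ (finite_order_eq n).toFinset, (w T : ℝ)

theorem levelSum_nonneg (w : OrderedTree → ℕ) (n : ℕ) : 0 ≤ levelSum w n :=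
  Finset.sum_nonneg fun _ _ => Nat.cast_nonneg _

theorem hasSum_levelSum {w : OrderedTree → ℕ} {z : ℂ} (h : Summable (term w z)) :
    HasSum (fun n => (levelSum w n : ℂ) * z ^ n) (∑' T, term w z T) := by
  have h1 := (Equiv.sigmaFiberEquiv order).hasSum_iff.2 h.hasSum
  refine h1.sigma fun n => ?_
  have hfin : Finite {T : OrderedTree // T.order = n} := finite_order_eq n
  have : Fintype {T : OrderedTree // T.order = n} := Fintype.ofFinite _
  have h2 := hasSum_fintype fun T : {T : OrderedTree // T.order = n} =>
    (term w z ∘ Equiv.sigmaFiberEquiv order) ⟨n, T⟩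
  convert h2 using 1
  rw [levelSum, Finset.sum_subtype (p := fun T => T.order = n) _ (by simp)]
  push_cast
  rw [Finset.sum_mul]
  refine Finset.sum_congr rfl fun T _ => ?_
  simp [term, T.2]

theorem tsum_term_one {z : ℂ} (hz : ‖z‖ < 1 / 4) :
    ∑' T, term (fun _ => 1) z T = (1 - csqrt (1 - 4 * z)) / 2 := by
  obtain ⟨hs, hle⟩ := summable_norm_term_of_tsum_le (by norm_num) (by norm_num)
    tsum_term_one_le hz.le
  set t := ∑' T, term (fun _ => 1) z T with ht
  have hlt : ‖t‖ < 1 := by linarith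
  have h1 : t = z * (1 / (1 - t)) :=
    (isBranching_one.hasSum z hs.of_norm fun _ _ _ => hs).unique
      ((hasSum_sum_prod_unit hlt).mul_left z)
  have h2 : 1 - t ≠ 0 := by
    intro h
    rw [← sub_eq_zero.1 h, norm_one] at hlt
    exact lt_irrefl _ hlt
  have h3 : (1 - 2 * t) ^ 2 = 1 - 4 * z := by
    field_simp at h1
    linear_combination (-4 : ℂ) * h1
  have h4 : 0 < (1 - 2 * t).re := by
    have h5 : 0 ≤ (1 - 2 * t).re := by
      have := (Complex.re_le_norm t).trans hle
      simp
      linarith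
    refine h5.lt_of_ne' fun h6 => ?_
    -- Otherwise `1 - 4 z` would be a negative number.
    have h7 : ((1 - 2 * t) ^ 2).re ≤ 0 := by
      rw [sq, Complex.mul_re, h6]
      nlinarith
    rw [h3] at h7
    have h8 := (Complex.re_le_norm z).trans_lt hz
    simp at h7
    linarith
  rw [← h3, csqrt_of_sq h4]
  ring

theorem eq_of_hasSum_eq {u v : ℕ → ℂ} {f : ℂ → ℂ} {ρ : ℝ} (hρ : 0 < ρ)
    (hu : ∀ z : ℂ, ‖z‖ < ρ → HasSum (fun n => u n * z ^ n) (f z))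
    (hv : ∀ z : ℂ, ‖z‖ < ρ → HasSum (fun n => v n * z ^ n) (f z)) : u = v := by
  have key : ∀ u : ℕ → ℂ, (∀ z : ℂ, ‖z‖ < ρ → HasSum (fun n => u n * z ^ n) (f z)) →
      HasFPowerSeriesAt f (.ofScalars ℂ u) 0 := by
    intro u hu
    rw [hasFPowerSeriesAt_iff]
    filter_upwards [Metric.ball_mem_nhds (0 : ℂ) hρ] with w hw
    have := hu w (mem_ball_zero_iff.1 hw)
    simpa [FormalMultilinearSeries.coeff_ofScalars, mul_comm] using this
  funext n
  have := congrArg (fun p => FormalMultilinearSeries.coeff p n)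
    ((key u hu).eq_formalMultilinearSeries (key v hv))
  simpa only [FormalMultilinearSeries.coeff_ofScalars] using this

/-- The number of trees of order `n` is a Catalan number, written as a coefficient of
`√(1 - 4 z)`. -/
theorem levelSum_one {n : ℕ} (hn : n ≠ 0) :
    levelSum (fun _ => 1) n = -sqrtCoeff n / 2 * 4 ^ n := by
  have h := eq_of_hasSum_eq (f := fun z => (1 - csqrt (1 - 4 * z)) / 2)
    (u := fun n => (levelSum (fun _ => 1) n : ℂ))
    (v := fun n => ((if n = 0 then 1 else 0) - (sqrtCoeff n : ℂ) * 4 ^ n) / 2)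
    (ρ := 1 / 4) (by norm_num) (fun z hz => ?_) (fun z hz => ?_)
  · have h1 := congrFun h n
    simp only [if_neg hn] at h1
    have h2 : ((levelSum (fun _ => 1) n : ℝ) : ℂ) = ((-sqrtCoeff n / 2 * 4 ^ n : ℝ) : ℂ) := by
      rw [h1]
      push_cast
      ring
    exact_mod_cast h2
  · rw [← tsum_term_one hz]
    exact hasSum_levelSum (summable_norm_term_of_tsum_le (by norm_num) (by norm_num)
      tsum_term_one_le hz.le).1.of_norm
  · have h1 : ‖4 * z‖ < 1 := by
      rw [norm_mul]
      norm_num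
      linarith
    have h2 : HasSum (fun n : ℕ => (if n = 0 then 1 else 0) * z ^ n) 1 := by
      convert! hasSum_ite_eq (0 : ℕ) (1 : ℂ) using 1
      funext n
      by_cases h : n = 0 <;> simp [h]
    convert! (h2.sub (hasSum_sqrtCoeff h1)).div_const 2 using 1
    funext n
    ring

theorem levelSum_one_pos {n : ℕ} (hn : n ≠ 0) : 0 < levelSum (fun _ => 1) n := by
  obtain ⟨m, rfl⟩ := Nat.exists_eq_succ_of_ne_zero hn
  rw [levelSum_one hn]
  have := sqrtCoeff_neg m
  have h2 : (0 : ℝ) < 4 ^ (m + 1) := by positivity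
  have h3 : 0 < -sqrtCoeff (m + 1) / 2 := by linarith
  exact mul_pos h3 h2

/-! ### The variance of a tree parameter -/

/-- For `n = 0` there is no tree, and `uniformTree 0` is the zero measure. -/
theorem variance_uniformTree (w : OrderedTree → ℕ) {n : ℕ} (hn : n ≠ 0) :
    variance (fun T : OrderedTree => (w T : ℝ)) (uniformTree n) =
      levelSum (fun T => w T * w T) n / levelSum (fun _ => 1) n -
        (levelSum w n / levelSum (fun _ => 1) n) ^ 2 := by
  have hdisc : DiscreteMeasurableSpace OrderedTree := ⟨fun _ => trivial⟩
  have hfin := finite_order_eq n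
  have hcard : levelSum (fun _ => 1) n = hfin.toFinset.card := by simp [levelSum]
  have hne : {T : OrderedTree | T.order = n}.Nonempty := by
    have h1 := levelSum_one_pos hn
    rw [hcard, Nat.cast_pos, Finset.card_pos] at h1
    obtain ⟨T, hT⟩ := h1
    exact ⟨T, hfin.mem_toFinset.1 hT⟩
  have hprob : IsProbabilityMeasure (uniformTree n) := isProbabilityMeasure_uniformOn hfin hne
  have hint : ∀ f : OrderedTree → ℝ, ∫ T, f T ∂(uniformTree n) =
      (∑ T ∈ hfin.toFinset, f T) / levelSum (fun _ => 1) n := by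
    intro f
    rw [uniformTree, uniformOn, ProbabilityTheory.cond, integral_smul_measure,
      Measure.count_apply_finite _ hfin]
    nth_rw 2 [← hfin.coe_toFinset]
    have hon : IntegrableOn f (hfin.toFinset : Set OrderedTree) Measure.count := by
      rw [← (hfin.toFinset : Set OrderedTree).biUnion_of_singleton]
      exact integrableOn_finset_iUnion.2 fun T _ => integrableOn_singleton
        (hx := by rw [Measure.count_singleton]; exact ENNReal.one_lt_top)
    rw [setIntegral_finset _ hon]
    simp [hcard, Measure.real, div_eq_inv_mul]
  have hmem : MemLp (fun T : OrderedTree => (w T : ℝ)) 2 (uniformTree n) := by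
    refine MemLp.of_bound (Measurable.of_discrete.aestronglyMeasurable) (levelSum w n) ?_
    filter_upwards [ae_cond_mem (μ := Measure.count) (MeasurableSet.of_discrete
      (s := {T : OrderedTree | T.order = n}))] with T hT
    rw [Real.norm_of_nonneg (Nat.cast_nonneg _)]
    exact Finset.single_le_sum (f := fun T => (w T : ℝ)) (fun _ _ => Nat.cast_nonneg _)
      (hfin.mem_toFinset.2 hT)
  rw [variance_eq_sub hmem, hint, hint]
  simp [levelSum, sq]

section Asymptotics

variable {w : OrderedTree → ℕ} {z₀ a b : ℝ}

theorem levelSum_isEquivalent (hs : ∀ z : ℂ, ‖z‖ < z₀ → Summable (term w z))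
    (hf : HasDominantSqrtSingularity (genFun w) z₀ a b) :
    (fun n => levelSum w n * z₀ ^ n) ~[atTop] fun n => -b * sqrtCoeff n :=
  hf.coeff_isEquivalent fun z hz => hasSum_levelSum (hs z hz)

/-- A geometric decay of the coefficients of `√(1 - w)` is impossible. -/
theorem not_sqrtCoeff_le {C q : ℝ} (hq0 : 0 ≤ q) (hq : q < 1) :
    ¬ ∀ᶠ n in atTop, |sqrtCoeff n| ≤ C * q ^ n := by
  intro h
  have hlim : Tendsto (fun n : ℕ => 16 * C ^ 2 * ((n : ℝ) ^ 3 * (q ^ 2) ^ n)) atTop (𝓝 0) := by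
    have := (tendsto_pow_const_mul_const_pow_of_abs_lt_one 3 (r := q ^ 2) (by
      rw [abs_of_nonneg (sq_nonneg q)]
      nlinarith)).const_mul (16 * C ^ 2)
    simpa using this
  obtain ⟨n, h1, h2, h3⟩ := (h.and ((hlim.eventually_lt_const one_pos).and
    (eventually_ge_atTop 2))).exists
  have h4 := one_le_mul_sqrtCoeff_sq n h3
  have h5 : sqrtCoeff n ^ 2 ≤ (C * q ^ n) ^ 2 := by
    rw [← sq_abs]
    gcongr
  have h6 : 16 * (n : ℝ) ^ 3 * sqrtCoeff n ^ 2 ≤ 16 * (n : ℝ) ^ 3 * (C * q ^ n) ^ 2 := by gcongr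
  have h7 : 16 * (n : ℝ) ^ 3 * (C * q ^ n) ^ 2 = 16 * C ^ 2 * ((n : ℝ) ^ 3 * (q ^ 2) ^ n) := by
    rw [mul_pow, ← pow_mul, ← pow_mul, mul_comm n 2]
    ring
  linarith

/-- If the series converged at a point of modulus `> z₀`, its coefficients would decay
geometrically, contrary to their asymptotic behaviour. -/
theorem hasConvergenceRadius_of_hasDominantSqrtSingularity
    (hs : ∀ z : ℂ, ‖z‖ < z₀ → Summable (term w z))
    (hf : HasDominantSqrtSingularity (genFun w) z₀ a b) : HasConvergenceRadius w z₀ := by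
  have hz₀ := hf.1
  have hb := hf.2.1
  refine ⟨hs, fun z hz hsum => ?_⟩
  have hz0 : 0 < ‖z‖ := hz₀.trans hz
  have h1 := (hasSum_levelSum hsum).summable.tendsto_atTop_zero.norm
  rw [norm_zero] at h1
  have h2 := h1.eventually_le_const one_pos
  obtain ⟨K, hK0, hK⟩ := (levelSum_isEquivalent hs hf).isBigO_symm.exists_pos
  refine not_sqrtCoeff_le (C := K / |b|) (q := z₀ / ‖z‖) (by positivity) ((div_lt_one hz0).2 hz) ?_
  filter_upwards [h2, hK.bound] with n h3 h4
  rw [norm_mul, norm_pow, Complex.norm_real, Real.norm_of_nonneg (levelSum_nonneg _ _)] at h3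
  rw [norm_mul, norm_neg, Real.norm_eq_abs, Real.norm_eq_abs,
    Real.norm_of_nonneg (mul_nonneg (levelSum_nonneg _ _) (pow_nonneg hz₀.le _))] at h4
  have hb' : 0 < |b| := abs_pos.2 hb
  have h5 : levelSum w n * z₀ ^ n ≤ (z₀ / ‖z‖) ^ n := by
    rw [div_pow, le_div_iff₀ (by positivity)]
    calc levelSum w n * z₀ ^ n * ‖z‖ ^ n = levelSum w n * ‖z‖ ^ n * z₀ ^ n := by ring
      _ ≤ 1 * z₀ ^ n := by gcongr
      _ = z₀ ^ n := one_mul _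
  rw [div_mul_eq_mul_div, le_div_iff₀ hb', mul_comm]
  exact h4.trans (mul_le_mul_of_nonneg_left h5 hK0.le)

/-- If the second moment of `w` has a dominant square-root singularity and the series of `w`
itself converges far enough, the variance of `w` is asymptotic to the second moment. -/
theorem variance_isEquivalent {ρ : ℝ} (hρ : 0 < ρ)
    (hs : ∀ z : ℂ, ‖z‖ < z₀ → Summable (term (fun T => w T * w T) z))
    (hf : HasDominantSqrtSingularity (genFun fun T => w T * w T) z₀ a b)
    (hmean : Summable (term w (ρ : ℂ))) (hρz : z₀ < 4 * ρ ^ 2) :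
    (fun n : ℕ => variance (fun T : OrderedTree => (w T : ℝ)) (uniformTree n))
      ~[atTop] fun n : ℕ => 2 * b * (1 / (4 * z₀)) ^ n := by
  have hz₀ := hf.1
  have hb := hf.2.1
  have hvar : (fun n : ℕ => variance (fun T : OrderedTree => (w T : ℝ)) (uniformTree n)) =ᶠ[atTop]
      fun n => levelSum (fun T => w T * w T) n / levelSum (fun _ => 1) n -
        (levelSum w n / levelSum (fun _ => 1) n) ^ 2 := by
    filter_upwards [eventually_ne_atTop 0] with n hn using variance_uniformTree w hn
  refine IsEquivalent.congr_left ?_ hvar.symm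
  have hone : (fun n => levelSum (fun _ => 1) n) =ᶠ[atTop] fun n => -sqrtCoeff n / 2 * 4 ^ n := by
    filter_upwards [eventually_ne_atTop 0] with n hn using levelSum_one hn
  have hsecond : (fun n => levelSum (fun T => w T * w T) n / levelSum (fun _ => 1) n) ~[atTop]
      fun n : ℕ => 2 * b * (1 / (4 * z₀)) ^ n := by
    have h1 := (levelSum_isEquivalent hs hf).div
      (IsEquivalent.refl (u := fun n => levelSum (fun _ => 1) n * z₀ ^ n))
    refine (h1.congr_left ?_).congr_right ?_
    · refine Eventually.of_forall fun n => ?_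
      have : z₀ ^ n ≠ 0 := pow_ne_zero n hz₀.ne'
      simp only [Pi.div_apply]
      rw [mul_div_mul_right _ _ this]
    · filter_upwards [eventually_ne_atTop 0] with n hn
      obtain ⟨m, rfl⟩ := Nat.exists_eq_succ_of_ne_zero hn
      have h2 := (sqrtCoeff_neg m).ne
      simp only [Pi.div_apply]
      rw [levelSum_one hn, one_div, inv_pow, mul_pow]
      have : z₀ ^ (m + 1) ≠ 0 := pow_ne_zero _ hz₀.ne'
      field_simp
  refine hsecond.sub_isLittleO ?_
  -- The mean is at most of order `n ^ (3/2) (4 ρ)⁻ⁿ`.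
  have h1 : ∀ᶠ n in atTop, levelSum w n * ρ ^ n ≤ 1 := by
    have h2 := (hasSum_levelSum hmean).summable.tendsto_atTop_zero.norm
    rw [norm_zero] at h2
    filter_upwards [h2.eventually_le_const one_pos] with n hn
    rwa [norm_mul, norm_pow, Complex.norm_real, Complex.norm_real, Real.norm_of_nonneg hρ.le,
      Real.norm_of_nonneg (levelSum_nonneg _ _)] at hn
  have hq : z₀ / (4 * ρ ^ 2) < 1 := (div_lt_one (by positivity)).2 hρz
  have hlim : Tendsto (fun n : ℕ => 64 / (2 * |b|) * ((n : ℝ) ^ 3 * (z₀ / (4 * ρ ^ 2)) ^ n)) atTop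
      (𝓝 0) := by
    have := (tendsto_pow_const_mul_const_pow_of_abs_lt_one 3 (r := z₀ / (4 * ρ ^ 2)) (by
      rwa [abs_of_nonneg (by positivity)])).const_mul (64 / (2 * |b|))
    simpa using this
  rw [isLittleO_iff]
  intro c hc
  filter_upwards [h1, hlim.eventually_le_const hc, eventually_ge_atTop 2] with n h2 h3 hn
  have h4 := one_le_mul_sqrtCoeff_sq n hn
  rw [levelSum_one (by omega)]
  have hb' : 0 < |b| := abs_pos.2 hb
  have hs0 : 0 < sqrtCoeff n ^ 2 := by
    by_contra hcon
    have : sqrtCoeff n ^ 2 = 0 := le_antisymm (not_lt.1 hcon) (sq_nonneg _)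
    rw [this] at h4
    norm_num at h4
  have hρn : 0 < ρ ^ n := by positivity
  have hzn : 0 < z₀ ^ n := by positivity
  have h5 : (levelSum w n / (-sqrtCoeff n / 2 * 4 ^ n)) ^ 2 ≤
      64 * (n : ℝ) ^ 3 / ((4 * ρ) ^ n) ^ 2 := by
    have h6 : (levelSum w n * ρ ^ n) ^ 2 ≤ 1 :=
      pow_le_one₀ (mul_nonneg (levelSum_nonneg _ _) hρn.le) h2
    have h7 : 0 < (-sqrtCoeff n / 2 * 4 ^ n) ^ 2 := by
      rw [show (-sqrtCoeff n / 2 * 4 ^ n) ^ 2 = sqrtCoeff n ^ 2 * (4 ^ n / 2) ^ 2 by ring]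
      exact mul_pos hs0 (by positivity)
    rw [div_pow, div_le_div_iff₀ h7 (by positivity)]
    calc levelSum w n ^ 2 * ((4 * ρ) ^ n) ^ 2 = (levelSum w n * ρ ^ n) ^ 2 * (4 ^ n) ^ 2 := by
          rw [mul_pow 4 ρ]
          ring
      _ ≤ 1 * (4 ^ n) ^ 2 := by gcongr
      _ ≤ (16 * (n : ℝ) ^ 3 * sqrtCoeff n ^ 2) * (4 ^ n) ^ 2 := by gcongr
      _ = _ := by ring
  rw [Real.norm_of_nonneg (sq_nonneg _), norm_mul, norm_mul, Real.norm_eq_abs b,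
    Real.norm_of_nonneg (by positivity : (0 : ℝ) ≤ (1 / (4 * z₀)) ^ n), Real.norm_two]
  refine h5.trans ?_
  have h6 : 64 * (n : ℝ) ^ 3 / ((4 * ρ) ^ n) ^ 2 =
      (64 / (2 * |b|) * ((n : ℝ) ^ 3 * (z₀ / (4 * ρ ^ 2)) ^ n)) *
        (2 * |b| * (1 / (4 * z₀)) ^ n) := by
    simp only [div_pow, mul_pow, one_pow]
    have : ((4 : ℝ) ^ n) ^ 2 = 4 ^ n * 4 ^ n := sq _
    rw [pow_right_comm ρ 2 n]
    field_simp
  rw [h6]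
  gcongr

end Asymptotics

end OrderedTree

/-! ### The singular point in terms of the logarithmic derivative -/

open Metric in
/-- A form of `hasDominantSqrtSingularity_of_implicit` in which `φ` is given with its logarithmic
derivative `L`; the equation degenerates where `L(τ) = 1 / τ`. -/
theorem hasDominantSqrtSingularity_of_logDeriv {φ L dL H dH X : ℂ → ℂ} {U : Set ℂ}
    {τ z₀ l a H₁ : ℝ} (hU : IsOpen U) (hball : closedBall (0 : ℂ) τ ⊆ U)
    (hφ : ∀ x ∈ U, HasDerivAt φ (φ x * L x) x) (hL : ∀ x ∈ U, HasDerivAt L (dL x) x)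
    (hH : ∀ x ∈ U, HasDerivAt H (dH x) x) (hτ : 0 < τ) (hz₀ : 0 < z₀) (hφ0 : φ 0 ≠ 0)
    (h0 : z₀ * φ τ = τ) (h1 : L τ = 1 / τ) (h2 : dL τ = l) (hl : 0 < 1 / τ ^ 2 + l)
    (hHτ : H τ = a) (hH1 : dH τ = H₁) (hH₁ : H₁ ≠ 0)
    (hlip : ∀ x ∈ closedBall (0 : ℂ) τ, ∀ y ∈ closedBall (0 : ℂ) τ, x ≠ y →
      z₀ * ‖φ x - φ y‖ < ‖x - y‖)
    (hder : ∀ x ∈ closedBall (0 : ℂ) τ, x ≠ τ → z₀ * ‖φ x * L x‖ < 1)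
    (hX : ∀ z : ℂ, ‖z‖ ≤ z₀ → ‖X z‖ ≤ τ ∧ X z = z * φ (X z)) :
    HasDominantSqrtSingularity (fun z => H (X z)) z₀ a
      (H₁ * Real.sqrt (2 / (1 / τ ^ 2 + l))) := by
  have hz₀' : (z₀ : ℂ) ≠ 0 := by exact_mod_cast hz₀.ne'
  have hτ' : (τ : ℂ) ≠ 0 := by exact_mod_cast hτ.ne'
  have hτU : (τ : ℂ) ∈ U := hball (by simp [abs_of_pos hτ])
  have hφa : ∀ x ∈ U, AnalyticAt ℂ φ x := fun x hx =>
    DifferentiableOn.analyticAt (s := U)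
      (fun y hy => (hφ y hy).differentiableAt.differentiableWithinAt) (hU.mem_nhds hx)
  have hHa : ∀ x ∈ U, AnalyticAt ℂ H x := fun x hx =>
    DifferentiableOn.analyticAt (s := U)
      (fun y hy => (hH y hy).differentiableAt.differentiableWithinAt) (hU.mem_nhds hx)
  have hφτ : φ τ = τ / z₀ := by
    field_simp
    linear_combination h0
  have hd2 : deriv (deriv φ) τ = ((τ / z₀ * (1 / τ ^ 2 + l) : ℝ) : ℂ) := by
    have h3 : deriv φ =ᶠ[𝓝 (τ : ℂ)] fun x => φ x * L x := by
      filter_upwards [hU.mem_nhds hτU] with x hx using (hφ x hx).deriv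
    rw [h3.deriv_eq, ((hφ τ hτU).fun_mul (hL τ hτU)).deriv, h1, h2, hφτ]
    push_cast
    field_simp
  have hb : 2 * τ / (z₀ * (τ / z₀ * (1 / τ ^ 2 + l))) = 2 / (1 / τ ^ 2 + l) := by
    have := hl.ne'
    rw [show z₀ * (τ / z₀ * (1 / τ ^ 2 + l)) = τ * (1 / τ ^ 2 + l) by field_simp]
    rw [mul_comm 2 τ, mul_div_mul_left _ _ hτ.ne']
  rw [← hb]
  refine hasDominantSqrtSingularity_of_implicit hτ hz₀ (fun x hx => hφa x (hball hx))
    (fun x hx => hHa x (hball hx)) hφ0 h0 ?_ hd2 (mul_pos (div_pos hτ hz₀) hl) hHτ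
    ((hH τ hτU).deriv.trans hH1) hH₁ hlip (fun x hx hne => ?_) hX
  · rw [(hφ τ hτU).deriv, h1, hφτ]
    field_simp
  · rw [(hφ x (hball hx)).deriv]
    exact hder x hx hne

/-- On the disc of radius `τ`, the minimum of `|1 - x|` is attained at `τ` only. -/
theorem lt_norm_one_sub {τ : ℝ} {x : ℂ} (hx : x ∈ Metric.closedBall (0 : ℂ) τ) (hne : x ≠ τ) :
    1 - τ < ‖1 - x‖ := by
  have h1 : ‖x‖ ≤ τ := mem_closedBall_zero_iff.1 hx
  have h2 := Complex.re_le_norm (1 - x)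
  have h3 := Complex.re_le_norm x
  simp only [Complex.sub_re, Complex.one_re] at h2
  by_contra hcon
  have h4 : x.re = ‖x‖ := by linarith
  have h5 : x.re = τ := by linarith
  have h6 : x.im = 0 := by
    have h7 := Complex.sq_norm x
    rw [Complex.normSq_apply, ← h4] at h7
    nlinarith
  exact hne (Complex.ext (by simpa using h5) (by simpa using h6))

theorem sub_mul_le_norm_one_sub {τ c : ℝ} (hc : 0 ≤ c) {x : ℂ}
    (hx : x ∈ Metric.closedBall (0 : ℂ) τ) : 1 - c * τ ≤ ‖1 - c * x‖ := by
  have h1 : ‖x‖ ≤ τ := mem_closedBall_zero_iff.1 hx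
  have h2 := norm_sub_norm_le (1 : ℂ) (c * x)
  rw [norm_one, norm_mul, Complex.norm_real, Real.norm_of_nonneg hc] at h2
  nlinarith

/-! ### Sums of weights -/

namespace OrderedTree

open scoped ENNReal

theorem term_eq_add {R : Type*} [CommSemiring R] {w w₁ w₂ : OrderedTree → ℕ}
    (h : ∀ T, w T = w₁ T + w₂ T) (x : R) (T : OrderedTree) :
    term w x T = term w₁ x T + term w₂ x T := by
  simp only [term, h T]
  push_cast
  ring

theorem tsum_term_add_le {E : Set OrderedTree} {w w₁ w₂ : OrderedTree → ℕ}
    (h : ∀ T, w T = w₁ T + w₂ T) {x : ℝ≥0∞} {b₁ b₂ : ℝ} (hb₁ : 0 ≤ b₁) (hb₂ : 0 ≤ b₂)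
    (h₁ : ∑' T : E, term w₁ x T ≤ ENNReal.ofReal b₁)
    (h₂ : ∑' T : E, term w₂ x T ≤ ENNReal.ofReal b₂) :
    ∑' T : E, term w x T ≤ ENNReal.ofReal (b₁ + b₂) := by
  simp only [term_eq_add h]
  rw [ENNReal.tsum_add, ENNReal.ofReal_add hb₁ hb₂]
  exact add_le_add h₁ h₂

theorem summable_norm_term_add {w w₁ w₂ : OrderedTree → ℕ} (h : ∀ T, w T = w₁ T + w₂ T) {z : ℂ}
    (h₁ : Summable fun T => ‖term w₁ z T‖) (h₂ : Summable fun T => ‖term w₂ z T‖) :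
    (Summable fun T => ‖term w z T‖) ∧
      ∑' T, term w z T = ∑' T, term w₁ z T + ∑' T, term w₂ z T := by
  constructor
  · refine (h₁.add h₂).of_nonneg_of_le (fun _ => norm_nonneg _) fun T => ?_
    rw [term_eq_add h]
    exact norm_add_le _ _
  · simp only [term_eq_add h]
    exact h₁.of_norm.tsum_add h₂.of_norm

theorem isBranching_mul_unit {w w' v v' : OrderedTree → ℕ}
    (h : IsBranching (κ := fun _ => Unit) w fun _ _ _ => v)
    (h' : IsBranching (κ := fun _ => Unit) w' fun _ _ _ => v') :
    IsBranching (κ := fun _ => Unit) (fun T => w T * w' T) fun _ _ _ T => v T * v' T := by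
  intro k g
  simp [h k g, h' k g, Finset.prod_mul_distrib]

theorem IsBranching.tsum_eq {κ : ℕ → Type} [∀ k, Fintype (κ k)] {w : OrderedTree → ℕ}
    {v : ∀ k, κ k → Fin k → OrderedTree → ℕ} (h : IsBranching w v) {z S : ℂ}
    (hw : Summable (term w z)) {B : ∀ k, κ k → Fin k → ℂ}
    (hv : ∀ k e l, Summable fun T => ‖term (v k e l) z T‖)
    (hB : ∀ k e l, ∑' T, term (v k e l) z T = B k e l)
    (hS : HasSum (fun k => ∑ e, ∏ l, B k e l) S) : ∑' T, term w z T = z * S := by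
  have h1 := h.hasSum z hw hv
  simp only [hB] at h1
  exact h1.unique (hS.mul_left z)

/-- The sum of a weight that is a product over the branches. -/
theorem IsBranching.tsum_unit {w v : OrderedTree → ℕ}
    (h : IsBranching (κ := fun _ => Unit) w fun _ _ _ => v) {z : ℂ}
    (hw : Summable fun T => ‖term w z T‖) (hv : Summable fun T => ‖term v z T‖)
    (hlt : ‖∑' T, term v z T‖ < 1) :
    ∑' T, term w z T = z / (1 - ∑' T, term v z T) := by
  rw [h.tsum_eq hw.of_norm (fun _ _ _ => hv) (fun _ _ _ => rfl) (hasSum_sum_prod_unit hlt),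
    mul_one_div]

theorem one_sub_ne_zero_of_norm_lt {t : ℂ} (h : ‖t‖ < 1) : 1 - t ≠ 0 := by
  intro h1
  rw [← sub_eq_zero.1 h1, norm_one] at h
  exact lt_irrefl _ h

end OrderedTree

/-! ### Independent sets: the analytic functions -/

section SigmaFunctions

variable {K : Type*} [Field K]

/-- The series `SS₂₂` in terms of the uniformizing parameter `x = SS₁₂ / (1 - SS₂₂)`. -/
def sigU (x : K) : K := x * (1 - x) / (1 - 2 * x)

/-- The derivative of `sigU`. -/
def sigU' (x : K) : K := 1 / 2 + 1 / (2 * (1 - 2 * x) ^ 2)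

/-- The function `1 / (1 - SS₂₂)` of the uniformizing parameter. -/
def sigV (x : K) : K := 1 / (1 - sigU x)

/-- The function `φ` in the equation `x = z φ(x)` for the uniformizing parameter. -/
def sigPhi (x : K) : K := sigV x ^ 2 / (1 - x)

/-- The logarithmic derivative of `sigPhi`. -/
def sigL (x : K) : K := 2 * sigU' x * sigV x + 1 / (1 - x)

/-- The derivative of `sigL`. -/
def sigL' (x : K) : K :=
  4 / (1 - 2 * x) ^ 3 * sigV x + 2 * sigU' x ^ 2 * sigV x ^ 2 + 1 / (1 - x) ^ 2

/-- The series `SS` in terms of the uniformizing parameter. -/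
def sigH (x : K) : K := 1 - (1 - 2 * x) * (1 - sigU x) ^ 2

/-- The derivative of `sigH`. -/
def sigH' (x : K) : K := 2 * (1 - sigU x) ^ 2 + 2 * (1 - 2 * x) * (1 - sigU x) * sigU' x

theorem one_sub_sigU {x : K} (hx : 1 - 2 * x ≠ 0) :
    1 - sigU x = (1 - 3 * x + x ^ 2) / (1 - 2 * x) := by
  have hx' : 1 - x * 2 ≠ 0 := by rwa [mul_comm x 2]
  unfold sigU
  field_simp
  ring

end SigmaFunctions

/-- The set on which the functions of the uniformizing parameter are analytic. -/
def sigDomain : Set ℂ := {x | 1 - x ≠ 0 ∧ 1 - 2 * x ≠ 0 ∧ 1 - 3 * x + x ^ 2 ≠ 0}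

theorem isOpen_sigDomain : IsOpen sigDomain :=
  (isOpen_ne_fun (by fun_prop) continuous_const).inter
    ((isOpen_ne_fun (by fun_prop) continuous_const).inter
      (isOpen_ne_fun (by fun_prop) continuous_const))

theorem one_sub_sigU_ne_zero {x : ℂ} (hx : x ∈ sigDomain) : 1 - sigU x ≠ 0 := by
  rw [one_sub_sigU hx.2.1]
  exact div_ne_zero hx.2.2 hx.2.1

theorem hasDerivAt_sigU {x : ℂ} (hx : x ∈ sigDomain) :
    HasDerivAt sigU (sigU' x) x := by
  have h1 := hx.2.1
  have h1' : 1 - x * 2 ≠ 0 := by rwa [mul_comm x 2]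
  have h2 : HasDerivAt (fun x : ℂ => 1 - 2 * x) (-(2 * 1)) x :=
    ((hasDerivAt_id' x).const_mul 2).const_sub 1
  have h3 := ((hasDerivAt_id' x).mul ((hasDerivAt_id' x).const_sub 1)).div h2 h1
  refine h3.congr_deriv ?_
  simp only [sigU', Pi.mul_apply]
  field_simp
  ring

theorem hasDerivAt_sigU' {x : ℂ} (hx : x ∈ sigDomain) :
    HasDerivAt sigU' (2 / (1 - 2 * x) ^ 3) x := by
  have h1 := hx.2.1
  have h1' : 1 - x * 2 ≠ 0 := by rwa [mul_comm x 2]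
  have h2 : HasDerivAt (fun x : ℂ => 1 - 2 * x) (-(2 * 1)) x :=
    ((hasDerivAt_id' x).const_mul 2).const_sub 1
  have h3 := ((hasDerivAt_const x (1 : ℂ)).div ((h2.fun_pow 2).const_mul 2)
    (mul_ne_zero two_ne_zero (pow_ne_zero 2 h1))).const_add (1 / 2)
  refine h3.congr_deriv ?_
  field_simp
  ring

theorem hasDerivAt_sigV {x : ℂ} (hx : x ∈ sigDomain) :
    HasDerivAt sigV (sigU' x * sigV x ^ 2) x := by
  have h1 := one_sub_sigU_ne_zero hx
  have h3 := (hasDerivAt_const x (1 : ℂ)).div ((hasDerivAt_sigU hx).const_sub 1) h1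
  refine h3.congr_deriv ?_
  simp only [sigV]
  field_simp
  ring

theorem hasDerivAt_sigPhi {x : ℂ} (hx : x ∈ sigDomain) :
    HasDerivAt sigPhi (sigPhi x * sigL x) x := by
  have h1 := hx.1
  have h3 := ((hasDerivAt_sigV hx).fun_pow 2).div ((hasDerivAt_id' x).const_sub 1) h1
  refine h3.congr_deriv ?_
  simp only [sigPhi, sigL]
  field_simp
  ring

theorem hasDerivAt_sigL {x : ℂ} (hx : x ∈ sigDomain) :
    HasDerivAt sigL (sigL' x) x := by
  have h1 := hx.1
  have h3 := (((hasDerivAt_sigU' hx).const_mul 2).mul (hasDerivAt_sigV hx)).add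
    ((hasDerivAt_const x (1 : ℂ)).div ((hasDerivAt_id' x).const_sub 1) h1)
  refine h3.congr_deriv ?_
  simp only [sigL']
  field_simp
  ring

theorem hasDerivAt_sigH {x : ℂ} (hx : x ∈ sigDomain) :
    HasDerivAt sigH (sigH' x) x := by
  have h2 : HasDerivAt (fun x : ℂ => 1 - 2 * x) (-(2 * 1)) x :=
    ((hasDerivAt_id' x).const_mul 2).const_sub 1
  have h3 := (h2.mul (((hasDerivAt_sigU hx).const_sub 1).fun_pow 2)).const_sub 1
  refine h3.congr_deriv ?_
  simp only [sigH']
  ring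

section SigmaBounds

open Metric

variable {τ : ℝ} {x y : ℂ}

theorem closedBall_subset_sigDomain (hτ : τ < 1 / 5) : closedBall (0 : ℂ) τ ⊆ sigDomain := by
  intro x hx
  have h1 : ‖x‖ ≤ τ := mem_closedBall_zero_iff.1 hx
  have h2 := sub_mul_le_norm_one_sub zero_le_one hx
  have h3 := sub_mul_le_norm_one_sub zero_le_two hx
  push_cast at h2 h3
  rw [one_mul, one_mul] at h2
  refine ⟨norm_pos_iff.1 (by linarith), norm_pos_iff.1 (by linarith), fun h => ?_⟩
  have h4 : (1 : ℂ) = 3 * x - x ^ 2 := by linear_combination h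
  have h5 : (1 : ℝ) ≤ 3 * τ + τ ^ 2 := by
    calc (1 : ℝ) = ‖(1 : ℂ)‖ := norm_one.symm
      _ = ‖3 * x - x ^ 2‖ := by rw [← h4]
      _ ≤ ‖3 * x‖ + ‖x ^ 2‖ := norm_sub_le _ _
      _ = 3 * ‖x‖ + ‖x‖ ^ 2 := by rw [norm_mul, norm_pow]; norm_num
      _ ≤ 3 * τ + τ ^ 2 := by gcongr
  have h0 : 0 ≤ τ := (norm_nonneg x).trans h1
  nlinarith

theorem norm_one_div_one_sub_le (hτ : τ < 1) (hx : x ∈ closedBall (0 : ℂ) τ) :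
    ‖1 / (1 - x)‖ ≤ 1 / (1 - τ) := by
  have h2 := sub_mul_le_norm_one_sub zero_le_one hx
  push_cast at h2
  rw [one_mul, one_mul] at h2
  rw [norm_div, norm_one]
  exact one_div_le_one_div_of_le (by linarith) h2

theorem norm_one_div_one_sub_lt (hτ : τ < 1) (hx : x ∈ closedBall (0 : ℂ) τ) (hne : x ≠ τ) :
    ‖1 / (1 - x)‖ < 1 / (1 - τ) := by
  rw [norm_div, norm_one]
  exact one_div_lt_one_div_of_lt (by linarith) (lt_norm_one_sub hx hne)

theorem norm_one_div_one_sub_two_mul_le (hτ : τ < 1 / 2) (hx : x ∈ closedBall (0 : ℂ) τ) :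
    ‖1 / (1 - 2 * x)‖ ≤ 1 / (1 - 2 * τ) := by
  have h2 := sub_mul_le_norm_one_sub zero_le_two hx
  push_cast at h2
  rw [norm_div, norm_one]
  exact one_div_le_one_div_of_le (by linarith) h2

theorem norm_mul_one_div_one_sub_lt (hτ : τ < 1) (hx : x ∈ closedBall (0 : ℂ) τ)
    (hy : y ∈ closedBall (0 : ℂ) τ) (hxy : x ≠ y) :
    ‖1 / (1 - x)‖ * ‖1 / (1 - y)‖ < 1 / (1 - τ) * (1 / (1 - τ)) := by
  have hpos : 0 < 1 / (1 - τ) := by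
    apply one_div_pos.2
    linarith
  by_cases h : x = τ
  · have h1 := norm_one_div_one_sub_lt hτ hy fun h' => hxy (h.trans h'.symm)
    exact mul_lt_mul' (norm_one_div_one_sub_le hτ hx) h1 (norm_nonneg _) hpos
  · exact (mul_le_mul_of_nonneg_left (norm_one_div_one_sub_le hτ hy) (norm_nonneg _)).trans_lt
      (mul_lt_mul_of_pos_right (norm_one_div_one_sub_lt hτ hx h) hpos)

theorem sigU_real_lt_one (hτ0 : 0 < τ) (hτ : τ < 1 / 5) : sigU τ < 1 := by
  have h := one_sub_sigU (x := τ) (by linarith)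
  have : 0 < (1 - 3 * τ + τ ^ 2) / (1 - 2 * τ) := by
    apply div_pos <;> nlinarith
  linarith

theorem norm_sigU'_le (hτ : τ < 1 / 5) (hx : x ∈ closedBall (0 : ℂ) τ) :
    ‖sigU' x‖ ≤ sigU' τ := by
  have h1 := norm_one_div_one_sub_two_mul_le (by linarith) hx
  have h2 : sigU' x = 1 / 2 + 1 / 2 * (1 / (1 - 2 * x)) ^ 2 := by
    simp only [sigU']
    rw [one_div_pow, one_div_mul_one_div]
  have h3 : sigU' τ = 1 / 2 + 1 / 2 * (1 / (1 - 2 * τ)) ^ 2 := by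
    simp only [sigU']
    rw [one_div_pow, one_div_mul_one_div]
  rw [h2, h3]
  refine (norm_add_le _ _).trans ?_
  rw [norm_mul, norm_pow]
  norm_num only [norm_div, norm_one, Complex.norm_ofNat] at h1 ⊢
  gcongr

theorem norm_sigU_sub_le (hτ : τ < 1 / 5) (hx : x ∈ closedBall (0 : ℂ) τ)
    (hy : y ∈ closedBall (0 : ℂ) τ) : ‖sigU x - sigU y‖ ≤ sigU' τ * ‖x - y‖ := by
  have h1 := norm_one_div_one_sub_two_mul_le (by linarith) hx
  have h2 := norm_one_div_one_sub_two_mul_le (by linarith) hy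
  have h3 : sigU x - sigU y =
      (1 / 2 + 1 / 2 * ((1 / (1 - 2 * x)) * (1 / (1 - 2 * y)))) * (x - y) := by
    have hx := (closedBall_subset_sigDomain hτ hx).2.1
    have hy := (closedBall_subset_sigDomain hτ hy).2.1
    have hx' : 1 - x * 2 ≠ 0 := by rwa [mul_comm]
    have hy' : 1 - y * 2 ≠ 0 := by rwa [mul_comm]
    simp only [sigU]
    field_simp
    ring
  have h4 : sigU' τ = 1 / 2 + 1 / 2 * ((1 / (1 - 2 * τ)) * (1 / (1 - 2 * τ))) := by
    simp only [sigU']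
    rw [← sq, one_div_pow, one_div_mul_one_div]
  rw [h3, h4, norm_mul]
  refine mul_le_mul_of_nonneg_right ((norm_add_le _ _).trans ?_) (norm_nonneg _)
  rw [norm_mul, norm_mul, show ‖(1 / 2 : ℂ)‖ = 1 / 2 by norm_num]
  have hp : 0 ≤ 1 / (1 - 2 * τ) := (norm_nonneg _).trans h1
  gcongr

theorem norm_sigU_le (hτ : τ < 1 / 5) (hx : x ∈ closedBall (0 : ℂ) τ) : ‖sigU x‖ ≤ sigU τ := by
  have h0 : ‖x‖ ≤ τ := mem_closedBall_zero_iff.1 hx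
  have h1 := norm_one_div_one_sub_two_mul_le (by linarith) hx
  have hτ0 : 0 ≤ τ := (norm_nonneg x).trans h0
  have h3 : sigU x = x * (1 / 2 + 1 / 2 * (1 / (1 - 2 * x))) := by
    have hx' : 1 - x * 2 ≠ 0 := by
      rw [mul_comm]
      exact (closedBall_subset_sigDomain hτ hx).2.1
    simp only [sigU]
    field_simp
    ring
  have h4 : sigU τ = τ * (1 / 2 + 1 / 2 * (1 / (1 - 2 * τ))) := by
    have hx' : 1 - τ * 2 ≠ 0 := by linarith
    simp only [sigU]
    field_simp
    ring
  rw [h3, h4, norm_mul]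
  refine mul_le_mul h0 ((norm_add_le _ _).trans ?_) (norm_nonneg _) hτ0
  rw [norm_mul, show ‖(1 / 2 : ℂ)‖ = 1 / 2 by norm_num]
  gcongr

theorem norm_sigV_le (hτ0 : 0 < τ) (hτ : τ < 1 / 5) (hx : x ∈ closedBall (0 : ℂ) τ) :
    ‖sigV x‖ ≤ sigV τ := by
  have h1 := norm_sigU_le hτ hx
  have h2 := norm_sub_norm_le (1 : ℂ) (sigU x)
  have h3 := sigU_real_lt_one hτ0 hτ
  rw [norm_one] at h2
  simp only [sigV]
  rw [norm_div, norm_one]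
  exact one_div_le_one_div_of_le (by linarith) (by linarith)

/-- On the disc, `sigPhi` is a strict contraction relative to its derivative at `τ`. -/
theorem norm_sigPhi_sub_lt (hτ0 : 0 < τ) (hτ : τ < 1 / 5) (hx : x ∈ closedBall (0 : ℂ) τ)
    (hy : y ∈ closedBall (0 : ℂ) τ) (hxy : x ≠ y) :
    ‖sigPhi x - sigPhi y‖ < sigPhi τ * sigL τ * ‖x - y‖ := by
  have hdx := closedBall_subset_sigDomain hτ hx
  have hdy := closedBall_subset_sigDomain hτ hy
  have h1 : sigPhi x - sigPhi y = sigV x ^ 2 * ((x - y) * ((1 / (1 - x)) * (1 / (1 - y)))) +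
      (sigU x - sigU y) * (sigV x * sigV y * (sigV x + sigV y)) * (1 / (1 - y)) := by
    have h2 := hdx.1
    have h3 := hdy.1
    have h4 := one_sub_sigU_ne_zero hdx
    have h5 := one_sub_sigU_ne_zero hdy
    simp only [sigPhi, sigV]
    field_simp
    ring
  have h2 : sigPhi τ * sigL τ * ‖x - y‖ = sigV τ ^ 2 * (‖x - y‖ * (1 / (1 - τ) * (1 / (1 - τ)))) +
      (sigU' τ * ‖x - y‖) * (sigV τ * sigV τ * (sigV τ + sigV τ)) * (1 / (1 - τ)) := by
    simp only [sigPhi, sigL]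
    ring
  have hV : 0 < sigV τ := one_div_pos.2 (by linarith [sigU_real_lt_one hτ0 hτ])
  have hU' : 0 ≤ sigU' τ := (norm_nonneg _).trans (norm_sigU'_le hτ hx)
  have hVx := norm_sigV_le hτ0 hτ hx
  have hVy := norm_sigV_le hτ0 hτ hy
  have hA := norm_mul_one_div_one_sub_lt (by linarith) hx hy hxy
  have hd : 0 < ‖x - y‖ := norm_pos_iff.2 (sub_ne_zero.2 hxy)
  rw [h1, h2]
  refine (norm_add_le _ _).trans_lt (add_lt_add_of_lt_of_le ?_ ?_)
  · rw [norm_mul, norm_pow, norm_mul, norm_mul]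
    calc ‖sigV x‖ ^ 2 * (‖x - y‖ * (‖1 / (1 - x)‖ * ‖1 / (1 - y)‖))
        ≤ sigV τ ^ 2 * (‖x - y‖ * (‖1 / (1 - x)‖ * ‖1 / (1 - y)‖)) := by gcongr
      _ < _ := by gcongr
  · rw [norm_mul, norm_mul, norm_mul, norm_mul]
    have h3 := norm_sigU_sub_le hτ hx hy
    have h4 := norm_one_div_one_sub_le (by linarith) hy
    have h5 := (norm_add_le (sigV x) (sigV y)).trans (add_le_add hVx hVy)
    gcongr

theorem norm_sigPhi_mul_sigL_lt (hτ0 : 0 < τ) (hτ : τ < 1 / 5) (hx : x ∈ closedBall (0 : ℂ) τ)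
    (hne : x ≠ τ) : ‖sigPhi x * sigL x‖ < sigPhi τ * sigL τ := by
  have h1 : sigPhi x * sigL x = sigV x ^ 2 * ((1 / (1 - x)) ^ 2) +
      2 * sigU' x * sigV x ^ 3 * (1 / (1 - x)) := by
    simp only [sigPhi, sigL]
    ring
  have h2 : sigPhi τ * sigL τ = sigV τ ^ 2 * ((1 / (1 - τ)) ^ 2) +
      2 * sigU' τ * sigV τ ^ 3 * (1 / (1 - τ)) := by
    simp only [sigPhi, sigL]
    ring
  have hV : 0 < sigV τ := one_div_pos.2 (by linarith [sigU_real_lt_one hτ0 hτ])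
  have hU' := norm_sigU'_le hτ hx
  have hU0 : 0 ≤ sigU' τ := (norm_nonneg _).trans hU'
  have hVx := norm_sigV_le hτ0 hτ hx
  have hA := norm_one_div_one_sub_lt (by linarith) hx hne
  rw [h1, h2]
  refine (norm_add_le _ _).trans_lt (add_lt_add_of_lt_of_le ?_ ?_)
  · rw [norm_mul, norm_pow, norm_pow]
    calc ‖sigV x‖ ^ 2 * ‖1 / (1 - x)‖ ^ 2 ≤ sigV τ ^ 2 * ‖1 / (1 - x)‖ ^ 2 := by gcongr
      _ < _ := by gcongr
  · rw [norm_mul, norm_mul, norm_mul, norm_pow, Complex.norm_ofNat]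
    gcongr

end SigmaBounds

/-! ### Independent sets: the generating functions -/

namespace OrderedTree

theorem sigma_mul_left_eq (v : OrderedTree → ℕ) (T : OrderedTree) :
    T.sigma * v T = T.sigma₁ * v T + T.sigma₂ * v T := by
  rw [sigma_eq]
  ring

/-- A solution of the equations for `SS₁₁`, `SS₁₂`, `SS₂₂` at `x > 0` bounds these series. -/
theorem sigma_tsum_le {x A v u : ℝ} (hx : 0 ≤ x) (hA : 0 ≤ A) (hv : 0 ≤ v) (hu : 0 ≤ u)
    (hlt : A + v + (v + u) < 1) (h₁₁ : x * (1 / (1 - u)) = A) (h₁₂ : x * (1 / (1 - (v + u))) = v)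
    (h₂₂ : x * (1 / (1 - (A + v + (v + u)))) = u) :
    ∑' T, term (fun T => T.sigma₁ * T.sigma₁) (ENNReal.ofReal x) T ≤ ENNReal.ofReal A ∧
    ∑' T, term (fun T => T.sigma₁ * T.sigma₂) (ENNReal.ofReal x) T ≤ ENNReal.ofReal v ∧
    ∑' T, term (fun T => T.sigma₂ * T.sigma₂) (ENNReal.ofReal x) T ≤ ENNReal.ofReal u := by
  have key := tsum_le_of_supersolution (ι := Fin 3)
    ![term (fun T => T.sigma₁ * T.sigma₁) (ENNReal.ofReal x),
      term (fun T => T.sigma₁ * T.sigma₂) (ENNReal.ofReal x),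
      term (fun T => T.sigma₂ * T.sigma₂) (ENNReal.ofReal x)]
    ![ENNReal.ofReal A, ENNReal.ofReal v, ENNReal.ofReal u] ?_
  · exact ⟨key 0, key 1, key 2⟩
  intro E hE
  have e₁₁ := hE 0
  have e₁₂ := hE 1
  have e₂₂ := hE 2
  simp only [Matrix.cons_val] at e₁₁ e₁₂ e₂₂
  have e₂ : ∑' T : E, term (fun T => T.sigma₂ * T.sigma) (ENNReal.ofReal x) T ≤
      ENNReal.ofReal (v + u) :=
    tsum_term_add_le (w₁ := fun T => T.sigma₁ * T.sigma₂) (w₂ := fun T => T.sigma₂ * T.sigma₂)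
      (fun T => by rw [sigma_eq]; ring) hv hu e₁₂ e₂₂
  have e₁ : ∑' T : E, term (fun T => T.sigma₁ * T.sigma) (ENNReal.ofReal x) T ≤
      ENNReal.ofReal (A + v) :=
    tsum_term_add_le (w₁ := fun T => T.sigma₁ * T.sigma₁) (w₂ := fun T => T.sigma₁ * T.sigma₂)
      (fun T => by rw [sigma_eq]; ring) hA hv e₁₁ e₁₂
  have e : ∑' T : E, term (fun T => T.sigma * T.sigma) (ENNReal.ofReal x) T ≤
      ENNReal.ofReal (A + v + (v + u)) :=
    tsum_term_add_le (fun T => sigma_mul_left_eq _ T) (by positivity) (by positivity) e₁ e₂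
  have hnorm : ∀ t : ℝ, 0 ≤ t → t < 1 → ‖t‖ < 1 := fun t h0 h1 => by
    rwa [Real.norm_of_nonneg h0]
  intro i
  fin_cases i
  · refine le_trans ((isBranching_mul_unit isBranching_sigma₁ isBranching_sigma₁).tsum_node_le hx
      (fun _ _ _ => u) (fun _ _ _ => hu) (fun _ _ _ => e₂₂)
      (hasSum_sum_prod_unit (hnorm u hu (by linarith)))) (by rw [h₁₁]; rfl)
  · refine le_trans ((isBranching_mul_unit isBranching_sigma₁ isBranching_sigma₂).tsum_node_le hx
      (fun _ _ _ => v + u) (fun _ _ _ => by positivity) (fun _ _ _ => e₂)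
      (hasSum_sum_prod_unit (hnorm (v + u) (by positivity) (by linarith)))) (by rw [h₁₂]; rfl)
  · refine le_trans ((isBranching_mul_unit isBranching_sigma₂ isBranching_sigma₂).tsum_node_le hx
      (fun _ _ _ => A + v + (v + u)) (fun _ _ _ => by positivity) (fun _ _ _ => e)
      (hasSum_sum_prod_unit (hnorm _ (by positivity) hlt))) (by rw [h₂₂]; rfl)

/-- The functional equations for the series `SS`, on a disc with a solution of the equations at the
boundary. -/
theorem SS_system {x A v u : ℝ} (hx : 0 ≤ x) (hA : 0 ≤ A) (hv : 0 ≤ v) (hu : 0 ≤ u)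
    (hlt : A + v + (v + u) < 1) (h₁₁ : x * (1 / (1 - u)) = A) (h₁₂ : x * (1 / (1 - (v + u))) = v)
    (h₂₂ : x * (1 / (1 - (A + v + (v + u)))) = u) {z : ℂ} (hz : ‖z‖ ≤ x) :
    (Summable fun T => ‖term (fun T => T.sigma * T.sigma) z T‖) ∧
    ‖SS₁₂ z‖ ≤ v ∧ ‖SS₂₂ z‖ ≤ u ∧ ‖SS z‖ < 1 ∧ ‖SS₁₂ z + SS₂₂ z‖ < 1 ∧
    SS z = SS₁₁ z + 2 * SS₁₂ z + SS₂₂ z ∧ SS₁₁ z = z / (1 - SS₂₂ z) ∧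
    SS₁₂ z = z / (1 - (SS₁₂ z + SS₂₂ z)) ∧ SS₂₂ z = z / (1 - SS z) := by
  obtain ⟨b₁₁, b₁₂, b₂₂⟩ := sigma_tsum_le hx hA hv hu hlt h₁₁ h₁₂ h₂₂
  obtain ⟨s₁₁, n₁₁⟩ := summable_norm_term_of_tsum_le hx hA b₁₁ hz
  obtain ⟨s₁₂, n₁₂⟩ := summable_norm_term_of_tsum_le hx hv b₁₂ hz
  obtain ⟨s₂₂, n₂₂⟩ := summable_norm_term_of_tsum_le hx hu b₂₂ hz
  obtain ⟨s₂, t₂⟩ := summable_norm_term_add (w := fun T => T.sigma₂ * T.sigma)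
    (w₁ := fun T => T.sigma₁ * T.sigma₂) (w₂ := fun T => T.sigma₂ * T.sigma₂)
    (fun T => by rw [sigma_eq]; ring) s₁₂ s₂₂
  obtain ⟨s₁, t₁⟩ := summable_norm_term_add (w := fun T => T.sigma₁ * T.sigma)
    (w₁ := fun T => T.sigma₁ * T.sigma₁) (w₂ := fun T => T.sigma₁ * T.sigma₂)
    (fun T => by rw [sigma_eq]; ring) s₁₁ s₁₂
  obtain ⟨s, t⟩ := summable_norm_term_add (w := fun T => T.sigma * T.sigma)
    (fun T => sigma_mul_left_eq _ T) s₁ s₂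
  rw [t₁, t₂] at t
  change ‖SS₁₁ z‖ ≤ A at n₁₁
  change ‖SS₁₂ z‖ ≤ v at n₁₂
  change ‖SS₂₂ z‖ ≤ u at n₂₂
  change SS z = SS₁₁ z + SS₁₂ z + (SS₁₂ z + SS₂₂ z) at t
  have n₂ : ‖SS₁₂ z + SS₂₂ z‖ < 1 := (norm_add_le _ _).trans_lt (by linarith)
  have n : ‖SS z‖ < 1 := by
    rw [t]
    refine (norm_add_le _ _).trans_lt ?_
    have h1 := norm_add_le (SS₁₁ z) (SS₁₂ z)
    have h2 := norm_add_le (SS₁₂ z) (SS₂₂ z)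
    linarith
  refine ⟨s, n₁₂, n₂₂, n, n₂, ?_, ?_, ?_, ?_⟩
  · rw [t]
    ring
  · exact (isBranching_mul_unit isBranching_sigma₁ isBranching_sigma₁).tsum_unit s₁₁ s₂₂
      (n₂₂.trans_lt (by linarith))
  · have h := (isBranching_mul_unit isBranching_sigma₁ isBranching_sigma₂).tsum_unit s₁₂ s₂
      (by rw [t₂]; exact n₂)
    rw [t₂] at h
    exact h
  · exact (isBranching_mul_unit isBranching_sigma₂ isBranching_sigma₂).tsum_unit s₂₂ s n

/-- The series of the `σ`-index converges at `4 / 27`, the singularity of the solution of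
`S₁ = z / (1 - S₂)`, `S₂ = z / (1 - S₁ - S₂)`, where `S₁ = 2 / 9` and `S₂ = 1 / 3`. -/
theorem summable_sigma : Summable (term sigma ((4 / 27 : ℝ) : ℂ)) := by
  have key := tsum_le_of_supersolution (ι := Fin 2)
    ![term sigma₁ (ENNReal.ofReal (4 / 27)), term sigma₂ (ENNReal.ofReal (4 / 27))]
    ![ENNReal.ofReal (2 / 9), ENNReal.ofReal (1 / 3)] ?_
  · have s₁ := (summable_norm_term_of_tsum_le (z := ((4 / 27 : ℝ) : ℂ)) (by norm_num)
      (by norm_num) (key 0) (by rw [Complex.norm_real]; norm_num)).1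
    have s₂ := (summable_norm_term_of_tsum_le (z := ((4 / 27 : ℝ) : ℂ)) (by norm_num)
      (by norm_num) (key 1) (by rw [Complex.norm_real]; norm_num)).1
    exact (summable_norm_term_add sigma_eq s₁ s₂).1.of_norm
  intro E hE
  have e₁ := hE 0
  have e₂ := hE 1
  simp only [Matrix.cons_val] at e₁ e₂
  have e : ∑' T : E, term sigma (ENNReal.ofReal (4 / 27)) T ≤ ENNReal.ofReal (2 / 9 + 1 / 3) :=
    tsum_term_add_le sigma_eq (by norm_num) (by norm_num) e₁ e₂
  intro i
  fin_cases i
  · refine le_trans (isBranching_sigma₁.tsum_node_le (by norm_num) (fun _ _ _ => 1 / 3)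
      (fun _ _ _ => by norm_num) (fun _ _ _ => e₂)
      (hasSum_sum_prod_unit (by rw [Real.norm_of_nonneg] <;> norm_num))) (le_of_eq ?_)
    norm_num
  · refine le_trans (isBranching_sigma₂.tsum_node_le (by norm_num) (fun _ _ _ => 2 / 9 + 1 / 3)
      (fun _ _ _ => by norm_num) (fun _ _ _ => e)
      (hasSum_sum_prod_unit (by rw [Real.norm_of_nonneg] <;> norm_num))) (le_of_eq ?_)
    norm_num

end OrderedTree

/-! ### Interval bounds -/

section Intervals

open Set

variable {x y a b c d : ℝ}

theorem mul_mem_Icc_mul (ha : 0 ≤ a) (hc : 0 ≤ c) (hx : x ∈ Icc a b) (hy : y ∈ Icc c d) :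
    x * y ∈ Icc (a * c) (b * d) :=
  ⟨mul_le_mul hx.1 hy.1 hc (ha.trans hx.1),
    mul_le_mul hx.2 hy.2 (hc.trans hy.1) (ha.trans (hx.1.trans hx.2))⟩

theorem pow_mem_Icc_pow (ha : 0 ≤ a) (hx : x ∈ Icc a b) (n : ℕ) : x ^ n ∈ Icc (a ^ n) (b ^ n) :=
  ⟨pow_le_pow_left₀ ha hx.1 n, pow_le_pow_left₀ (ha.trans hx.1) hx.2 n⟩

theorem div_mem_Icc_div (ha : 0 ≤ a) (hc : 0 < c) (hx : x ∈ Icc a b) (hy : y ∈ Icc c d) :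
    x / y ∈ Icc (a / d) (b / c) :=
  ⟨div_le_div₀ (ha.trans hx.1) hx.1 (hc.trans_le hy.1) hy.2,
    div_le_div₀ (ha.trans (hx.1.trans hx.2)) hx.2 hc hy.1⟩

theorem sqrt_mem_Icc (hb : 0 ≤ b) (hx : x ∈ Icc (a ^ 2) (b ^ 2)) :
    Real.sqrt x ∈ Icc a b :=
  ⟨Real.le_sqrt_of_sq_le hx.1, (Real.sqrt_le_left hb).2 hx.2⟩

end Intervals

/-! ### Independent sets: the singularity -/

section SigmaCast

theorem ofReal_sigPhi (x : ℝ) : ((sigPhi x : ℝ) : ℂ) = sigPhi (x : ℂ) := by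
  simp [sigPhi, sigV, sigU]

theorem ofReal_sigL (x : ℝ) : ((sigL x : ℝ) : ℂ) = sigL (x : ℂ) := by
  simp [sigL, sigV, sigU, sigU']

theorem ofReal_sigL' (x : ℝ) : ((sigL' x : ℝ) : ℂ) = sigL' (x : ℂ) := by
  simp [sigL', sigV, sigU, sigU']

theorem ofReal_sigH (x : ℝ) : ((sigH x : ℝ) : ℂ) = sigH (x : ℂ) := by
  simp [sigH, sigU]

theorem ofReal_sigH' (x : ℝ) : ((sigH' x : ℝ) : ℂ) = sigH' (x : ℂ) := by
  simp [sigH', sigU, sigU']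

end SigmaCast

/-- The critical value of the uniformizing parameter: the solution of `sigL τ = 1 / τ`. -/
theorem exists_sigTau : ∃ τ ∈ Set.Icc (0.17779725187 : ℝ) 0.17779725188, sigL τ = 1 / τ := by
  -- `sigL x = 1 / x` with the denominators cleared.
  obtain ⟨τ, hτ, h⟩ := intermediate_value_Icc' (a := (0.17779725187 : ℝ)) (b := 0.17779725188)
    (f := fun x => (1 - 2 * x) ^ 2 * (1 - 3 * x + x ^ 2) -
      2 * x * (1 - x) * (1 - 2 * x + 2 * x ^ 2))
    (by norm_num) (by fun_prop) (show (0 : ℝ) ∈ _ by constructor <;> norm_num)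
  refine ⟨τ, hτ, ?_⟩
  have hτ1 := hτ.1
  have hτ2 := hτ.2
  have h1 : 1 - 2 * τ ≠ 0 := by
    norm_num at hτ2
    linarith
  have h2 : 1 - 3 * τ + τ ^ 2 ≠ 0 := by
    norm_num at hτ2
    nlinarith
  have h3 : 1 - τ ≠ 0 := by
    norm_num at hτ2
    linarith
  have h4 : τ ≠ 0 := by
    norm_num at hτ1
    linarith
  have h5 : 1 - τ * 2 ≠ 0 := by rwa [mul_comm]
  have h6 : 1 - τ * 3 + τ ^ 2 ≠ 0 := by rwa [mul_comm τ 3]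
  simp only [sigL, sigV, one_sub_sigU h1, sigU']
  simp only at h
  field_simp
  linear_combination -h

/-- The values of the functions at the critical parameter. -/
theorem sig_numerics {τ : ℝ} (hτ : τ ∈ Set.Icc (0.17779725187 : ℝ) 0.17779725188) :
    τ / sigPhi τ ∈ Set.Icc (0.0873832 : ℝ) 0.08738322 ∧
    sigH τ ∈ Set.Icc (0.6148026 : ℝ) 0.6148027 ∧ 0 < 1 / τ ^ 2 + sigL' τ ∧
    sigH' τ * Real.sqrt (2 / (1 / τ ^ 2 + sigL' τ)) ∈ Set.Icc (0.51901 : ℝ) 0.5190102 := by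
  have h2 : 1 - 2 * τ ∈ Set.Icc (0.64440549624 : ℝ) 0.64440549626 := by
    constructor <;> linarith [hτ.1, hτ.2]
  have h1 : 1 - τ ∈ Set.Icc (0.82220274812 : ℝ) 0.82220274813 := by
    constructor <;> linarith [hτ.1, hτ.2]
  have hw : 1 - sigU τ ∈ Set.Icc (0.7731468927 : ℝ) 0.7731468929 := by
    rw [one_sub_sigU (by linarith [h2.1])]
    have h0 : (0 : ℝ) < 1 - 2 * τ := by linarith [h2.1]
    constructor
    · rw [le_div_iff₀ h0]
      nlinarith [hτ.1, hτ.2]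
    · rw [div_le_iff₀ h0]
      nlinarith [hτ.1, hτ.2]
  have hV : sigV τ ∈ Set.Icc (1.293415273 : ℝ) 1.293415275 :=
    Set.Icc_subset_Icc (by norm_num) (by norm_num)
      (div_mem_Icc_div zero_le_one (by norm_num) ⟨le_refl (1 : ℝ), le_refl 1⟩ hw)
  have hq : 1 / (1 - 2 * τ) ∈ Set.Icc (1.551817924 : ℝ) 1.551817926 :=
    Set.Icc_subset_Icc (by norm_num) (by norm_num)
      (div_mem_Icc_div zero_le_one (by norm_num) ⟨le_refl (1 : ℝ), le_refl 1⟩ h2)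
  have hr : 1 / (1 - τ) ∈ Set.Icc (1.216245022 : ℝ) 1.216245024 :=
    Set.Icc_subset_Icc (by norm_num) (by norm_num)
      (div_mem_Icc_div zero_le_one (by norm_num) ⟨le_refl (1 : ℝ), le_refl 1⟩ h1)
  have ht : 1 / τ ∈ Set.Icc (5.62438389 : ℝ) 5.6243839 :=
    Set.Icc_subset_Icc (by norm_num) (by norm_num)
      (div_mem_Icc_div zero_le_one (by norm_num) ⟨le_refl (1 : ℝ), le_refl 1⟩ hτ)
  have hU : sigU' τ ∈ Set.Icc (1.70406943 : ℝ) 1.70406944 := by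
    have h3 := pow_mem_Icc_pow (by norm_num) hq 2
    have h4 : sigU' τ = 1 / 2 + 1 / 2 * (1 / (1 - 2 * τ)) ^ 2 := by
      simp only [sigU']
      rw [one_div_pow, one_div_mul_one_div]
    rw [h4]
    constructor <;> linarith [h3.1, h3.2]
  have hT : 1 / τ ^ 2 + sigL' τ ∈ Set.Icc (62.162725 : ℝ) 62.162727 := by
    have h3 := mul_mem_Icc_mul (by norm_num) (by norm_num)
      (pow_mem_Icc_pow (by norm_num) hq 3) hV
    have h4 := mul_mem_Icc_mul (by norm_num) (by norm_num) (pow_mem_Icc_pow (by norm_num) hU 2)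
      (pow_mem_Icc_pow (by norm_num) hV 2)
    have h5 := pow_mem_Icc_pow (by norm_num) hr 2
    have h6 := pow_mem_Icc_pow (by norm_num) ht 2
    have h7 : 1 / τ ^ 2 + sigL' τ = (1 / τ) ^ 2 + 4 * ((1 / (1 - 2 * τ)) ^ 3 * sigV τ) +
        2 * (sigU' τ ^ 2 * sigV τ ^ 2) + (1 / (1 - τ)) ^ 2 := by
      simp only [sigL', one_div_pow]
      ring
    rw [h7]
    constructor <;> linarith [h3.1, h3.2, h4.1, h4.2, h5.1, h5.2, h6.1, h6.2]
  have hs : Real.sqrt (2 / (1 / τ ^ 2 + sigL' τ)) ∈ Set.Icc (0.17937006 : ℝ) 0.17937008 :=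
    sqrt_mem_Icc (by norm_num) (Set.Icc_subset_Icc (by norm_num) (by norm_num)
      (div_mem_Icc_div zero_le_two (by norm_num) ⟨le_refl (2 : ℝ), le_refl 2⟩ hT))
  have hw2 := pow_mem_Icc_pow (by norm_num) hw 2
  refine ⟨?_, ?_, by linarith [hT.1], ?_⟩
  · have h3 : τ / sigPhi τ = τ * (1 - τ) * (1 - sigU τ) ^ 2 := by
      have h4 : 1 - sigU τ ≠ 0 := by linarith [hw.1]
      have h5 : 1 - τ ≠ 0 := by linarith [h1.1]
      simp only [sigPhi, sigV]
      field_simp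
    rw [h3]
    exact Set.Icc_subset_Icc (by norm_num) (by norm_num)
      (mul_mem_Icc_mul (by norm_num) (by norm_num)
        (mul_mem_Icc_mul (by norm_num) (by norm_num) hτ h1) hw2)
  · have h3 := mul_mem_Icc_mul (by norm_num) (by norm_num) h2 hw2
    simp only [sigH]
    norm_num at h3 ⊢
    constructor <;> linarith [h3.1, h3.2]
  · have h3 := mul_mem_Icc_mul (by norm_num) (by norm_num)
      (mul_mem_Icc_mul (by norm_num) (by norm_num) h2 hw) hU
    have h4 : sigH' τ ∈ Set.Icc (2.8935155 : ℝ) 2.8935156 := by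
      simp only [sigH']
      norm_num at h3 hw2 ⊢
      constructor <;> linarith [h3.1, h3.2, hw2.1, hw2.2]
    exact Set.Icc_subset_Icc (by norm_num) (by norm_num)
      (mul_mem_Icc_mul (by norm_num) (by norm_num) h4 hs)

/-- The values of a function on the open disc alone determine its singularity. -/
theorem HasDominantSqrtSingularity.congr {f f' : ℂ → ℂ} {z₀ a b : ℝ}
    (h : HasDominantSqrtSingularity f z₀ a b) (hff' : ∀ z : ℂ, ‖z‖ < z₀ → f z = f' z) :
    HasDominantSqrtSingularity f' z₀ a b := by
  obtain ⟨h1, h2, R, hR, F, g, k, hF, hFf, h3⟩ := h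
  exact ⟨h1, h2, R, hR, F, g, k, hF, fun z hz => (hFf z hz).trans (hff' z hz), h3⟩

section SigmaAlgebra

variable {A V U S X z : ℂ}

/-- The parametrization of the solutions of the functional equations by `X = V / (1 - U)`. -/
theorem sig_param (hU : 1 - U ≠ 0) (hVU : 1 - (V + U) ≠ 0) (hS : 1 - S ≠ 0)
    (hX1 : 1 - 2 * X ≠ 0) (hX : V / (1 - U) = X) (e : S = A + 2 * V + U)
    (e₁₁ : A = z / (1 - U)) (e₁₂ : V = z / (1 - (V + U))) (e₂₂ : U = z / (1 - S)) :
    U = sigU X ∧ S = sigH X ∧ z = (1 - U) ^ 2 * X * (1 - X) := by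
  have hV : V = (1 - U) * X := by
    rw [← hX]
    field_simp
  have hz : z = (1 - U) ^ 2 * X * (1 - X) := by
    have h1 : V * (1 - (V + U)) = z := by
      nth_rw 1 [e₁₂]
      field_simp
    rw [← h1, hV]
    ring
  have hA : A = (1 - U) * X * (1 - X) := by
    rw [e₁₁, hz]
    field_simp
  have h2 : U * (1 - S) = z := by
    nth_rw 1 [e₂₂]
    field_simp
  have h3 : (1 - U) * (1 - 3 * X + X ^ 2 - (1 - U) * (1 - 2 * X)) = 0 := by
    rw [e, hA, hV, hz] at h2
    linear_combination h2
  have h4 := (mul_eq_zero.1 h3).resolve_left hU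
  have h5 : U = sigU X := by
    rw [sigU, eq_div_iff hX1]
    linear_combination h4
  refine ⟨h5, ?_, hz⟩
  rw [sigH, ← h5, e, hA, hV]
  linear_combination (U - 1) * h4

/-- The polynomial equation between `S = SS` and `z`, by elimination of the parameter. -/
theorem sig_sextic (hX1 : 1 - 2 * X ≠ 0) (hS : S = sigH X)
    (hz : z = (1 - sigU X) ^ 2 * X * (1 - X)) :
    S ^ 6 - 6 * S ^ 5 + (4 * z + 14) * S ^ 4 + (8 * z ^ 2 - 20 * z - 16) * S ^ 3
      + (4 * z ^ 3 - 30 * z ^ 2 + 36 * z + 9) * S ^ 2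
      - (12 * z ^ 3 - 36 * z ^ 2 + 28 * z + 2) * S
      - (z ^ 4 - 8 * z ^ 3 + 14 * z ^ 2 - 8 * z) = 0 := by
  rw [sigH] at hS
  rw [one_sub_sigU hX1] at hS hz
  have hX2 : 1 - X * 2 ≠ 0 := by rwa [mul_comm]
  rw [hS, hz]
  field_simp
  ring

end SigmaAlgebra

namespace OrderedTree

/-- The analysis of the series `SS` at the critical value `τ` of the uniformizing parameter. -/
theorem SS_analysis {τ z₀ : ℝ} (hτ0 : 0 < τ) (hτ : τ < 1 / 5) (hL : sigL τ = 1 / τ)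
    (hz : z₀ = τ / sigPhi τ) (hl : 0 < 1 / τ ^ 2 + sigL' τ) :
    0 < z₀ ∧ (∀ z : ℂ, ‖z‖ ≤ z₀ → (Summable (term (fun T => T.sigma * T.sigma) z)) ∧
      1 - SS₂₂ z ≠ 0 ∧ 1 - (SS₁₂ z + SS₂₂ z) ≠ 0 ∧ 1 - SS z ≠ 0 ∧
      SS z = SS₁₁ z + 2 * SS₁₂ z + SS₂₂ z ∧ SS₁₁ z = z / (1 - SS₂₂ z) ∧
      SS₁₂ z = z / (1 - (SS₁₂ z + SS₂₂ z)) ∧ SS₂₂ z = z / (1 - SS z) ∧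
      ∃ X, 1 - 2 * X ≠ 0 ∧ SS z = sigH X ∧ z = (1 - sigU X) ^ 2 * X * (1 - X)) ∧
    HasDominantSqrtSingularity SS z₀ (sigH τ)
      (sigH' τ * Real.sqrt (2 / (1 / τ ^ 2 + sigL' τ))) := by
  have h2 : 0 < 1 - 2 * τ := by linarith
  have h1 : 0 < 1 - τ := by linarith
  have hu := sigU_real_lt_one hτ0 hτ
  have hu0 : 0 < sigU τ := by
    unfold sigU
    positivity
  have hc : (1 - sigU τ) * (1 - 2 * τ) = 1 - 3 * τ + τ ^ 2 := by
    rw [one_sub_sigU h2.ne', div_mul_cancel₀ _ h2.ne']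
  have hpoly : 0 < 1 - 3 * τ + τ ^ 2 := by nlinarith
  set c := 1 - sigU τ with hcdef
  have hc0 : 0 < c := by linarith
  have huc : sigU τ = 1 - c := by rw [hcdef]; ring
  have hPhi : sigPhi τ = 1 / (c ^ 2 * (1 - τ)) := by
    simp only [sigPhi, sigV, ← hcdef]
    field_simp
  have hPhi0 : 0 < sigPhi τ := by
    rw [hPhi]
    positivity
  have hzc : z₀ = c ^ 2 * τ * (1 - τ) := by
    rw [hz, hPhi]
    field_simp
  have hz0 : 0 < z₀ := by
    rw [hzc]
    positivity
  have hlt : c * τ * (1 - τ) + c * τ + (c * τ + sigU τ) < 1 := by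
    rw [huc]
    nlinarith [mul_pos hc0 hpoly]
  -- The values of `SS₁₁`, `SS₁₂`, `SS₂₂` at `z₀` expected from the parametrization.
  have sys := fun (z : ℂ) (hz : ‖z‖ ≤ z₀) => SS_system (x := z₀) (A := c * τ * (1 - τ))
    (v := c * τ) (u := sigU τ) hz0.le (by positivity) (by positivity) hu0.le hlt
    (by
      rw [← hcdef, hzc]
      field_simp)
    (by
      rw [huc, hzc, show 1 - (c * τ + (1 - c)) = c * (1 - τ) by ring]
      field_simp)
    (by
      have h3 : 1 - (c * τ * (1 - τ) + c * τ + (c * τ + sigU τ)) = c * (1 - 3 * τ + τ ^ 2) := by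
        rw [huc]
        ring
      rw [h3, hzc, huc, mul_one_div, div_eq_iff (by positivity)]
      linear_combination c * hc) hz
  have par : ∀ z : ℂ, ‖z‖ ≤ z₀ → ‖SS₁₂ z / (1 - SS₂₂ z)‖ ≤ τ ∧
      1 - 2 * (SS₁₂ z / (1 - SS₂₂ z)) ≠ 0 ∧
      SS z = sigH (SS₁₂ z / (1 - SS₂₂ z)) ∧
      z = (1 - sigU (SS₁₂ z / (1 - SS₂₂ z))) ^ 2 * (SS₁₂ z / (1 - SS₂₂ z)) *
        (1 - SS₁₂ z / (1 - SS₂₂ z)) ∧ 1 - SS₂₂ z ≠ 0 := by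
    intro z hz
    obtain ⟨-, n₁₂, n₂₂, n, n₂, e, e₁₁, e₁₂, e₂₂⟩ := sys z hz
    have hU : 1 - SS₂₂ z ≠ 0 := one_sub_ne_zero_of_norm_lt (n₂₂.trans_lt hu)
    have hX : ‖SS₁₂ z / (1 - SS₂₂ z)‖ ≤ τ := by
      have h3 := norm_sub_norm_le (1 : ℂ) (SS₂₂ z)
      rw [norm_one] at h3
      rw [norm_div, div_le_iff₀ (norm_pos_iff.2 hU)]
      calc ‖SS₁₂ z‖ ≤ c * τ := n₁₂
        _ = τ * c := mul_comm _ _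
        _ ≤ τ * ‖1 - SS₂₂ z‖ := by
          gcongr
          linarith
    have hdom := closedBall_subset_sigDomain hτ (mem_closedBall_zero_iff.2 hX)
    obtain ⟨p1, p2, p3⟩ := sig_param hU (one_sub_ne_zero_of_norm_lt n₂)
      (one_sub_ne_zero_of_norm_lt n) hdom.2.1 rfl e e₁₁ e₁₂ e₂₂
    exact ⟨hX, hdom.2.1, p2, by rw [← p1]; exact p3, hU⟩
  refine ⟨hz0, fun z hz => ?_, ?_⟩
  · obtain ⟨s, n₁₂, n₂₂, n, n₂, e, e₁₁, e₁₂, e₂₂⟩ := sys z hz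
    obtain ⟨-, p1, p2, p3, p4⟩ := par z hz
    exact ⟨s.of_norm, p4, one_sub_ne_zero_of_norm_lt n₂, one_sub_ne_zero_of_norm_lt n, e, e₁₁, e₁₂,
      e₂₂, _, p1, p2, p3⟩
  · have hsing : HasDominantSqrtSingularity (fun z => sigH (SS₁₂ z / (1 - SS₂₂ z))) z₀ (sigH τ)
        (sigH' τ * Real.sqrt (2 / (1 / τ ^ 2 + sigL' τ))) := by
      refine hasDominantSqrtSingularity_of_logDeriv (U := sigDomain) (φ := sigPhi) (L := sigL)
        isOpen_sigDomain (closedBall_subset_sigDomain hτ) (fun x hx => hasDerivAt_sigPhi hx)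
        (fun x hx => hasDerivAt_sigL hx) (fun x hx => hasDerivAt_sigH hx) hτ0 hz0 ?_ ?_ ?_
        (ofReal_sigL' τ).symm hl (ofReal_sigH τ).symm (ofReal_sigH' τ).symm ?_ ?_ ?_ ?_
      · simp [sigPhi, sigV, sigU]
      · rw [← ofReal_sigPhi, hz]
        norm_cast
        field_simp
      · rw [← ofReal_sigL, hL]
        push_cast
        rfl
      · simp only [sigH', sigU', ← hcdef]
        positivity
      · intro x hx y hy hxy
        have h3 := mul_lt_mul_of_pos_left (norm_sigPhi_sub_lt hτ0 hτ hx hy hxy) hz0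
        rwa [hL, hz, show τ / sigPhi τ * (sigPhi τ * (1 / τ) * ‖x - y‖) = ‖x - y‖ by field_simp,
          ← hz] at h3
      · intro x hx hne
        have h3 := mul_lt_mul_of_pos_left (norm_sigPhi_mul_sigL_lt hτ0 hτ hx hne) hz0
        rwa [hL, hz, show τ / sigPhi τ * (sigPhi τ * (1 / τ)) = 1 by field_simp, ← hz] at h3
      · intro z hz
        obtain ⟨p1, -, -, p3, -⟩ := par z hz
        have hdom := closedBall_subset_sigDomain hτ (mem_closedBall_zero_iff.2 p1)
        refine ⟨p1, ?_⟩
        have h3 := one_sub_sigU_ne_zero hdom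
        have h4 := hdom.1
        generalize SS₁₂ z / (1 - SS₂₂ z) = X at *
        rw [p3]
        simp only [sigPhi, sigV]
        field_simp
    exact hsing.congr fun z hz => ((par z hz.le).2.2.1).symm

end OrderedTree

/-! ### Matchings: the analytic functions -/

section MatchingFunctions

variable {K : Type*} [Field K]

/-- The function `1 / (1 - ZZ)` of the uniformizing parameter `x = z / (1 - ZZ) ^ 2`; the equation
for the parameter is `x = z zP(x) ^ 2`. -/
def zP (x : K) : K := 1 + x + x ^ 2 + 2 * (x / (1 - x)) ^ 2

/-- The derivative of `zP`. -/
def zP' (x : K) : K := 1 + 2 * x + 4 * x * (1 / (1 - x)) ^ 3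

/-- The derivative of `zP'`. -/
def zP'' (x : K) : K := 2 + 4 * (1 / (1 - x)) ^ 3 + 12 * x * (1 / (1 - x)) ^ 4

/-- The logarithmic derivative of the square of `zP`. -/
def zL (x : K) : K := 2 * zP' x / zP x

/-- The derivative of `zL`. -/
def zL' (x : K) : K := 2 * zP'' x / zP x - 2 * zP' x ^ 2 / zP x ^ 2

/-- The series `ZZ` in terms of the uniformizing parameter. -/
def zH (x : K) : K := 1 - 1 / zP x

/-- The derivative of `zH`. -/
def zH' (x : K) : K := zP' x / zP x ^ 2

end MatchingFunctions

theorem ofReal_zP (x : ℝ) : ((zP x : ℝ) : ℂ) = zP (x : ℂ) := by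
  simp [zP]

theorem ofReal_zL (x : ℝ) : ((zL x : ℝ) : ℂ) = zL (x : ℂ) := by
  simp [zL, zP, zP']

theorem ofReal_zL' (x : ℝ) : ((zL' x : ℝ) : ℂ) = zL' (x : ℂ) := by
  simp [zL', zP, zP', zP'']

theorem ofReal_zH (x : ℝ) : ((zH x : ℝ) : ℂ) = zH (x : ℂ) := by
  simp [zH, zP]

theorem ofReal_zH' (x : ℝ) : ((zH' x : ℝ) : ℂ) = zH' (x : ℂ) := by
  simp [zH', zP, zP']

/-- The set on which the functions of the uniformizing parameter are analytic. -/
def zDomain : Set ℂ := {x | 1 - x ≠ 0 ∧ zP x ≠ 0}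

theorem hasDerivAt_zP {x : ℂ} (hx : 1 - x ≠ 0) : HasDerivAt zP (zP' x) x := by
  have h := (((hasDerivAt_id' x).const_add 1).add ((hasDerivAt_id' x).fun_pow 2)).add
    ((((hasDerivAt_id' x).div ((hasDerivAt_id' x).const_sub 1) hx).fun_pow 2).const_mul 2)
  refine h.congr_deriv ?_
  simp only [zP', Pi.div_apply, Nat.cast_ofNat, Nat.reduceSub, pow_one]
  field_simp
  ring

theorem hasDerivAt_zP' {x : ℂ} (hx : 1 - x ≠ 0) : HasDerivAt zP' (zP'' x) x := by
  have h := (((hasDerivAt_id' x).const_mul 2).const_add 1).add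
    (((hasDerivAt_id' x).const_mul 4).mul
      (((hasDerivAt_const x (1 : ℂ)).div ((hasDerivAt_id' x).const_sub 1) hx).fun_pow 3))
  refine h.congr_deriv ?_
  simp only [zP'', Pi.div_apply, Nat.cast_ofNat, Nat.reduceSub]
  field_simp
  ring

theorem isOpen_zDomain : IsOpen zDomain := by
  have h1 : IsOpen {x : ℂ | 1 - x ≠ 0} := isOpen_ne_fun (by fun_prop) continuous_const
  have h2 : ContinuousOn zP {x : ℂ | 1 - x ≠ 0} := fun x hx =>
    (hasDerivAt_zP hx).continuousAt.continuousWithinAt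
  exact h2.isOpen_inter_preimage h1 isOpen_ne

theorem hasDerivAt_zP_sq {x : ℂ} (hx : x ∈ zDomain) :
    HasDerivAt (fun x => zP x ^ 2) (zP x ^ 2 * zL x) x := by
  have h2 := hx.2
  refine ((hasDerivAt_zP hx.1).fun_pow 2).congr_deriv ?_
  simp only [zL, Nat.cast_ofNat, Nat.reduceSub, pow_one]
  field_simp

theorem hasDerivAt_zL {x : ℂ} (hx : x ∈ zDomain) : HasDerivAt zL (zL' x) x := by
  have h2 := hx.2
  refine (((hasDerivAt_zP' hx.1).const_mul 2).div (hasDerivAt_zP hx.1) h2).congr_deriv ?_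
  simp only [zL']
  field_simp

theorem hasDerivAt_zH {x : ℂ} (hx : x ∈ zDomain) : HasDerivAt zH (zH' x) x := by
  have h2 := hx.2
  refine (((hasDerivAt_const x (1 : ℂ)).div (hasDerivAt_zP hx.1) h2).const_sub 1).congr_deriv ?_
  simp only [zH']
  field_simp
  ring

section MatchingBounds

open Metric

variable {τ : ℝ} {x y : ℂ}

theorem norm_div_one_sub_le (hτ : τ < 1) (hx : x ∈ closedBall (0 : ℂ) τ) :
    ‖x / (1 - x)‖ ≤ τ / (1 - τ) := by
  have h0 : ‖x‖ ≤ τ := mem_closedBall_zero_iff.1 hx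
  have h1 := norm_one_div_one_sub_le hτ hx
  rw [div_eq_mul_one_div, div_eq_mul_one_div τ, norm_mul]
  exact mul_le_mul h0 h1 (norm_nonneg _) ((norm_nonneg x).trans h0)

theorem norm_zP_le (hτ : τ < 1) (hx : x ∈ closedBall (0 : ℂ) τ) : ‖zP x‖ ≤ zP τ := by
  have h0 : ‖x‖ ≤ τ := mem_closedBall_zero_iff.1 hx
  have h1 := norm_div_one_sub_le hτ hx
  unfold zP
  refine (norm_add_le _ _).trans (add_le_add ((norm_add_le _ _).trans (add_le_add
    ((norm_add_le _ _).trans (add_le_add (by simp) h0)) ?_)) ?_)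
  · rw [norm_pow]
    gcongr
  · rw [norm_mul, norm_pow, Complex.norm_ofNat]
    gcongr

theorem closedBall_subset_zDomain (hτ : τ < 1 / 4) : closedBall (0 : ℂ) τ ⊆ zDomain := by
  intro x hx
  have h0 : ‖x‖ ≤ τ := mem_closedBall_zero_iff.1 hx
  have h1 := norm_div_one_sub_le (by linarith) hx
  have h2 := sub_mul_le_norm_one_sub zero_le_one hx
  push_cast at h2
  rw [one_mul, one_mul] at h2
  refine ⟨norm_pos_iff.1 (by linarith), fun h => ?_⟩
  have h4 : (-1 : ℂ) = x + x ^ 2 + 2 * (x / (1 - x)) ^ 2 := by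
    unfold zP at h
    linear_combination -h
  have hτ0 : 0 ≤ τ := (norm_nonneg x).trans h0
  have h5 : τ / (1 - τ) ≤ 1 / 3 := by
    rw [div_le_iff₀ (by linarith)]
    linarith
  have h6 : (1 : ℝ) ≤ τ + τ ^ 2 + 2 * (1 / 3) ^ 2 := by
    calc (1 : ℝ) = ‖(-1 : ℂ)‖ := by simp
      _ = ‖x + x ^ 2 + 2 * (x / (1 - x)) ^ 2‖ := by rw [h4]
      _ ≤ ‖x‖ + ‖x ^ 2‖ + ‖2 * (x / (1 - x)) ^ 2‖ :=
        (norm_add_le _ _).trans (add_le_add_left (norm_add_le _ _) _)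
      _ = ‖x‖ + ‖x‖ ^ 2 + 2 * ‖x / (1 - x)‖ ^ 2 := by
        rw [norm_mul, norm_pow, norm_pow, Complex.norm_ofNat]
      _ ≤ _ := by
        have := h1.trans h5
        gcongr
  nlinarith

theorem norm_zP_sub_lt (hτ0 : 0 < τ) (hτ : τ < 1) (hx : x ∈ closedBall (0 : ℂ) τ)
    (hy : y ∈ closedBall (0 : ℂ) τ) (hxy : x ≠ y) : ‖zP x - zP y‖ < zP' τ * ‖x - y‖ := by
  have hx0 : ‖x‖ ≤ τ := mem_closedBall_zero_iff.1 hx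
  have hy0 : ‖y‖ ≤ τ := mem_closedBall_zero_iff.1 hy
  have hd : 0 < ‖x - y‖ := norm_pos_iff.2 (sub_ne_zero.2 hxy)
  have hne : ∀ t ∈ closedBall (0 : ℂ) τ, 1 - t ≠ 0 := fun t ht => by
    have h2 := sub_mul_le_norm_one_sub zero_le_one ht
    push_cast at h2
    rw [one_mul, one_mul] at h2
    exact norm_pos_iff.1 (by linarith)
  have h1 : zP x - zP y = (x - y) * (1 + (x + y)) +
      (x - y) * ((1 / (1 - x)) * (1 / (1 - y))) * (2 * (x / (1 - x) + y / (1 - y))) := by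
    have h2 := hne x hx
    have h3 := hne y hy
    simp only [zP]
    field_simp
    ring
  have h2 : zP' τ * ‖x - y‖ = ‖x - y‖ * (1 + (τ + τ)) +
      ‖x - y‖ * ((1 / (1 - τ)) * (1 / (1 - τ))) * (2 * (τ / (1 - τ) + τ / (1 - τ))) := by
    simp only [zP']
    ring
  rw [h1, h2]
  refine (norm_add_le _ _).trans_lt (add_lt_add_of_le_of_lt ?_ ?_)
  · rw [norm_mul]
    refine mul_le_mul_of_nonneg_left ((norm_add_le _ _).trans ?_) hd.le
    rw [norm_one]
    gcongr
    exact (norm_add_le _ _).trans (add_le_add hx0 hy0)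
  · rw [norm_mul, norm_mul, norm_mul, norm_mul 2, Complex.norm_ofNat]
    have h3 := norm_mul_one_div_one_sub_lt hτ hx hy hxy
    have h4 := (norm_add_le (x / (1 - x)) (y / (1 - y))).trans
      (add_le_add (norm_div_one_sub_le hτ hx) (norm_div_one_sub_le hτ hy))
    have h5 : 0 < τ / (1 - τ) := div_pos hτ0 (by linarith)
    calc ‖x - y‖ * (‖1 / (1 - x)‖ * ‖1 / (1 - y)‖) * (2 * ‖x / (1 - x) + y / (1 - y)‖)
        ≤ ‖x - y‖ * (‖1 / (1 - x)‖ * ‖1 / (1 - y)‖) * (2 * (τ / (1 - τ) + τ / (1 - τ))) := by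
          gcongr
      _ < _ := by gcongr

theorem norm_zP'_lt (hτ0 : 0 < τ) (hτ : τ < 1) (hx : x ∈ closedBall (0 : ℂ) τ) (hne : x ≠ τ) :
    ‖zP' x‖ < zP' τ := by
  have h0 : ‖x‖ ≤ τ := mem_closedBall_zero_iff.1 hx
  have h1 := norm_one_div_one_sub_lt hτ hx hne
  unfold zP'
  refine (norm_add_le _ _).trans_lt (add_lt_add_of_le_of_lt ((norm_add_le _ _).trans ?_) ?_)
  · rw [norm_one, norm_mul, Complex.norm_ofNat]
    gcongr
  · rw [norm_mul, norm_mul, norm_pow, Complex.norm_ofNat]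
    calc 4 * ‖x‖ * ‖1 / (1 - x)‖ ^ 3 ≤ 4 * τ * ‖1 / (1 - x)‖ ^ 3 := by gcongr
      _ < _ := by gcongr

theorem zP_pos (hτ0 : 0 < τ) : 0 < zP τ := by
  unfold zP
  positivity

/-- On the disc, the square of `zP` is a strict contraction relative to its derivative at `τ`. -/
theorem norm_zP_sq_sub_lt (hτ0 : 0 < τ) (hτ : τ < 1) (hx : x ∈ closedBall (0 : ℂ) τ)
    (hy : y ∈ closedBall (0 : ℂ) τ) (hxy : x ≠ y) :
    ‖zP x ^ 2 - zP y ^ 2‖ < zP τ ^ 2 * zL τ * ‖x - y‖ := by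
  have h1 := norm_zP_sub_lt hτ0 hτ hx hy hxy
  have h2 := (norm_add_le (zP x) (zP y)).trans (add_le_add (norm_zP_le hτ hx) (norm_zP_le hτ hy))
  have hP := zP_pos hτ0
  have h3 : zP τ ^ 2 * zL τ * ‖x - y‖ = (zP τ + zP τ) * (zP' τ * ‖x - y‖) := by
    simp only [zL]
    field_simp
    ring
  rw [h3, sq_sub_sq, norm_mul]
  exact (mul_le_mul_of_nonneg_right h2 (norm_nonneg _)).trans_lt (by gcongr)

theorem norm_zP_sq_mul_zL_lt (hτ0 : 0 < τ) (hτ : τ < 1 / 4) (hx : x ∈ closedBall (0 : ℂ) τ)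
    (hne : x ≠ τ) : ‖zP x ^ 2 * zL x‖ < zP τ ^ 2 * zL τ := by
  have h1 := norm_zP'_lt hτ0 (by linarith) hx hne
  have h2 := norm_zP_le (by linarith) hx
  have hP := zP_pos hτ0
  have hPx := (closedBall_subset_zDomain hτ hx).2
  have h3 : zP τ ^ 2 * zL τ = 2 * zP τ * zP' τ := by
    simp only [zL]
    field_simp
  have h4 : zP x ^ 2 * zL x = 2 * zP x * zP' x := by
    simp only [zL]
    field_simp
  rw [h3, h4, norm_mul, norm_mul, Complex.norm_ofNat]
  calc 2 * ‖zP x‖ * ‖zP' x‖ ≤ 2 * zP τ * ‖zP' x‖ := by gcongr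
    _ < _ := by gcongr

end MatchingBounds

/-- The critical value of the uniformizing parameter: the solution of `zL τ = 1 / τ`. -/
theorem exists_zTau : ∃ τ ∈ Set.Icc (0.21798407272 : ℝ) 0.21798407273, zL τ = 1 / τ := by
  -- `zL x = 1 / x` with the denominators cleared.
  obtain ⟨τ, hτ, h⟩ := intermediate_value_Icc' (a := (0.21798407272 : ℝ)) (b := 0.21798407273)
    (f := fun x => (1 + x + x ^ 2) * (1 - x) ^ 3 + 2 * x ^ 2 * (1 - x) -
      2 * x * ((1 + 2 * x) * (1 - x) ^ 3 + 4 * x))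
    (by norm_num) (by fun_prop) (show (0 : ℝ) ∈ _ by constructor <;> norm_num)
  refine ⟨τ, hτ, ?_⟩
  have h3 : 1 - τ ≠ 0 := by
    have := hτ.2
    norm_num at this
    linarith
  have h4 : 0 < τ := lt_of_lt_of_le (by norm_num) hτ.1
  have h5 := zP_pos h4
  simp only at h
  rw [zL, div_eq_div_iff h5.ne' h4.ne']
  simp only [zP, zP']
  field_simp
  linear_combination -h

/-- The values of the functions at the critical parameter. -/
theorem z_numerics {τ : ℝ} (hτ : τ ∈ Set.Icc (0.21798407272 : ℝ) 0.21798407273) :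
    τ / zP τ ^ 2 ∈ Set.Icc (0.10796864 : ℝ) 0.10796865 ∧
    zH τ ∈ Set.Icc (0.2962207 : ℝ) 0.2962209 ∧ 0 < 1 / τ ^ 2 + zL' τ ∧
    zH' τ * Real.sqrt (2 / (1 / τ ^ 2 + zL' τ)) ∈ Set.Icc (0.3861357 : ℝ) 0.3861359 := by
  have hc : ∀ c : ℝ, c ∈ Set.Icc c c := fun c => ⟨le_refl c, le_refl c⟩
  have h1 : 1 - τ ∈ Set.Icc (0.78201592727 : ℝ) 0.78201592728 := by
    constructor <;> linarith [hτ.1, hτ.2]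
  have hr : 1 / (1 - τ) ∈ Set.Icc (1.278746333 : ℝ) 1.278746335 :=
    Set.Icc_subset_Icc (by norm_num) (by norm_num)
      (div_mem_Icc_div zero_le_one (by norm_num) (hc 1) h1)
  have ht : 1 / τ ∈ Set.Icc (4.587491129 : ℝ) 4.58749113 :=
    Set.Icc_subset_Icc (by norm_num) (by norm_num)
      (div_mem_Icc_div zero_le_one (by norm_num) (hc 1) hτ)
  have ht2 := pow_mem_Icc_pow (by norm_num) ht 2
  have hτ2 := pow_mem_Icc_pow (by norm_num) hτ 2
  have hr2 := pow_mem_Icc_pow (by norm_num) hr 2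
  have hr3 := pow_mem_Icc_pow (by norm_num) hr 3
  have hr4 := pow_mem_Icc_pow (by norm_num) hr 4
  have hP : zP τ ∈ Set.Icc (1.420900164 : ℝ) 1.420900168 := by
    have h3 := mul_mem_Icc_mul (by norm_num) (by norm_num) hτ2 hr2
    have h4 : zP τ = 1 + τ + τ ^ 2 + 2 * (τ ^ 2 * (1 / (1 - τ)) ^ 2) := by
      simp only [zP]
      ring
    rw [h4]
    constructor <;> linarith [h3.1, h3.2, hτ.1, hτ.2, hτ2.1, hτ2.2]
  have hP1 : zP' τ ∈ Set.Icc (3.259183444 : ℝ) 3.259183464 := by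
    have h3 := mul_mem_Icc_mul (by norm_num) (by norm_num) hτ hr3
    simp only [zP']
    constructor <;> linarith [h3.1, h3.2, hτ.1, hτ.2]
  have hP2 : zP'' τ ∈ Set.Icc (17.3582736 : ℝ) 17.3582738 := by
    have h3 := mul_mem_Icc_mul (by norm_num) (by norm_num) hτ hr4
    simp only [zP'']
    constructor <;> linarith [h3.1, h3.2, hr3.1, hr3.2]
  have hT : 1 / τ ^ 2 + zL' τ ∈ Set.Icc (34.95532 : ℝ) 34.955324 := by
    have h3 := div_mem_Icc_div (by norm_num) (by norm_num) hP2 hP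
    have h4 := pow_mem_Icc_pow (by norm_num)
      (div_mem_Icc_div (by norm_num) (by norm_num) hP1 hP) 2
    have h7 : 1 / τ ^ 2 + zL' τ =
        (1 / τ) ^ 2 + 2 * (zP'' τ / zP τ) - 2 * (zP' τ / zP τ) ^ 2 := by
      simp only [zL']
      ring
    rw [h7]
    constructor <;> linarith [h3.1, h3.2, h4.1, h4.2, ht2.1, ht2.2]
  have hs : Real.sqrt (2 / (1 / τ ^ 2 + zL' τ)) ∈ Set.Icc (0.23919842 : ℝ) 0.23919846 :=
    sqrt_mem_Icc (by norm_num) (Set.Icc_subset_Icc (by norm_num) (by norm_num)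
      (div_mem_Icc_div zero_le_two (by norm_num) (hc 2) hT))
  have hPsq := pow_mem_Icc_pow (by norm_num) hP 2
  refine ⟨?_, ?_, by linarith [hT.1], ?_⟩
  · exact Set.Icc_subset_Icc (by norm_num) (by norm_num)
      (div_mem_Icc_div (by norm_num) (by norm_num) hτ hPsq)
  · have h3 := div_mem_Icc_div zero_le_one (by norm_num) (hc 1) hP
    simp only [zH]
    constructor <;> linarith [h3.1, h3.2]
  · exact Set.Icc_subset_Icc (by norm_num) (by norm_num)
      (mul_mem_Icc_mul (by norm_num) (by norm_num)
        (div_mem_Icc_div (by norm_num) (by norm_num) hP1 hPsq) hs)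

section MatchingAlgebra

variable {A V U S z X : ℂ}

/-- The parametrization of the solutions of the functional equations by `X = z / (1 - S) ^ 2`. -/
theorem z_param (hS : 1 - S ≠ 0) (hX1 : 1 - X ≠ 0) (hX : z / (1 - S) ^ 2 = X)
    (e : S = A + 2 * V + U) (e₁₁ : A = z * U / (1 - S) ^ 2 + 2 * z * (V + U) ^ 2 / (1 - S) ^ 3)
    (e₁₂ : V = z * (V + U) / (1 - S) ^ 2) (e₂₂ : U = z / (1 - S)) :
    (1 - S) * zP X = 1 := by
  have hz : z = X * (1 - S) ^ 2 := by
    rw [← hX]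
    field_simp
  have hU : U = X * (1 - S) := by
    rw [e₂₂, hz]
    field_simp
  have hV : V + U = X * (1 - S) / (1 - X) := by
    have h1 : V = X * (V + U) := by
      nth_rw 1 [e₁₂]
      rw [hz]
      field_simp
    rw [eq_div_iff hX1]
    linear_combination h1 + hU
  have hA : A = X ^ 2 * (1 - S) + 2 * X ^ 3 / (1 - X) ^ 2 * (1 - S) := by
    rw [e₁₁, hV, hU, hz]
    field_simp
  have h2 : S = A + 2 * (V + U) - U := by linear_combination e
  rw [hA, hV, hU] at h2
  unfold zP
  field_simp at h2 ⊢
  linear_combination -h2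

/-- The polynomial equation between `S = ZZ` and `z`, by elimination of the parameter. -/
theorem z_octic (hX1 : 1 - X ≠ 0) (hP : zP X ≠ 0) (hS : S = zH X) (hz : z = X * (1 - S) ^ 2) :
    S ^ 8 - 7 * S ^ 7 - (z - 21) * S ^ 6 + (4 * z - 35) * S ^ 5
      + (2 * z ^ 2 - 5 * z + 35) * S ^ 4 - (7 * z ^ 2 + 21) * S ^ 3
      - (z ^ 3 - 9 * z ^ 2 - 5 * z - 7) * S ^ 2
      + (2 * z ^ 3 - 5 * z ^ 2 - 4 * z - 1) * S + (z ^ 4 - z ^ 3 + z ^ 2 + z) = 0 := by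
  obtain ⟨N, hN⟩ : ∃ N, N = (1 + X + X ^ 2) * (1 - X) ^ 2 + 2 * X ^ 2 := ⟨_, rfl⟩
  have h1 : zP X = N / (1 - X) ^ 2 := by
    rw [hN]
    unfold zP
    field_simp
  have h2 : N ≠ 0 := by
    rintro rfl
    rw [h1, zero_div] at hP
    exact hP rfl
  have h3 : S = 1 - (1 - X) ^ 2 / N := by
    rw [hS, zH, h1, one_div_div]
  have h4 : z = X * ((1 - X) ^ 2 / N) ^ 2 := by
    rw [hz, h3, sub_sub_cancel]
  rw [h4, h3]
  field_simp
  rw [hN]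
  ring

end MatchingAlgebra

/-! ### Matchings: the generating functions -/

namespace OrderedTree

theorem zIndex_mul_left_eq (v : OrderedTree → ℕ) (T : OrderedTree) :
    T.zIndex * v T = T.zIndex₁ * v T + T.zIndex₂ * v T := by
  rw [zIndex_eq]
  ring

theorem isBranching_zIndex₁_mul_zIndex₂ :
    IsBranching (κ := Fin) (fun T => T.zIndex₁ * T.zIndex₂) fun _ i l =>
      if l = i then fun T => T.zIndex₂ * T.zIndex else fun T => T.zIndex * T.zIndex := by
  intro k g
  simp only [zIndex₁_node, zIndex₂_node, Finset.sum_mul, ← Finset.prod_mul_distrib]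
  refine Finset.sum_congr rfl fun i _ => Finset.prod_congr rfl fun l _ => ?_
  split_ifs <;> rfl

/-- In a pair of matchings that both cover the root, the two edges at the root lead to the
branches `e.1` and `e.2`. -/
theorem isBranching_zIndex₁_mul_zIndex₁ :
    IsBranching (κ := fun k => Fin k × Fin k) (fun T => T.zIndex₁ * T.zIndex₁) fun _ =>
      pairLabel (fun T => T.zIndex₂ * T.zIndex₂) (fun T => T.zIndex₂ * T.zIndex)
        (fun T => T.zIndex * T.zIndex) := by
  intro k g
  simp only [zIndex₁_node, Finset.sum_mul_sum, ← Finset.prod_mul_distrib, Fintype.sum_prod_type]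
  refine Finset.sum_congr rfl fun i _ => Finset.sum_congr rfl fun j _ =>
    Finset.prod_congr rfl fun l _ => ?_
  unfold pairLabel
  split_ifs <;> first | rfl | exact mul_comm _ _

/-- A solution of the equations for `ZZ₁₁`, `ZZ₁₂`, `ZZ₂₂` at `x > 0` bounds these series. -/
theorem zIndex_tsum_le {x A v u : ℝ} (hx : 0 ≤ x) (hA : 0 ≤ A) (hv : 0 ≤ v) (hu : 0 ≤ u)
    (hlt : A + v + (v + u) < 1)
    (h₁₁ : x * (u / (1 - (A + v + (v + u))) ^ 2 +
      2 * (v + u) ^ 2 / (1 - (A + v + (v + u))) ^ 3) = A)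
    (h₁₂ : x * ((v + u) / (1 - (A + v + (v + u))) ^ 2) = v)
    (h₂₂ : x * (1 / (1 - (A + v + (v + u)))) = u) :
    ∑' T, term (fun T => T.zIndex₁ * T.zIndex₁) (ENNReal.ofReal x) T ≤ ENNReal.ofReal A ∧
    ∑' T, term (fun T => T.zIndex₁ * T.zIndex₂) (ENNReal.ofReal x) T ≤ ENNReal.ofReal v ∧
    ∑' T, term (fun T => T.zIndex₂ * T.zIndex₂) (ENNReal.ofReal x) T ≤ ENNReal.ofReal u := by
  have key := tsum_le_of_supersolution (ι := Fin 3)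
    ![term (fun T => T.zIndex₁ * T.zIndex₁) (ENNReal.ofReal x),
      term (fun T => T.zIndex₁ * T.zIndex₂) (ENNReal.ofReal x),
      term (fun T => T.zIndex₂ * T.zIndex₂) (ENNReal.ofReal x)]
    ![ENNReal.ofReal A, ENNReal.ofReal v, ENNReal.ofReal u] ?_
  · exact ⟨key 0, key 1, key 2⟩
  intro E hE
  have e₁₁ := hE 0
  have e₁₂ := hE 1
  have e₂₂ := hE 2
  simp only [Matrix.cons_val] at e₁₁ e₁₂ e₂₂
  have e₂ : ∑' T : E, term (fun T => T.zIndex₂ * T.zIndex) (ENNReal.ofReal x) T ≤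
      ENNReal.ofReal (v + u) :=
    tsum_term_add_le (w₁ := fun T => T.zIndex₁ * T.zIndex₂)
      (w₂ := fun T => T.zIndex₂ * T.zIndex₂)
      (fun T => by rw [zIndex_eq]; ring) hv hu e₁₂ e₂₂
  have e₁ : ∑' T : E, term (fun T => T.zIndex₁ * T.zIndex) (ENNReal.ofReal x) T ≤
      ENNReal.ofReal (A + v) :=
    tsum_term_add_le (w₁ := fun T => T.zIndex₁ * T.zIndex₁)
      (w₂ := fun T => T.zIndex₁ * T.zIndex₂)
      (fun T => by rw [zIndex_eq]; ring) hA hv e₁₁ e₁₂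
  have e : ∑' T : E, term (fun T => T.zIndex * T.zIndex) (ENNReal.ofReal x) T ≤
      ENNReal.ofReal (A + v + (v + u)) :=
    tsum_term_add_le (fun T => zIndex_mul_left_eq _ T) (by positivity) (by positivity) e₁ e₂
  have hnorm : ‖A + v + (v + u)‖ < 1 := by rwa [Real.norm_of_nonneg (by positivity)]
  intro i
  fin_cases i
  · refine le_trans (isBranching_zIndex₁_mul_zIndex₁.tsum_node_le hx
      (fun _ => pairLabel u (v + u) (A + v + (v + u))) (fun _ _ _ => ?_) (fun _ _ _ => ?_)
      (hasSum_sum_prod_pairLabel u (v + u) hnorm)) (by rw [h₁₁]; rfl)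
    · unfold pairLabel
      split_ifs <;> positivity
    · unfold pairLabel
      split_ifs
      exacts [e₂₂, e₂, e₂, e]
  · refine le_trans (isBranching_zIndex₁_mul_zIndex₂.tsum_node_le hx
      (fun _ i l => if l = i then v + u else A + v + (v + u)) (fun _ _ _ => ?_) (fun _ _ _ => ?_)
      (hasSum_sum_prod_ite (v + u) hnorm)) (by rw [h₁₂]; rfl)
    · split_ifs <;> positivity
    · split_ifs
      exacts [e₂, e]
  · refine le_trans ((isBranching_mul_unit isBranching_zIndex₂ isBranching_zIndex₂).tsum_node_le hx
      (fun _ _ _ => A + v + (v + u)) (fun _ _ _ => by positivity) (fun _ _ _ => e)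
      (hasSum_sum_prod_unit hnorm)) (by rw [h₂₂]; rfl)

/-- The functional equations for the series `ZZ`, on a disc with a solution of the equations at the
boundary. -/
theorem ZZ_system {x A v u : ℝ} (hx : 0 ≤ x) (hA : 0 ≤ A) (hv : 0 ≤ v) (hu : 0 ≤ u)
    (hlt : A + v + (v + u) < 1)
    (h₁₁ : x * (u / (1 - (A + v + (v + u))) ^ 2 +
      2 * (v + u) ^ 2 / (1 - (A + v + (v + u))) ^ 3) = A)
    (h₁₂ : x * ((v + u) / (1 - (A + v + (v + u))) ^ 2) = v)
    (h₂₂ : x * (1 / (1 - (A + v + (v + u)))) = u) {z : ℂ} (hz : ‖z‖ ≤ x) :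
    (Summable fun T => ‖term (fun T => T.zIndex * T.zIndex) z T‖) ∧
    ‖ZZ z‖ ≤ A + v + (v + u) ∧ ZZ z = ZZ₁₁ z + 2 * ZZ₁₂ z + ZZ₂₂ z ∧
    ZZ₁₁ z = z * ZZ₂₂ z / (1 - ZZ z) ^ 2 + 2 * z * (ZZ₁₂ z + ZZ₂₂ z) ^ 2 / (1 - ZZ z) ^ 3 ∧
    ZZ₁₂ z = z * (ZZ₁₂ z + ZZ₂₂ z) / (1 - ZZ z) ^ 2 ∧ ZZ₂₂ z = z / (1 - ZZ z) := by
  obtain ⟨b₁₁, b₁₂, b₂₂⟩ := zIndex_tsum_le hx hA hv hu hlt h₁₁ h₁₂ h₂₂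
  obtain ⟨s₁₁, n₁₁⟩ := summable_norm_term_of_tsum_le hx hA b₁₁ hz
  obtain ⟨s₁₂, n₁₂⟩ := summable_norm_term_of_tsum_le hx hv b₁₂ hz
  obtain ⟨s₂₂, n₂₂⟩ := summable_norm_term_of_tsum_le hx hu b₂₂ hz
  obtain ⟨s₂, t₂⟩ := summable_norm_term_add (w := fun T => T.zIndex₂ * T.zIndex)
    (w₁ := fun T => T.zIndex₁ * T.zIndex₂) (w₂ := fun T => T.zIndex₂ * T.zIndex₂)
    (fun T => by rw [zIndex_eq]; ring) s₁₂ s₂₂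
  obtain ⟨s₁, t₁⟩ := summable_norm_term_add (w := fun T => T.zIndex₁ * T.zIndex)
    (w₁ := fun T => T.zIndex₁ * T.zIndex₁) (w₂ := fun T => T.zIndex₁ * T.zIndex₂)
    (fun T => by rw [zIndex_eq]; ring) s₁₁ s₁₂
  obtain ⟨s, t⟩ := summable_norm_term_add (w := fun T => T.zIndex * T.zIndex)
    (fun T => zIndex_mul_left_eq _ T) s₁ s₂
  rw [t₁, t₂] at t
  change ‖ZZ₁₁ z‖ ≤ A at n₁₁
  change ‖ZZ₁₂ z‖ ≤ v at n₁₂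
  change ‖ZZ₂₂ z‖ ≤ u at n₂₂
  change ZZ z = ZZ₁₁ z + ZZ₁₂ z + (ZZ₁₂ z + ZZ₂₂ z) at t
  have n : ‖ZZ z‖ ≤ A + v + (v + u) := by
    rw [t]
    exact (norm_add_le _ _).trans (add_le_add ((norm_add_le _ _).trans (add_le_add n₁₁ n₁₂))
      ((norm_add_le _ _).trans (add_le_add n₁₂ n₂₂)))
  have n' := n.trans_lt hlt
  refine ⟨s, n, ?_, ?_, ?_, ?_⟩
  · rw [t]
    ring
  · have h := isBranching_zIndex₁_mul_zIndex₁.tsum_eq s₁₁.of_norm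
      (B := fun _ => pairLabel (ZZ₂₂ z) (ZZ₁₂ z + ZZ₂₂ z) (ZZ z)) (fun k e l => ?_)
      (fun k e l => ?_) (hasSum_sum_prod_pairLabel (ZZ₂₂ z) (ZZ₁₂ z + ZZ₂₂ z) n')
    · exact h.trans (by ring)
    · unfold pairLabel
      split_ifs
      exacts [s₂₂, s₂, s₂, s]
    · unfold pairLabel
      split_ifs
      exacts [rfl, t₂, t₂, rfl]
  · have h := isBranching_zIndex₁_mul_zIndex₂.tsum_eq s₁₂.of_norm
      (B := fun _ i l => if l = i then ZZ₁₂ z + ZZ₂₂ z else ZZ z) (fun k e l => ?_)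
      (fun k e l => ?_) (hasSum_sum_prod_ite (ZZ₁₂ z + ZZ₂₂ z) n')
    · exact h.trans (by ring)
    · split_ifs
      exacts [s₂, s]
    · split_ifs
      exacts [t₂, rfl]
  · exact (isBranching_mul_unit isBranching_zIndex₂ isBranching_zIndex₂).tsum_unit s₂₂ s n'

/-- The series of the `Z`-index converges at `z = x / (1 + x + x²)²` with `x = 3 / 7`, where
`1 / (1 - Z) = 1 + x + x²`. At this point `4 z²` exceeds the singularity
of `ZZ`. -/
theorem summable_zIndex : Summable (term zIndex ((1029 / 6241 : ℝ) : ℂ)) := by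
  have key := tsum_le_of_supersolution (ι := Fin 2)
    ![term zIndex₁ (ENNReal.ofReal (1029 / 6241)), term zIndex₂ (ENNReal.ofReal (1029 / 6241))]
    ![ENNReal.ofReal (9 / 79), ENNReal.ofReal (21 / 79)] ?_
  · have s₁ := (summable_norm_term_of_tsum_le (z := ((1029 / 6241 : ℝ) : ℂ)) (by norm_num)
      (by norm_num) (key 0) (by rw [Complex.norm_real]; norm_num)).1
    have s₂ := (summable_norm_term_of_tsum_le (z := ((1029 / 6241 : ℝ) : ℂ)) (by norm_num)
      (by norm_num) (key 1) (by rw [Complex.norm_real]; norm_num)).1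
    exact (summable_norm_term_add zIndex_eq s₁ s₂).1.of_norm
  intro E hE
  have e₁ := hE 0
  have e₂ := hE 1
  simp only [Matrix.cons_val] at e₁ e₂
  have e : ∑' T : E, term zIndex (ENNReal.ofReal (1029 / 6241)) T ≤
      ENNReal.ofReal (9 / 79 + 21 / 79) :=
    tsum_term_add_le zIndex_eq (by norm_num) (by norm_num) e₁ e₂
  intro i
  fin_cases i
  · refine le_trans (isBranching_zIndex₁.tsum_node_le (by norm_num)
      (fun _ i l => if l = i then 21 / 79 else 9 / 79 + 21 / 79) (fun _ _ _ => ?_)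
      (fun _ _ _ => ?_)
      (hasSum_sum_prod_ite (21 / 79) (by rw [Real.norm_of_nonneg] <;> norm_num))) (le_of_eq ?_)
    · split_ifs <;> norm_num
    · split_ifs
      exacts [e₂, e]
    · norm_num
  · refine le_trans (isBranching_zIndex₂.tsum_node_le (by norm_num)
      (fun _ _ _ => 9 / 79 + 21 / 79) (fun _ _ _ => by norm_num) (fun _ _ _ => e)
      (hasSum_sum_prod_unit (by rw [Real.norm_of_nonneg] <;> norm_num))) (le_of_eq ?_)
    norm_num

/-- The analysis of the series `ZZ` at the critical value `τ` of the uniformizing parameter. -/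
theorem ZZ_analysis {τ z₀ : ℝ} (hτ0 : 0 < τ) (hτ : τ < 1 / 4) (hL : zL τ = 1 / τ)
    (hz : z₀ = τ / zP τ ^ 2) (hl : 0 < 1 / τ ^ 2 + zL' τ) :
    0 < z₀ ∧ (∀ z : ℂ, ‖z‖ ≤ z₀ → Summable (term (fun T => T.zIndex * T.zIndex) z) ∧
      1 - ZZ z ≠ 0 ∧ ZZ z = ZZ₁₁ z + 2 * ZZ₁₂ z + ZZ₂₂ z ∧
      ZZ₁₁ z = z * ZZ₂₂ z / (1 - ZZ z) ^ 2 + 2 * z * (ZZ₁₂ z + ZZ₂₂ z) ^ 2 / (1 - ZZ z) ^ 3 ∧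
      ZZ₁₂ z = z * (ZZ₁₂ z + ZZ₂₂ z) / (1 - ZZ z) ^ 2 ∧ ZZ₂₂ z = z / (1 - ZZ z) ∧
      ∃ X, 1 - X ≠ 0 ∧ zP X ≠ 0 ∧ ZZ z = zH X ∧ z = X * (1 - ZZ z) ^ 2) ∧
    HasDominantSqrtSingularity ZZ z₀ (zH τ) (zH' τ * Real.sqrt (2 / (1 / τ ^ 2 + zL' τ))) := by
  have h1 : 0 < 1 - τ := by linarith
  have hP := zP_pos hτ0
  have hPτ : zP τ * (1 - τ) ^ 2 = (1 + τ + τ ^ 2) * (1 - τ) ^ 2 + 2 * τ ^ 2 := by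
    unfold zP
    field_simp
  have hz0 : 0 < z₀ := by
    rw [hz]
    positivity
  set p := zP τ with hp
  have hs : (τ ^ 2 + 2 * τ ^ 3 / (1 - τ) ^ 2) / p + τ ^ 2 / (p * (1 - τ)) +
      (τ ^ 2 / (p * (1 - τ)) + τ / p) = 1 - 1 / p := by
    field_simp
    linear_combination (-1) * hPτ
  -- The values of `ZZ₁₁`, `ZZ₁₂`, `ZZ₂₂` at `z₀` expected from the parametrization.
  have sys := fun (z : ℂ) (hz' : ‖z‖ ≤ z₀) => ZZ_system (x := z₀)
    (A := (τ ^ 2 + 2 * τ ^ 3 / (1 - τ) ^ 2) / p)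
    (v := τ ^ 2 / (p * (1 - τ))) (u := τ / p) hz0.le (by positivity) (by positivity)
    (by positivity)
    (by
      rw [hs]
      linarith [one_div_pos.2 hP])
    (by
      rw [hs, hz]
      field_simp
      ring)
    (by
      rw [hs, hz]
      field_simp
      ring)
    (by
      rw [hs, hz]
      field_simp
      ring) hz'
  rw [hs] at sys
  have par : ∀ z : ℂ, ‖z‖ ≤ z₀ → ‖z / (1 - ZZ z) ^ 2‖ ≤ τ ∧ 1 - ZZ z ≠ 0 ∧
      ZZ z = zH (z / (1 - ZZ z) ^ 2) ∧ (1 - ZZ z) * zP (z / (1 - ZZ z) ^ 2) = 1 := by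
    intro z hz'
    obtain ⟨-, n, e, e₁₁, e₁₂, e₂₂⟩ := sys z hz'
    have h2 := norm_sub_norm_le (1 : ℂ) (ZZ z)
    rw [norm_one] at h2
    have h3 : 1 / p ≤ ‖1 - ZZ z‖ := by linarith
    have h4 : 1 - ZZ z ≠ 0 := norm_pos_iff.1 ((one_div_pos.2 hP).trans_le h3)
    have hX : ‖z / (1 - ZZ z) ^ 2‖ ≤ τ := by
      rw [norm_div, norm_pow, div_le_iff₀ (pow_pos (norm_pos_iff.2 h4) 2)]
      calc ‖z‖ ≤ z₀ := hz'
        _ = τ * (1 / p) ^ 2 := by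
          rw [hz]
          ring
        _ ≤ _ := by gcongr
    have hdom := closedBall_subset_zDomain hτ (mem_closedBall_zero_iff.2 hX)
    have h5 := z_param h4 hdom.1 rfl e e₁₁ e₁₂ e₂₂
    refine ⟨hX, h4, ?_, h5⟩
    rw [zH, ← eq_one_div_of_mul_eq_one_left h5, sub_sub_cancel]
  refine ⟨hz0, fun z hz' => ?_, ?_⟩
  · obtain ⟨s, n, e, e₁₁, e₁₂, e₂₂⟩ := sys z hz'
    obtain ⟨p1, p2, p3, p4⟩ := par z hz'
    have hdom := closedBall_subset_zDomain hτ (mem_closedBall_zero_iff.2 p1)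
    refine ⟨s.of_norm, p2, e, e₁₁, e₁₂, e₂₂, _, hdom.1, hdom.2, p3, ?_⟩
    field_simp
  · have hsing : HasDominantSqrtSingularity (fun z => zH (z / (1 - ZZ z) ^ 2)) z₀ (zH τ)
        (zH' τ * Real.sqrt (2 / (1 / τ ^ 2 + zL' τ))) := by
      refine hasDominantSqrtSingularity_of_logDeriv (U := zDomain) (φ := fun x => zP x ^ 2)
        (L := zL) isOpen_zDomain (closedBall_subset_zDomain hτ) (fun x hx => hasDerivAt_zP_sq hx)
        (fun x hx => hasDerivAt_zL hx) (fun x hx => hasDerivAt_zH hx) hτ0 hz0 ?_ ?_ ?_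
        (ofReal_zL' τ).symm hl (ofReal_zH τ).symm (ofReal_zH' τ).symm ?_ ?_ ?_ ?_
      · simp [zP]
      · rw [← ofReal_zP, ← hp, hz]
        norm_cast
        field_simp
      · rw [← ofReal_zL, hL]
        push_cast
        rfl
      · simp only [zH', zP']
        positivity
      · intro x hx y hy hxy
        have h3 := mul_lt_mul_of_pos_left (norm_zP_sq_sub_lt hτ0 (by linarith) hx hy hxy) hz0
        rwa [hL, hz, ← hp, show τ / p ^ 2 * (p ^ 2 * (1 / τ) * ‖x - y‖) = ‖x - y‖ by field_simp,
          ← hz] at h3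
      · intro x hx hne
        have h3 := mul_lt_mul_of_pos_left (norm_zP_sq_mul_zL_lt hτ0 hτ hx hne) hz0
        rwa [hL, hz, ← hp, show τ / p ^ 2 * (p ^ 2 * (1 / τ)) = 1 by field_simp, ← hz] at h3
      · intro z hz'
        obtain ⟨p1, p2, p3, p4⟩ := par z hz'
        refine ⟨p1, ?_⟩
        rw [div_eq_iff (pow_ne_zero 2 p2), mul_assoc, ← mul_pow, mul_comm (zP _), p4]
        ring
    exact hsing.congr fun z hz => ((par z hz.le).2.2.1).symm

end OrderedTree

/-! ### The singularities of `SS` and `ZZ` and the variances -/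

theorem mainTheorem9 :
    (∃ z₀ a b : ℝ,
      |z₀ - 0.0873832| ≤ 5 / 10 ^ 8 ∧ |a - 0.614803| ≤ 5 / 10 ^ 7 ∧
      |b - 0.519010| ≤ 5 / 10 ^ 7 ∧
      OrderedTree.HasConvergenceRadius (fun T => T.sigma * T.sigma) z₀ ∧
      (∀ z : ℂ, ‖z‖ < z₀ →
        1 - OrderedTree.SS₂₂ z ≠ 0 ∧ 1 - OrderedTree.SS₁₂ z - OrderedTree.SS₂₂ z ≠ 0 ∧
        1 - OrderedTree.SS z ≠ 0 ∧
        OrderedTree.SS z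
          = OrderedTree.SS₁₁ z + 2 * OrderedTree.SS₁₂ z + OrderedTree.SS₂₂ z ∧
        OrderedTree.SS₁₁ z = z / (1 - OrderedTree.SS₂₂ z) ∧
        OrderedTree.SS₁₂ z = z / (1 - OrderedTree.SS₁₂ z - OrderedTree.SS₂₂ z) ∧
        OrderedTree.SS₂₂ z
          = z / (1 - OrderedTree.SS₁₁ z - 2 * OrderedTree.SS₁₂ z - OrderedTree.SS₂₂ z) ∧
        (OrderedTree.SS z) ^ 6 - 6 * (OrderedTree.SS z) ^ 5
          + (4 * z + 14) * (OrderedTree.SS z) ^ 4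
          + (8 * z ^ 2 - 20 * z - 16) * (OrderedTree.SS z) ^ 3
          + (4 * z ^ 3 - 30 * z ^ 2 + 36 * z + 9) * (OrderedTree.SS z) ^ 2
          - (12 * z ^ 3 - 36 * z ^ 2 + 28 * z + 2) * OrderedTree.SS z
          - (z ^ 4 - 8 * z ^ 3 + 14 * z ^ 2 - 8 * z) = 0) ∧
      HasDominantSqrtSingularity OrderedTree.SS z₀ a b ∧
      |2 * b - 1.03802| ≤ 5 / 10 ^ 6 ∧ |1 / (4 * z₀) - 2.86096| ≤ 5 / 10 ^ 6 ∧
      (fun n : ℕ =>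
          variance (fun T : OrderedTree => (T.sigma : ℝ)) (OrderedTree.uniformTree n))
        ~[atTop] fun n : ℕ => 2 * b * (1 / (4 * z₀)) ^ n) ∧
    (∃ z₀ a b : ℝ,
      |z₀ - 0.107969| ≤ 5 / 10 ^ 7 ∧ |a - 0.296221| ≤ 5 / 10 ^ 7 ∧
      |b - 0.386136| ≤ 5 / 10 ^ 7 ∧
      OrderedTree.HasConvergenceRadius (fun T => T.zIndex * T.zIndex) z₀ ∧
      (∀ z : ℂ, ‖z‖ < z₀ →
        1 - OrderedTree.ZZ z ≠ 0 ∧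
        OrderedTree.ZZ z
          = OrderedTree.ZZ₁₁ z + 2 * OrderedTree.ZZ₁₂ z + OrderedTree.ZZ₂₂ z ∧
        OrderedTree.ZZ₁₁ z
          = z * OrderedTree.ZZ₂₂ z / (1 - OrderedTree.ZZ z) ^ 2
            + 2 * z * (OrderedTree.ZZ₁₂ z + OrderedTree.ZZ₂₂ z) ^ 2
              / (1 - OrderedTree.ZZ z) ^ 3 ∧
        OrderedTree.ZZ₁₂ z
          = z * (OrderedTree.ZZ₁₂ z + OrderedTree.ZZ₂₂ z) / (1 - OrderedTree.ZZ z) ^ 2 ∧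
        OrderedTree.ZZ₂₂ z = z / (1 - OrderedTree.ZZ z) ∧
        (OrderedTree.ZZ z) ^ 8 - 7 * (OrderedTree.ZZ z) ^ 7
          - (z - 21) * (OrderedTree.ZZ z) ^ 6
          + (4 * z - 35) * (OrderedTree.ZZ z) ^ 5
          + (2 * z ^ 2 - 5 * z + 35) * (OrderedTree.ZZ z) ^ 4
          - (7 * z ^ 2 + 21) * (OrderedTree.ZZ z) ^ 3
          - (z ^ 3 - 9 * z ^ 2 - 5 * z - 7) * (OrderedTree.ZZ z) ^ 2
          + (2 * z ^ 3 - 5 * z ^ 2 - 4 * z - 1) * OrderedTree.ZZ z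
          + (z ^ 4 - z ^ 3 + z ^ 2 + z) = 0) ∧
      HasDominantSqrtSingularity OrderedTree.ZZ z₀ a b ∧
      |2 * b - 0.77227| ≤ 5 / 10 ^ 6 ∧ |1 / (4 * z₀) - 2.31549| ≤ 5 / 10 ^ 6 ∧
      (fun n : ℕ =>
          variance (fun T : OrderedTree => (T.zIndex : ℝ)) (OrderedTree.uniformTree n))
        ~[atTop] fun n : ℕ => 2 * b * (1 / (4 * z₀)) ^ n) := by
  constructor
  · obtain ⟨τ, hτ, hL⟩ := exists_sigTau
    obtain ⟨nz, na, hl, nb⟩ := sig_numerics hτ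
    have hτ0 : 0 < τ := lt_of_lt_of_le (by norm_num) hτ.1
    have hτ1 : τ < 1 / 5 := lt_of_le_of_lt hτ.2 (by norm_num)
    obtain ⟨hz0, heq, hsing⟩ := OrderedTree.SS_analysis hτ0 hτ1 hL rfl hl
    have hsum : ∀ z : ℂ, ‖z‖ < τ / sigPhi τ →
        Summable (OrderedTree.term (fun T => T.sigma * T.sigma) z) := fun z hz => (heq z hz.le).1
    refine ⟨_, _, _, ?_, ?_, ?_,
      OrderedTree.hasConvergenceRadius_of_hasDominantSqrtSingularity hsum hsing,
      fun z hz => ?_, hsing, ?_, ?_, OrderedTree.variance_isEquivalent (ρ := 4 / 27)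
        (by norm_num) hsum hsing OrderedTree.summable_sigma (lt_of_le_of_lt nz.2 (by norm_num))⟩
    · rw [abs_le]
      constructor <;> linarith [nz.1, nz.2]
    · rw [abs_le]
      constructor <;> linarith [na.1, na.2]
    · rw [abs_le]
      constructor <;> linarith [nb.1, nb.2]
    · obtain ⟨-, d₂₂, d₁₂, d, e, e₁₁, e₁₂, e₂₂, X, hX, hS, hzX⟩ := heq z hz.le
      rw [← sub_sub] at d₁₂
      rw [← sub_sub] at e₁₂
      refine ⟨d₂₂, d₁₂, d, e, e₁₁, e₁₂, ?_, sig_sextic hX hS hzX⟩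
      rwa [e, ← sub_sub, ← sub_sub] at e₂₂
    · rw [abs_le]
      constructor <;> linarith [nb.1, nb.2]
    · have h := div_mem_Icc_div zero_le_one (by norm_num) ⟨le_refl (1 : ℝ), le_refl 1⟩
        (mul_mem_Icc_mul (by norm_num) (by norm_num) ⟨le_refl (4 : ℝ), le_refl 4⟩ nz)
      rw [abs_le]
      constructor <;> linarith [h.1, h.2]
  · obtain ⟨τ, hτ, hL⟩ := exists_zTau
    obtain ⟨nz, na, hl, nb⟩ := z_numerics hτ
    have hτ0 : 0 < τ := lt_of_lt_of_le (by norm_num) hτ.1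
    have hτ1 : τ < 1 / 4 := lt_of_le_of_lt hτ.2 (by norm_num)
    obtain ⟨hz0, heq, hsing⟩ := OrderedTree.ZZ_analysis hτ0 hτ1 hL rfl hl
    have hsum : ∀ z : ℂ, ‖z‖ < τ / zP τ ^ 2 →
        Summable (OrderedTree.term (fun T => T.zIndex * T.zIndex) z) := fun z hz => (heq z hz.le).1
    refine ⟨_, _, _, ?_, ?_, ?_,
      OrderedTree.hasConvergenceRadius_of_hasDominantSqrtSingularity hsum hsing,
      fun z hz => ?_, hsing, ?_, ?_, OrderedTree.variance_isEquivalent (ρ := 1029 / 6241)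
        (by norm_num) hsum hsing OrderedTree.summable_zIndex (lt_of_le_of_lt nz.2 (by norm_num))⟩
    · rw [abs_le]
      constructor <;> linarith [nz.1, nz.2]
    · rw [abs_le]
      constructor <;> linarith [na.1, na.2]
    · rw [abs_le]
      constructor <;> linarith [nb.1, nb.2]
    · obtain ⟨-, d, e, e₁₁, e₁₂, e₂₂, X, hX, hP, hS, hzX⟩ := heq z hz.le
      exact ⟨d, e, e₁₁, e₁₂, e₂₂, z_octic hX hP hS hzX⟩
    · rw [abs_le]
      constructor <;> linarith [nb.1, nb.2]
    · have h := div_mem_Icc_div zero_le_one (by norm_num) ⟨le_refl (1 : ℝ), le_refl 1⟩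
        (mul_mem_Icc_mul (by norm_num) (by norm_num) ⟨le_refl (4 : ℝ), le_refl 4⟩ nz)
      rw [abs_le]
      constructor <;> linarith [h.1, h.2]
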